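/- Let $\mathsf T$ be a triangulation of the 2-sphere (a finite simplicial complex) with vertex set $V$, and let the punctured sphere $\mathsf T\setminus V$ be equipped with a hyperbolic metric with cusps at the vertices for which $\mathsf T$ is an ideal triangulation; that is, each triangle of $\mathsf T$ (without its vertices) is isometric to an ideal hyperbolic triangle, the metrics of adjacent triangles agree on their common edge, and around each vertex the triangles' horocyclic arcs can be chosen so that they close up to closed horocycles. A \emph{realization} is an embedding $f$ of $\mathsf T$ in the closed ball $H^3\cup\partial_\infty H^3$ that maps the vertices to ideal points, maps $\mathsf T\setminus V$ into $H^3$, and maps each ideal triangle of $\mathsf T$ isometrically onto a totally geodesic ideal triangle in $H^3$; together with the solid (not necessarily convex) ideal hyperbolic polyhedron $P$ bounded by the image. (So $f$ is an isometric embedding of $\mathsf T$ as the boundary of an ideal polyhedron, all of whose edges are edges of $\mathsf T$.) For a vertex $l\in V$, the realization is \emph{star-shaped with respect to $l$} if for every point $p\in P$ the geodesic from $p$ to the ideal point $f(l)$ is contained in $P$. Theorem. For every vertex $l$ of $\mathsf T$ there is, up to isometries of $H^3$, at most one realization that is star-shaped with respect to $l$: if $(f,P)$ and $(f',P')$ are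 two such realizations, then there is an isometry $\varphi$ of $H^3$ (possibly orientation reversing) such that $f'=\varphi\circ f$ on $\mathsf T\setminus V$ and $P'=\varphi(P)$. -/

import Mathlib

noncomputable section

/-! ### Hyperbolic space in the Klein model -/

/-- Hyperbolic `n`-space in the Klein (projective) model: the open unit ball of Euclidean `n`-space.
Hyperbolic geodesics are straight chords, the ideal boundary is the unit sphere, and an ideal
triangle is a Euclidean triangle with vertices on the unit sphere, minus these vertices. -/
def hypSpace (n : ℕ) : Set (EuclideanSpace ℝ (Fin n)) := Metric.ball 0 1

/-- The hyperbolic distance (curvature `-1`) of two points of the Klein model. -/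
def hypDist {n : ℕ} (x y : EuclideanSpace ℝ (Fin n)) : ℝ :=
  Real.arcosh ((1 - inner ℝ x y) / (√(1 - ‖x‖ ^ 2) * √(1 - ‖y‖ ^ 2)))

/-- The Busemann function of the ideal point `ξ`; its level sets are the horospheres
(horocycles, if `n = 2`) centered at `ξ`. -/
def busemann {n : ℕ} (ξ x : EuclideanSpace ℝ (Fin n)) : ℝ :=
  Real.log ((1 - inner ℝ ξ x) / √(1 - ‖x‖ ^ 2))

/-- `φ` restricts to an isometry of hyperbolic `n`-space onto itself (orientation preserving or
not). -/
def IsHypIsometry {n : ℕ} (φ : EuclideanSpace ℝ (Fin n) → EuclideanSpace ℝ (Fin n)) : Prop :=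
  Set.BijOn φ (hypSpace n) (hypSpace n) ∧
    ∀ x ∈ hypSpace n, ∀ y ∈ hypSpace n, hypDist (φ x) (φ y) = hypDist x y

/-! ### Triangulations of the sphere -/

/-- A triangulation of the sphere with vertex set `V` that is a simplicial complex, given by its
triangles: a connected closed combinatorial surface with Euler characteristic `2`. -/
structure SphereTriangulation (V : Type*) [Fintype V] [DecidableEq V] where
  /-- the triangles -/
  faces : Finset (Finset V)
  card_of_mem_faces : ∀ t ∈ faces, t.card = 3
  /-- every vertex lies in a triangle -/
  exists_face : ∀ i : V, ∃ t ∈ faces, i ∈ t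
  /-- every edge lies in exactly two triangles -/
  card_faces_of_edge : ∀ e : Finset V, e.card = 2 → (∃ t ∈ faces, e ⊆ t) →
    (faces.filter (fun t => e ⊆ t)).card = 2
  /-- every vertex link is connected (hence a single cycle, since it is 2-regular) -/
  link_connected : ∀ i j k : V, (∃ t ∈ faces, i ∈ t ∧ j ∈ t) → (∃ t ∈ faces, i ∈ t ∧ k ∈ t) →
    j ≠ i → k ≠ i →
    Relation.ReflTransGen (fun a b => ({i, a, b} : Finset V) ∈ faces) j k
  /-- the surface is connected -/
  connected : ∀ i j : V, Relation.ReflTransGen (fun a b => ∃ t ∈ faces, a ∈ t ∧ b ∈ t) i j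
  /-- the Euler characteristic is `2` -/
  euler : (Fintype.card V : ℤ)
    - ((Finset.univ.filter
        (fun e : Finset V => e.card = 2 ∧ ∃ t ∈ faces, e ⊆ t)).card : ℤ)
    + (faces.card : ℤ) = 2

section Realization

variable {V : Type*} [Fintype V] [DecidableEq V]

/-- The point of the geometric realization (barycentric coordinates) that is the vertex `i`. -/
def vertexPt (i : V) : V → ℝ := Pi.single i 1

/-- The closed simplex with vertex set `s`, in barycentric coordinates. -/
def simplexSet (s : Finset V) : Set (V → ℝ) :=
  {w | (∀ i, 0 ≤ w i) ∧ ∑ i, w i = 1 ∧ ∀ i, i ∉ s → w i = 0}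

/-- The simplex with vertex set `s` without its vertices. -/
def puncturedSimplex (s : Finset V) : Set (V → ℝ) := simplexSet s \ Set.range vertexPt

namespace SphereTriangulation

/-- The geometric realization of the triangulation, a topological sphere. -/
def carrier (T : SphereTriangulation V) : Set (V → ℝ) := ⋃ t ∈ T.faces, simplexSet t

/-- The punctured sphere: the geometric realization without the vertices. -/
def punctured (T : SphereTriangulation V) : Set (V → ℝ) := T.carrier \ Set.range vertexPt

end SphereTriangulation

/-- A hyperbolic metric with cusps at the vertices on the punctured sphere of `T`, for which `T` is
an ideal triangulation. The metric is given by charts: every triangle (without its vertices) is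
identified with an ideal hyperbolic triangle in such a way that the metrics of neighboring
triangles agree on the common edge. -/
structure CuspMetric (T : SphereTriangulation V) where
  /-- the chart that identifies the triangle `t` with an ideal triangle in `H²` -/
  chart : Finset V → (V → ℝ) → EuclideanSpace ℝ (Fin 2)
  continuousOn_chart : ∀ t ∈ T.faces, ContinuousOn (chart t) (simplexSet t)
  /-- the vertices go to ideal points -/
  norm_chart_vertex : ∀ t ∈ T.faces, ∀ i ∈ t, ‖chart t (vertexPt i)‖ = 1
  /-- the chart is a bijection of the triangle onto the triangle spanned by the ideal points
  that correspond to its vertices, and maps edges to edges -/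
  bijOn_chart : ∀ t ∈ T.faces, ∀ s ⊆ t, Set.BijOn (chart t) (simplexSet s)
    (convexHull ℝ ((fun i => chart t (vertexPt i)) '' (s : Set V)))
  /-- the metrics of two triangles agree on their intersection -/
  glue : ∀ s ∈ T.faces, ∀ t ∈ T.faces, ∀ x ∈ puncturedSimplex s ∩ puncturedSimplex t,
    ∀ y ∈ puncturedSimplex s ∩ puncturedSimplex t,
      hypDist (chart s x) (chart s y) = hypDist (chart t x) (chart t y)
  /-- every puncture is a cusp: the pieces of horocycles centered at the vertex `i` in the
  triangles around `i` can be chosen so that they fit together to closed horocycles, that is,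
  there is a function around `i` which in every triangle is a Busemann function at `i` up to an
  additive constant -/
  cusp : ∀ i : V, ∃ β : (V → ℝ) → ℝ, ∀ t ∈ T.faces, i ∈ t → ∃ c : ℝ,
    ∀ x ∈ puncturedSimplex t, β x = busemann (chart t (vertexPt i)) (chart t x) + c

/-- A realization of the ideal triangulation `T` with hyperbolic cusp metric `M` as a (not
necessarily convex) ideal polyhedron in `H³`, all of whose edges are edges of `T`. -/
structure IdealRealization (T : SphereTriangulation V) (M : CuspMetric T) where
  /-- the embedding of the sphere in the closed ball -/
  toFun : (V → ℝ) → EuclideanSpace ℝ (Fin 3)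
  continuousOn_toFun : ContinuousOn toFun T.carrier
  injOn_toFun : Set.InjOn toFun T.carrier
  /-- the vertices are ideal points -/
  norm_vertex : ∀ i : V, ‖toFun (vertexPt i)‖ = 1
  /-- the punctured sphere is mapped to hyperbolic space -/
  mapsTo_hypSpace : Set.MapsTo toFun T.punctured (hypSpace 3)
  /-- every triangle of `T` is mapped isometrically to `H³`; so the embedding is isometric for the
  intrinsic metrics, and the image of every triangle is a (flat) ideal triangle, so that the
  surface can be bent only along edges of `T` -/
  isometric : ∀ t ∈ T.faces, ∀ x ∈ puncturedSimplex t, ∀ y ∈ puncturedSimplex t,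
    hypDist (toFun x) (toFun y) = hypDist (M.chart t x) (M.chart t y)
  /-- the solid polyhedron (together with its ideal vertices) bounded by the embedded surface -/
  body : Set (EuclideanSpace ℝ (Fin 3))
  isCompact_body : IsCompact body
  closure_interior_body : closure (interior body) = body
  frontier_body : frontier body = toFun '' T.carrier

/-- The polyhedron is star-shaped with respect to its ideal vertex `l`: with every point it contains
the geodesic from that point to the ideal point `l` (in the Klein model, a straight segment). -/
def IdealRealization.IsStarShapedAt {T : SphereTriangulation V} {M : CuspMetric T}
    (R : IdealRealization T M) (l : V) : Prop :=
  StarConvex ℝ (R.toFun (vertexPt l)) R.body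

end Realization

end

set_option linter.unusedSectionVars false

noncomputable section

open Filter Topology

/-! ### The Klein model: hyperbolic cosine of the distance and horospherical functions -/

/-! Move the ideal point of `l` to `north` and use half-space coordinates with `north` at infinity.
Every other ideal vertex becomes a point of the plane (`drawing`), and a face without `l` projects
to a Euclidean triangle, which is flat when the face is vertical. Star-shapedness says that rays
from `north` leave the body at most once; hence the projected triangles are never negatively
oriented and do not overlap (`isDrawing`). Edges of vertical faces that would cross are excluded
because the surface is embedded.

The intrinsic metric of an ideal triangle determines its image up to one horospherical factor per
vertex. Comparing two realizations, these factors depend on the vertex only (`scale_eq`), and `1 -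
inner` of the endpoints of an edge is multiplied by the factors of its ends. For the drawings this
means that the squared edge lengths are multiplied by `τ i * τ j`: the drawings are discretely
conformally equivalent. The edges ending at `l` force `τ` to have the same value `κ` at all
neighbors of `l`, so after rescaling the logarithmic factor `δ` vanishes on the boundary of the
drawing.

The planar problem is a rigidity statement (`conformal_factor_eq_zero`). At a vertex that is not a
neighbor of `l` the angles add up to `2π` in both drawings (`angle_sum`), so the sum of angle change
times `δ` over all corners is zero. Grouped by triangles it is a sum of nonpositive terms, since the
angles of a triangle are a monotone function of the logarithmic side lengths (`IsTriangle.mono`,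
essentially convexity of the functional whose Hessian is the cotangent form). So every term
vanishes. Then on each triangle `δ` is constant, or the triangle is flat in both drawings with the
same longest side, and there `exp (-δ / 2)` at the middle vertex is an affine interpolation of the
two ends. A maximum principle (`exists_ge_of_edge`), again based on the angle sum, gives `δ = 0`.

The drawings therefore differ by a similarity, once the two orientations of the sphere induced by
the bodies agree; they agree or are opposite (`agree_or_opposite`), and a reflection repairs the
second case. The similarity extends to an isometry of hyperbolic space (`simMap`). It matches the
faces because isometric maps of ideal triangles are projective with weights given by the scale
factors (`SameMetric.eq_sum`), and it matches the bodies because each body point lies on a segment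
from `north` to the surface. -/

/-- The hyperbolic cosine of the distance in the Klein model. -/
def hypCosh {n : ℕ} (x y : EuclideanSpace ℝ (Fin n)) : ℝ :=
  (1 - inner ℝ x y) / (√(1 - ‖x‖ ^ 2) * √(1 - ‖y‖ ^ 2))

/-- The exponential of the Busemann function. -/
def horo {n : ℕ} (ξ x : EuclideanSpace ℝ (Fin n)) : ℝ :=
  (1 - inner ℝ ξ x) / √(1 - ‖x‖ ^ 2)

section Klein

variable {n : ℕ}

theorem mem_hypSpace {x : EuclideanSpace ℝ (Fin n)} : x ∈ hypSpace n ↔ ‖x‖ < 1 := by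
  simp [hypSpace]

theorem sqrt_one_sub_pos {x : EuclideanSpace ℝ (Fin n)} (hx : x ∈ hypSpace n) :
    0 < √(1 - ‖x‖ ^ 2) := by
  rw [mem_hypSpace] at hx
  apply Real.sqrt_pos.2
  nlinarith [norm_nonneg x]

theorem inner_lt_one {ξ x : EuclideanSpace ℝ (Fin n)} (hξ : ‖ξ‖ ≤ 1) (hx : x ∈ hypSpace n) :
    inner ℝ ξ x < 1 := by
  rw [mem_hypSpace] at hx
  have := real_inner_le_norm ξ x
  nlinarith [norm_nonneg x, norm_nonneg ξ]

theorem horo_pos {ξ x : EuclideanSpace ℝ (Fin n)} (hξ : ‖ξ‖ = 1) (hx : x ∈ hypSpace n) :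
    0 < horo ξ x :=
  div_pos (by linarith [inner_lt_one hξ.le hx]) (sqrt_one_sub_pos hx)

/-- Reversed Cauchy-Schwarz inequality of Minkowski space, from `(1 - ab)² - (1 - a²)(1 - b²) = (a -
b)²` for the two norms. -/
theorem one_le_hypCosh {x y : EuclideanSpace ℝ (Fin n)} (hx : x ∈ hypSpace n)
    (hy : y ∈ hypSpace n) : 1 ≤ hypCosh x y := by
  have h1 := sqrt_one_sub_pos hx
  have h2 := sqrt_one_sub_pos hy
  rw [hypCosh, one_le_div (mul_pos h1 h2)]
  have h3 := real_inner_le_norm x y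
  rw [mem_hypSpace] at hx hy
  rw [← Real.sqrt_mul (by nlinarith [norm_nonneg x])]
  apply Real.sqrt_le_iff.2
  have h4 : ‖x‖ * ‖y‖ ≤ 1 := by nlinarith [norm_nonneg x, norm_nonneg y]
  constructor
  · linarith
  · nlinarith [sq_nonneg (‖x‖ - ‖y‖)]

/-- Equality case of the reversed Cauchy-Schwarz inequality. In `SameMetric.eq_sum` it identifies an
unknown point with a candidate by a single distance computation. -/
theorem eq_of_hypCosh_eq_one {x y : EuclideanSpace ℝ (Fin n)} (hx : x ∈ hypSpace n)
    (hy : y ∈ hypSpace n) (h : hypCosh x y = 1) : x = y := by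
  have h1 := sqrt_one_sub_pos hx
  have h2 := sqrt_one_sub_pos hy
  rw [hypCosh, div_eq_one_iff_eq (mul_pos h1 h2).ne'] at h
  have h3 := real_inner_le_norm x y
  rw [mem_hypSpace] at hx hy
  have h4 : ‖x‖ * ‖y‖ ≤ 1 := by nlinarith [norm_nonneg x, norm_nonneg y]
  have h5 : (1 - inner ℝ x y) ^ 2 = (1 - ‖x‖ ^ 2) * (1 - ‖y‖ ^ 2) := by
    rw [h, mul_pow, Real.sq_sqrt (by nlinarith [norm_nonneg x]),
      Real.sq_sqrt (by nlinarith [norm_nonneg y])]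
  have h6 : ‖x - y‖ ^ 2 = ‖x‖ ^ 2 - 2 * inner ℝ x y + ‖y‖ ^ 2 := norm_sub_sq_real x y
  have h7 : inner ℝ x y = ‖x‖ * ‖y‖ := by
    nlinarith [sq_nonneg (‖x‖ - ‖y‖), mul_nonneg (sub_nonneg.2 h3) (sub_nonneg.2 h4)]
  have h8 : ‖x - y‖ ^ 2 = 0 := by
    rw [h7] at h5 h6
    nlinarith
  rw [← sub_eq_zero, ← norm_eq_zero]
  exact pow_eq_zero_iff (two_ne_zero) |>.1 h8

theorem hypCosh_eq_of_hypDist_eq {m : ℕ} {x y : EuclideanSpace ℝ (Fin n)}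
    {x' y' : EuclideanSpace ℝ (Fin m)} (hx : x ∈ hypSpace n) (hy : y ∈ hypSpace n)
    (hx' : x' ∈ hypSpace m) (hy' : y' ∈ hypSpace m) (h : hypDist x y = hypDist x' y') :
    hypCosh x y = hypCosh x' y' :=
  Real.arcosh_injOn (one_le_hypCosh hx hy) (one_le_hypCosh hx' hy') h

theorem inner_lt_one_of_ne {ξ η : EuclideanSpace ℝ (Fin n)} (hξ : ‖ξ‖ = 1) (hη : ‖η‖ = 1)
    (h : ξ ≠ η) : inner ℝ ξ η < 1 :=
  inner_lt_one_iff_real_of_norm_eq_one hξ hη |>.2 h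

variable {ι : Type*}

/-- For weights of total one, `1 - inner` behaves like a bilinear form: it is minus the Minkowski
product of the lifts `(1, v)` and `(1, p)`. This turns distance computations into sums over ideal
vertices. -/
theorem one_sub_inner_sum (t : Finset ι) (w : ι → ℝ) (η : ι → EuclideanSpace ℝ (Fin n))
    (v : EuclideanSpace ℝ (Fin n)) (hw : ∑ i ∈ t, w i = 1) :
    1 - inner ℝ v (∑ i ∈ t, w i • η i) = ∑ i ∈ t, w i * (1 - inner ℝ v (η i)) := by
  simp only [inner_sum, inner_smul_right, mul_sub, Finset.sum_sub_distrib, mul_one, hw]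

theorem one_sub_inner_sum' (t : Finset ι) (w : ι → ℝ) (η : ι → EuclideanSpace ℝ (Fin n))
    (v : EuclideanSpace ℝ (Fin n)) (hw : ∑ i ∈ t, w i = 1) :
    1 - inner ℝ (∑ i ∈ t, w i • η i) v = ∑ i ∈ t, w i * (1 - inner ℝ (η i) v) := by
  rw [real_inner_comm, one_sub_inner_sum t w η v hw]
  simp only [real_inner_comm]

/-- A convex combination of distinct ideal points, with at least two of them, lies in hyperbolic
space. -/
theorem sum_mem_hypSpace (t : Finset ι) (w : ι → ℝ) (η : ι → EuclideanSpace ℝ (Fin n))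
    (hw : ∑ i ∈ t, w i = 1) (hw0 : ∀ i ∈ t, 0 ≤ w i) (hη : ∀ i ∈ t, ‖η i‖ = 1)
    {a b : ι} (ha : a ∈ t) (hb : b ∈ t) (hab : η a ≠ η b) (hwa : 0 < w a) (hwb : 0 < w b) :
    ∑ i ∈ t, w i • η i ∈ hypSpace n := by
  -- Expanded bilinearly, the quantity is the sum of `w i * w j * (1 - inner (η i) (η j))`. No term
  -- is negative, and the pair `a, b` gives a positive one.
  have key : 0 < 1 - ‖∑ i ∈ t, w i • η i‖ ^ 2 := by
    rw [← real_inner_self_eq_norm_sq, one_sub_inner_sum' t w η _ hw]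
    have h0 : ∀ i ∈ t, ∀ j ∈ t, 0 ≤ 1 - inner ℝ (η i) (η j) := fun i hi j hj => by
      have := real_inner_le_norm (η i) (η j)
      rw [hη i hi, hη j hj] at this
      linarith
    refine Finset.sum_pos' (fun i hi => mul_nonneg (hw0 i hi) ?_) ⟨a, ha, mul_pos hwa ?_⟩
    · rw [one_sub_inner_sum t w η _ hw]
      exact Finset.sum_nonneg fun j hj => mul_nonneg (hw0 j hj) (h0 i hi j hj)
    · rw [one_sub_inner_sum t w η _ hw]
      refine Finset.sum_pos' (fun j hj => mul_nonneg (hw0 j hj) (h0 a ha j hj))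
        ⟨b, hb, mul_pos hwb ?_⟩
      linarith [inner_lt_one_of_ne (hη a ha) (hη b hb) hab]
  rw [mem_hypSpace]
  nlinarith [norm_nonneg (∑ i ∈ t, w i • η i)]

end Klein

/-! ### Simplices -/

section Simplices

variable {V : Type*} [Fintype V] [DecidableEq V]

theorem vertexPt_mem_simplexSet {i : V} {s : Finset V} (hi : i ∈ s) : vertexPt i ∈ simplexSet s := by
  refine ⟨fun j => ?_, ?_, fun j hj => ?_⟩
  · unfold vertexPt; by_cases h : j = i
    · subst h; simp
    · simp [h]
  · simp [vertexPt]
  · have : j ≠ i := fun h => hj (h ▸ hi)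
    simp [vertexPt, this]

theorem simplexSet_mono {s t : Finset V} (h : s ⊆ t) : simplexSet s ⊆ simplexSet t :=
  fun _ hw => ⟨hw.1, hw.2.1, fun i hi => hw.2.2 i fun h' => hi (h h')⟩

theorem simplexSet_inter (s t : Finset V) : simplexSet s ∩ simplexSet t = simplexSet (s ∩ t) := by
  ext w
  constructor
  · rintro ⟨h, h'⟩
    refine ⟨h.1, h.2.1, fun i hi => ?_⟩
    by_cases his : i ∈ s
    · exact h'.2.2 i fun hit => hi (Finset.mem_inter.2 ⟨his, hit⟩)
    · exact h.2.2 i his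
  · exact fun h => ⟨simplexSet_mono Finset.inter_subset_left h,
      simplexSet_mono Finset.inter_subset_right h⟩

theorem convex_simplexSet (s : Finset V) : Convex ℝ (simplexSet s) := by
  intro x hx y hy a b ha hb hab
  refine ⟨fun i => ?_, ?_, fun i hi => ?_⟩
  · simpa using add_nonneg (mul_nonneg ha (hx.1 i)) (mul_nonneg hb (hy.1 i))
  · simp [Finset.sum_add_distrib, ← Finset.mul_sum, hx.2.1, hy.2.1, hab]
  · simp [hx.2.2 i hi, hy.2.2 i hi]

theorem sum_simplexSet {s : Finset V} {w : V → ℝ} (hw : w ∈ simplexSet s) : ∑ i ∈ s, w i = 1 := by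
  rw [← hw.2.1]
  exact Finset.sum_subset (Finset.subset_univ _) fun i _ hi => hw.2.2 i hi

theorem eq_vertexPt_of_apply_eq_one {s : Finset V} {w : V → ℝ} (hw : w ∈ simplexSet s) {i : V}
    (h : w i = 1) : w = vertexPt i := by
  have h1 : ∑ j ∈ Finset.univ.erase i, w j = 0 := by
    have := Finset.add_sum_erase Finset.univ w (Finset.mem_univ i)
    rw [hw.2.1, h] at this
    linarith
  rw [Finset.sum_eq_zero_iff_of_nonneg fun j _ => hw.1 j] at h1
  ext j
  by_cases hj : j = i
  · subst hj; simp [vertexPt, h]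
  · simp [vertexPt, hj, h1 j (by simp [hj])]

/-- Two positive weights of a point of a simplex that is not a vertex. -/
theorem exists_two_pos {s : Finset V} {w : V → ℝ} (hw : w ∈ puncturedSimplex s) :
    ∃ a ∈ s, ∃ b ∈ s, a ≠ b ∧ 0 < w a ∧ 0 < w b := by
  have h1 := sum_simplexSet hw.1
  obtain ⟨a, ha, hwa⟩ : ∃ a ∈ s, 0 < w a := by
    by_contra! h
    have := Finset.sum_nonpos h
    linarith
  by_contra! h
  refine hw.2 ⟨a, (eq_vertexPt_of_apply_eq_one hw.1 ?_).symm⟩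
  rw [← h1]
  refine (Finset.sum_eq_single_of_mem a ha fun b hb hba => ?_).symm
  exact le_antisymm (h a ha b hb hba.symm hwa) (hw.1.1 b)

/-- The segment from the vertex `i` to the point `x`. -/
def toVertex (i : V) (x : V → ℝ) (s : ℝ) : V → ℝ := (1 - s) • vertexPt i + s • x

theorem toVertex_mem {t : Finset V} {i : V} (hi : i ∈ t) {x : V → ℝ} (hx : x ∈ puncturedSimplex t)
    {s : ℝ} (hs : s ∈ Set.Ioo (0 : ℝ) 1) : toVertex i x s ∈ puncturedSimplex t := by
  refine ⟨convex_simplexSet t (vertexPt_mem_simplexSet hi) hx.1 (by linarith [hs.2]) hs.1.le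
    (by ring), ?_⟩
  rintro ⟨j, hj⟩
  have hji := congrFun hj i
  have hii : (vertexPt i : V → ℝ) i = 1 := by simp [vertexPt]
  simp only [toVertex, Pi.add_apply, Pi.smul_apply, smul_eq_mul, hii] at hji
  by_cases h : j = i
  · subst h
    rw [hii] at hji
    have : x j = 1 := by
      have : s * x j = s * 1 := by linarith
      exact mul_left_cancel₀ hs.1.ne' this
    exact hx.2 ⟨j, (eq_vertexPt_of_apply_eq_one hx.1 this).symm⟩
  · have : (vertexPt j : V → ℝ) i = 0 := by simp [vertexPt, Ne.symm h]
    rw [this] at hji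
    nlinarith [mul_nonneg hs.1.le (hx.1.1 i), hs.2]

theorem tendsto_toVertex (i : V) (x : V → ℝ) :
    Tendsto (toVertex i x) (𝓝[>] 0) (𝓝 (vertexPt i)) := by
  have : Continuous (toVertex i x) := by unfold toVertex; fun_prop
  have h := (this.tendsto 0).mono_left (nhdsWithin_le_nhds (s := Set.Ioi 0))
  simpa [toVertex] using h

end Simplices

/-! ### Isometric maps of an ideal triangle -/

section Transfer

variable {V : Type*} [Fintype V] [DecidableEq V] {n m : ℕ}

/-- A map of a triangle that sends vertices to distinct ideal points and the rest into hyperbolic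
space. -/
structure IsIdealMap (t : Finset V) (F : (V → ℝ) → EuclideanSpace ℝ (Fin n)) : Prop where
  cont : ContinuousOn F (simplexSet t)
  norm_vertex : ∀ i ∈ t, ‖F (vertexPt i)‖ = 1
  inj_vertex : ∀ i ∈ t, ∀ j ∈ t, F (vertexPt i) = F (vertexPt j) → i = j
  maps : ∀ x ∈ puncturedSimplex t, F x ∈ hypSpace n

variable {t : Finset V} {F : (V → ℝ) → EuclideanSpace ℝ (Fin n)}
  {G : (V → ℝ) → EuclideanSpace ℝ (Fin m)}

theorem IsIdealMap.tendsto (hF : IsIdealMap t F) {i : V} (hi : i ∈ t) {x : V → ℝ}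
    (hx : x ∈ puncturedSimplex t) :
    Tendsto (fun s => F (toVertex i x s)) (𝓝[>] 0) (𝓝 (F (vertexPt i))) := by
  refine (hF.cont _ (vertexPt_mem_simplexSet hi)).tendsto.comp ?_
  rw [tendsto_nhdsWithin_iff]
  refine ⟨tendsto_toVertex i x, ?_⟩
  filter_upwards [Ioo_mem_nhdsGT (zero_lt_one' ℝ)] with s hs
  exact (toVertex_mem hi hx hs).1

/-- The root belonging to the moving point cancels in the quotient, so it has a finite limit. Hence
distances determine horospherical functions up to a factor. -/
theorem IsIdealMap.tendsto_ratio (hF : IsIdealMap t F) {i : V} (hi : i ∈ t) {x y z : V → ℝ}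
    (hx : x ∈ puncturedSimplex t) (hy : y ∈ puncturedSimplex t) (hz : z ∈ puncturedSimplex t) :
    Tendsto (fun s => hypCosh (F x) (F (toVertex i z s)) / hypCosh (F y) (F (toVertex i z s)))
      (𝓝[>] 0) (𝓝 (horo (F (vertexPt i)) (F x) / horo (F (vertexPt i)) (F y))) := by
  have h1 : ∀ u ∈ puncturedSimplex t, Tendsto
      (fun s => (1 - inner ℝ (F (toVertex i z s)) (F u)) / √(1 - ‖F u‖ ^ 2)) (𝓝[>] 0)
      (𝓝 (horo (F (vertexPt i)) (F u))) := fun u hu =>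
    (tendsto_const_nhds.sub ((hF.tendsto hi hz).inner tendsto_const_nhds)).div_const _
  refine ((h1 x hx).div (h1 y hy) (horo_pos (hF.norm_vertex i hi) (hF.maps y hy)).ne').congr' ?_
  filter_upwards [Ioo_mem_nhdsGT (zero_lt_one' ℝ)] with s hs
  have h2 := sqrt_one_sub_pos (hF.maps _ (toVertex_mem hi hz hs))
  simp only [hypCosh, Pi.div_apply]
  rw [real_inner_comm (F (toVertex i z s)) (F x), real_inner_comm (F (toVertex i z s)) (F y),
    ← div_div, ← div_div, div_div_div_cancel_right₀ h2.ne']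

/-- Two points run to two different cusps; each of their roots occurs once in the numerator and once
in the denominator. The limit relates the horospherical normalizations at the two cusps to the
position of the ideal points. -/
theorem IsIdealMap.tendsto_ratio₂ (hF : IsIdealMap t F) {i j : V} (hi : i ∈ t) (hj : j ∈ t)
    (hij : i ≠ j) {x : V → ℝ} (hx : x ∈ puncturedSimplex t) :
    Tendsto (fun s => hypCosh (F x) (F (toVertex i x s)) * hypCosh (F x) (F (toVertex j x s)) /
        hypCosh (F (toVertex i x s)) (F (toVertex j x s)))
      (𝓝[>] 0) (𝓝 (horo (F (vertexPt i)) (F x) * horo (F (vertexPt j)) (F x) /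
        (1 - inner ℝ (F (vertexPt i)) (F (vertexPt j))))) := by
  have h1 : ∀ k ∈ t, Tendsto
      (fun s => (1 - inner ℝ (F (toVertex k x s)) (F x)) / √(1 - ‖F x‖ ^ 2)) (𝓝[>] 0)
      (𝓝 (horo (F (vertexPt k)) (F x))) := fun u hu =>
    (tendsto_const_nhds.sub ((hF.tendsto hu hx).inner tendsto_const_nhds)).div_const _
  have h2 : inner ℝ (F (vertexPt i)) (F (vertexPt j)) < 1 :=
    inner_lt_one_of_ne (hF.norm_vertex i hi) (hF.norm_vertex j hj)
      fun h => hij (hF.inj_vertex i hi j hj h)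
  have h3 : Tendsto (fun s => 1 - inner ℝ (F (toVertex i x s)) (F (toVertex j x s))) (𝓝[>] 0)
      (𝓝 (1 - inner ℝ (F (vertexPt i)) (F (vertexPt j)))) :=
    tendsto_const_nhds.sub ((hF.tendsto hi hx).inner (hF.tendsto hj hx))
  refine (((h1 i hi).mul (h1 j hj)).div h3 (by linarith)).congr' ?_
  filter_upwards [Ioo_mem_nhdsGT (zero_lt_one' ℝ)] with s hs
  have h4 := sqrt_one_sub_pos (hF.maps _ (toVertex_mem hi hx hs))
  have h5 := sqrt_one_sub_pos (hF.maps _ (toVertex_mem hj hx hs))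
  have h6 := sqrt_one_sub_pos (hF.maps _ hx)
  simp only [hypCosh, Pi.div_apply]
  rw [real_inner_comm (F (toVertex i x s)) (F x), real_inner_comm (F (toVertex j x s)) (F x)]
  field_simp

/-- Two ideal maps of the triangle `t` that induce the same metric. -/
def SameMetric (t : Finset V) (F : (V → ℝ) → EuclideanSpace ℝ (Fin n))
    (G : (V → ℝ) → EuclideanSpace ℝ (Fin m)) : Prop :=
  ∀ x ∈ puncturedSimplex t, ∀ y ∈ puncturedSimplex t, hypDist (F x) (F y) = hypDist (G x) (G y)

theorem SameMetric.horo_ratio (h : SameMetric t F G) (hF : IsIdealMap t F) (hG : IsIdealMap t G)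
    {i : V} (hi : i ∈ t) {x y : V → ℝ} (hx : x ∈ puncturedSimplex t)
    (hy : y ∈ puncturedSimplex t) :
    horo (F (vertexPt i)) (F x) / horo (F (vertexPt i)) (F y) =
      horo (G (vertexPt i)) (G x) / horo (G (vertexPt i)) (G y) := by
  refine tendsto_nhds_unique (hF.tendsto_ratio hi hx hy hx)
    ((hG.tendsto_ratio hi hx hy hx).congr' ?_)
  filter_upwards [Ioo_mem_nhdsGT (zero_lt_one' ℝ)] with s hs
  have hs' := toVertex_mem hi hx hs
  rw [hypCosh_eq_of_hypDist_eq (hF.maps _ hx) (hF.maps _ hs') (hG.maps _ hx) (hG.maps _ hs')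
    (h _ hx _ hs'), hypCosh_eq_of_hypDist_eq (hF.maps _ hy) (hF.maps _ hs') (hG.maps _ hy)
    (hG.maps _ hs') (h _ hy _ hs')]

theorem SameMetric.horo_mul (h : SameMetric t F G) (hF : IsIdealMap t F) (hG : IsIdealMap t G)
    {i j : V} (hi : i ∈ t) (hj : j ∈ t) (hij : i ≠ j) {x : V → ℝ} (hx : x ∈ puncturedSimplex t) :
    horo (F (vertexPt i)) (F x) * horo (F (vertexPt j)) (F x) /
        (1 - inner ℝ (F (vertexPt i)) (F (vertexPt j))) =
      horo (G (vertexPt i)) (G x) * horo (G (vertexPt j)) (G x) /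
        (1 - inner ℝ (G (vertexPt i)) (G (vertexPt j))) := by
  refine tendsto_nhds_unique (hF.tendsto_ratio₂ hi hj hij hx)
    ((hG.tendsto_ratio₂ hi hj hij hx).congr' ?_)
  filter_upwards [Ioo_mem_nhdsGT (zero_lt_one' ℝ)] with s hs
  have hs' := toVertex_mem hi hx hs
  have hs'' := toVertex_mem hj hx hs
  rw [hypCosh_eq_of_hypDist_eq (hF.maps _ hx) (hF.maps _ hs') (hG.maps _ hx) (hG.maps _ hs')
    (h _ hx _ hs'), hypCosh_eq_of_hypDist_eq (hF.maps _ hx) (hF.maps _ hs'') (hG.maps _ hx)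
    (hG.maps _ hs'') (h _ hx _ hs''), hypCosh_eq_of_hypDist_eq (hF.maps _ hs') (hF.maps _ hs'')
    (hG.maps _ hs') (hG.maps _ hs'') (h _ hs' _ hs'')]

/-- The factor by which a change of the map scales the horospherical function of the vertex `i`. -/
def scaleAt (F : (V → ℝ) → EuclideanSpace ℝ (Fin n)) (G : (V → ℝ) → EuclideanSpace ℝ (Fin m))
    (i : V) (x : V → ℝ) : ℝ :=
  horo (F (vertexPt i)) (F x) / horo (G (vertexPt i)) (G x)

theorem scaleAt_pos (hF : IsIdealMap t F) (hG : IsIdealMap t G) {i : V} (hi : i ∈ t)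
    {x : V → ℝ} (hx : x ∈ puncturedSimplex t) : 0 < scaleAt F G i x :=
  div_pos (horo_pos (hF.norm_vertex i hi) (hF.maps x hx))
    (horo_pos (hG.norm_vertex i hi) (hG.maps x hx))

theorem SameMetric.scaleAt_eq (h : SameMetric t F G) (hF : IsIdealMap t F) (hG : IsIdealMap t G)
    {i : V} (hi : i ∈ t) {x y : V → ℝ} (hx : x ∈ puncturedSimplex t)
    (hy : y ∈ puncturedSimplex t) : scaleAt F G i x = scaleAt F G i y := by
  have h1 := h.horo_ratio hF hG hi hx hy
  have h2 := horo_pos (hF.norm_vertex i hi) (hF.maps y hy)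
  have h3 := horo_pos (hG.norm_vertex i hi) (hG.maps y hy)
  have h4 := horo_pos (hG.norm_vertex i hi) (hG.maps x hx)
  unfold scaleAt
  rw [div_eq_div_iff h2.ne' h3.ne'] at h1
  rw [div_eq_div_iff h4.ne' h3.ne']
  linarith

/-- The transformation law of squared lambda lengths under a change of horocycles. It is the source
of the discrete conformal equivalence of the two drawings. -/
theorem SameMetric.one_sub_inner (h : SameMetric t F G) (hF : IsIdealMap t F)
    (hG : IsIdealMap t G) {i j : V} (hi : i ∈ t) (hj : j ∈ t) {x : V → ℝ}
    (hx : x ∈ puncturedSimplex t) :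
    1 - inner ℝ (F (vertexPt i)) (F (vertexPt j)) = scaleAt F G i x * scaleAt F G j x *
      (1 - inner ℝ (G (vertexPt i)) (G (vertexPt j))) := by
  by_cases hij : i = j
  · subst hij
    simp [hF.norm_vertex i hi, hG.norm_vertex i hi]
  have h1 := h.horo_mul hF hG hi hj hij hx
  have h2 : inner ℝ (F (vertexPt i)) (F (vertexPt j)) < 1 :=
    inner_lt_one_of_ne (hF.norm_vertex i hi) (hF.norm_vertex j hj)
      fun h => hij (hF.inj_vertex i hi j hj h)
  have h2' : inner ℝ (G (vertexPt i)) (G (vertexPt j)) < 1 :=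
    inner_lt_one_of_ne (hG.norm_vertex i hi) (hG.norm_vertex j hj)
      fun h => hij (hG.inj_vertex i hi j hj h)
  have h3 := horo_pos (hG.norm_vertex i hi) (hG.maps x hx)
  have h4 := horo_pos (hG.norm_vertex j hj) (hG.maps x hx)
  rw [div_eq_div_iff (by linarith) (by linarith)] at h1
  unfold scaleAt
  field_simp
  linarith

/-- In terms of the ideal vertices, isometric maps of a flat ideal triangle are projective. -/
theorem SameMetric.eq_sum (h : SameMetric t F G) (hF : IsIdealMap t F) (hG : IsIdealMap t G)
    {x w : V → ℝ} (hx : x ∈ puncturedSimplex t) (hw : w ∈ puncturedSimplex t)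
    (hGx : G x = ∑ a ∈ t, w a • G (vertexPt a)) :
    F x = ∑ a ∈ t, (w a / scaleAt F G a x / ∑ b ∈ t, w b / scaleAt F G b x) • F (vertexPt a) := by
  have hρ : ∀ a ∈ t, 0 < scaleAt F G a x := fun a ha => scaleAt_pos hF hG ha hx
  obtain ⟨a, ha, b, hb, hab, hwa, hwb⟩ := exists_two_pos hw
  have hS : 0 < ∑ b ∈ t, w b / scaleAt F G b x :=
    Finset.sum_pos' (fun i hi => div_nonneg (hw.1.1 i) (hρ i hi).le)
      ⟨a, ha, div_pos hwa (hρ a ha)⟩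
  set S := ∑ b ∈ t, w b / scaleAt F G b x
  -- A Lorentz map carrying one ideal triangle to the other sends the lightlike lift `(1, G a)` to
  -- `(1, F a)` divided by the scale factor of `a`; this dictates the weights, up to normalization
  -- by `S`.
  set c : V → ℝ := fun a => w a / scaleAt F G a x / S with hc
  have hc1 : ∑ a ∈ t, c a = 1 := by rw [hc, ← Finset.sum_div, div_self hS.ne']
  have hc0 : ∀ a ∈ t, 0 ≤ c a := fun a ha => div_nonneg (div_nonneg (hw.1.1 a) (hρ a ha).le) hS.le
  have hw1 := sum_simplexSet hw.1
  have hz : ∑ a ∈ t, c a • F (vertexPt a) ∈ hypSpace n :=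
    sum_mem_hypSpace t c _ hc1 hc0 hF.norm_vertex ha hb (fun h => hab (hF.inj_vertex a ha b hb h))
      (div_pos (div_pos hwa (hρ a ha)) hS) (div_pos (div_pos hwb (hρ b hb)) hS)
  have hFx := hF.maps x hx
  have hGx' := hG.maps x hx
  have e1 : 1 - ‖∑ a ∈ t, c a • F (vertexPt a)‖ ^ 2 = (1 - ‖G x‖ ^ 2) / S ^ 2 := by
    rw [← real_inner_self_eq_norm_sq, one_sub_inner_sum' t c _ _ hc1,
      ← real_inner_self_eq_norm_sq]
    conv_rhs => rw [hGx, one_sub_inner_sum' t w _ _ hw1]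
    rw [Finset.sum_div]
    refine Finset.sum_congr rfl fun i hi => ?_
    rw [one_sub_inner_sum t c _ _ hc1, one_sub_inner_sum t w _ _ hw1, Finset.mul_sum,
      Finset.mul_sum, Finset.sum_div]
    refine Finset.sum_congr rfl fun j hj => ?_
    rw [h.one_sub_inner hF hG hi hj hx, hc]
    have := (hρ i hi).ne'
    have := (hρ j hj).ne'
    field_simp
  have e2 : 1 - inner ℝ (F x) (∑ a ∈ t, c a • F (vertexPt a)) =
      √(1 - ‖F x‖ ^ 2) * √(1 - ‖G x‖ ^ 2) / S := by
    have h1 := sqrt_one_sub_pos hFx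
    have h2 := sqrt_one_sub_pos hGx'
    -- Pairing `G x` with its own expansion writes its Minkowski length in terms of its
    -- horospherical values, which the scale factors convert to those of `F x`.
    have h3 : √(1 - ‖G x‖ ^ 2) = ∑ a ∈ t, w a * horo (G (vertexPt a)) (G x) := by
      unfold horo
      simp only [← mul_div_assoc, ← Finset.sum_div]
      rw [← one_sub_inner_sum' t w _ _ hw1, ← hGx, real_inner_self_eq_norm_sq, eq_div_iff h2.ne',
        Real.mul_self_sqrt]
      rw [mem_hypSpace] at hGx'
      nlinarith [norm_nonneg (G x)]
    rw [one_sub_inner_sum t c _ _ hc1, h3, Finset.mul_sum, Finset.sum_div]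
    refine Finset.sum_congr rfl fun i hi => ?_
    have h4 := horo_pos (hG.norm_vertex i hi) hGx'
    have h5 : 1 - inner ℝ (F x) (F (vertexPt i)) =
        scaleAt F G i x * horo (G (vertexPt i)) (G x) * √(1 - ‖F x‖ ^ 2) := by
      unfold scaleAt
      rw [div_mul_cancel₀ _ h4.ne', horo, div_mul_cancel₀ _ h1.ne', real_inner_comm]
    rw [h5, hc]
    have := (hρ i hi).ne'
    field_simp
  refine eq_of_hypCosh_eq_one hFx hz ?_
  have h1 := sqrt_one_sub_pos hFx
  have h2 := sqrt_one_sub_pos hGx'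
  rw [hypCosh, e1, e2, Real.sqrt_div' _ (sq_nonneg _), Real.sqrt_sq hS.le]
  field_simp

end Transfer

end

noncomputable section

open Filter Topology

/-! ### Ideal triangles of a realization -/

section Hulls

variable {V : Type*} [Fintype V] [DecidableEq V] {E : Type*} [AddCommGroup E] [Module ℝ E]

theorem mem_convexHull_image_iff (η : V → E) (s : Finset V) (y : E) :
    y ∈ convexHull ℝ (η '' (s : Set V)) ↔ ∃ w ∈ simplexSet s, y = ∑ a ∈ s, w a • η a := by
  constructor
  · intro hy
    have hconv : Convex ℝ ((fun w : V → ℝ => ∑ a ∈ s, w a • η a) '' simplexSet s) := by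
      refine (convex_simplexSet s).is_linear_image ⟨fun x y => ?_, fun c x => ?_⟩
      · simp [add_smul, Finset.sum_add_distrib]
      · simp [Finset.smul_sum, smul_smul]
    have hsub : η '' (s : Set V) ⊆ (fun w : V → ℝ => ∑ a ∈ s, w a • η a) '' simplexSet s := by
      rintro _ ⟨a, ha, rfl⟩
      refine ⟨vertexPt a, vertexPt_mem_simplexSet ha, ?_⟩
      simp only [vertexPt]
      rw [Finset.sum_eq_single_of_mem a ha]
      · simp
      · intro b _ hb
        simp [hb]
    obtain ⟨w, hw, rfl⟩ := convexHull_min hsub hconv hy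
    exact ⟨w, hw, rfl⟩
  · rintro ⟨w, hw, rfl⟩
    exact (convex_convexHull ℝ _).sum_mem (fun i _ => hw.1 i) (sum_simplexSet hw)
      fun i hi => subset_convexHull ℝ _ ⟨i, hi, rfl⟩

end Hulls

section Realization

variable {V : Type*} [Fintype V] [DecidableEq V] {T : SphereTriangulation V} {M : CuspMetric T}

theorem SphereTriangulation.simplexSet_subset {t : Finset V} (ht : t ∈ T.faces) :
    simplexSet t ⊆ T.carrier :=
  Set.subset_biUnion_of_mem (u := fun t => simplexSet t) (show t ∈ (T.faces : Set _) from ht)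

theorem SphereTriangulation.puncturedSimplex_subset {t : Finset V} (ht : t ∈ T.faces) :
    puncturedSimplex t ⊆ T.punctured :=
  Set.sdiff_subset_sdiff_left (T.simplexSet_subset ht)

theorem SphereTriangulation.vertexPt_mem (i : V) : vertexPt i ∈ T.carrier := by
  obtain ⟨t, ht, hi⟩ := T.exists_face i
  exact T.simplexSet_subset ht (vertexPt_mem_simplexSet hi)

theorem vertexPt_injective : Function.Injective (vertexPt : V → V → ℝ) := by
  intro i j h
  by_contra hij
  have := congrFun h i
  simp [vertexPt, hij] at this

/-- By injectivity of the chart a point that is not a vertex cannot land on an ideal vertex. Its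
image then has two positive weights, and so lies in the open ball. -/
theorem CuspMetric.isIdealMap (M : CuspMetric T) {t : Finset V} (ht : t ∈ T.faces) :
    IsIdealMap t (M.chart t) where
  cont := M.continuousOn_chart t ht
  norm_vertex := M.norm_chart_vertex t ht
  inj_vertex i hi j hj h := vertexPt_injective ((M.bijOn_chart t ht t subset_rfl).injOn
    (vertexPt_mem_simplexSet hi) (vertexPt_mem_simplexSet hj) h)
  maps x hx := by
    have hb := M.bijOn_chart t ht t subset_rfl
    obtain ⟨w, hw, hxw⟩ := (mem_convexHull_image_iff _ _ _).1 (hb.mapsTo hx.1)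
    have hw' : w ∈ puncturedSimplex t := by
      refine ⟨hw, ?_⟩
      rintro ⟨i, rfl⟩
      have hit : i ∈ t := by
        by_contra h
        have := hw.2.2 i h
        simp [vertexPt] at this
      refine hx.2 ⟨i, ?_⟩
      refine hb.injOn (vertexPt_mem_simplexSet hit) hx.1 ?_
      rw [hxw, Finset.sum_eq_single_of_mem i hit]
      · simp [vertexPt]
      · intro b _ hb
        simp [vertexPt, hb]
    obtain ⟨a, ha, b, hb', hab, hwa, hwb⟩ := exists_two_pos hw'
    rw [hxw]
    refine sum_mem_hypSpace t w _ (sum_simplexSet hw) (fun i _ => hw.1 i)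
      (M.norm_chart_vertex t ht) ha hb' (fun h => hab ?_) hwa hwb
    exact vertexPt_injective (hb.injOn (vertexPt_mem_simplexSet ha) (vertexPt_mem_simplexSet hb') h)

namespace IdealRealization

/-- The ideal point that is the image of a vertex. -/
def idealPt (R : IdealRealization T M) (i : V) : EuclideanSpace ℝ (Fin 3) := R.toFun (vertexPt i)

variable (R R' : IdealRealization T M)

theorem norm_idealPt (i : V) : ‖R.idealPt i‖ = 1 := R.norm_vertex i

theorem idealPt_injective : Function.Injective R.idealPt := fun i j h =>
  vertexPt_injective (R.injOn_toFun (T.vertexPt_mem i) (T.vertexPt_mem j) h)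

theorem isIdealMap {t : Finset V} (ht : t ∈ T.faces) : IsIdealMap t R.toFun where
  cont := R.continuousOn_toFun.mono (T.simplexSet_subset ht)
  norm_vertex i _ := R.norm_vertex i
  inj_vertex _ _ _ _ h := R.idealPt_injective h
  maps x hx := R.mapsTo_hypSpace (T.puncturedSimplex_subset ht hx)

theorem sameMetric_chart {t : Finset V} (ht : t ∈ T.faces) : SameMetric t R.toFun (M.chart t) :=
  R.isometric t ht

theorem sameMetric {t : Finset V} (ht : t ∈ T.faces) : SameMetric t R'.toFun R.toFun :=
  fun _ hx _ hy => (R'.isometric t ht _ hx _ hy).trans (R.isometric t ht _ hx _ hy).symm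

theorem sum_vertexPt_smul {E : Type*} [AddCommGroup E] [Module ℝ E] {s : Finset V} {i : V}
    (hi : i ∈ s) (η : V → E) : ∑ a ∈ s, (vertexPt i : V → ℝ) a • η a = η i := by
  rw [Finset.sum_eq_single_of_mem i hi]
  · simp [vertexPt]
  · intro b _ hb
    simp [vertexPt, hb]

/-- The weights `w a / ρ a`, normalized. -/
def reweight (t : Finset V) (ρ w : V → ℝ) (a : V) : ℝ :=
  w a / ρ a / ∑ b ∈ t, w b / ρ b

theorem reweight_mem {s t : Finset V} (hst : s ⊆ t) {ρ w : V → ℝ} (hρ : ∀ a ∈ t, 0 < ρ a)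
    (hw : w ∈ simplexSet s) : reweight t ρ w ∈ simplexSet s := by
  have hwt := simplexSet_mono hst hw
  have hS : 0 < ∑ b ∈ t, w b / ρ b := by
    refine lt_of_le_of_ne (Finset.sum_nonneg fun i hi => div_nonneg (hw.1 i) (hρ i hi).le)
      fun h => ?_
    have h1 := (Finset.sum_eq_zero_iff_of_nonneg
      fun i hi => div_nonneg (hw.1 i) (hρ i hi).le).1 h.symm
    have h2 : ∑ i ∈ t, w i = 0 := Finset.sum_eq_zero fun i hi => by
      have := h1 i hi
      rw [div_eq_zero_iff] at this
      exact this.resolve_right (hρ i hi).ne'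
    rw [sum_simplexSet hwt] at h2
    exact one_ne_zero h2
  have h0 : ∀ i, i ∉ t → reweight t ρ w i = 0 := fun i hi => by
    simp [reweight, hwt.2.2 i hi]
  refine ⟨fun i => ?_, ?_, fun i hi => by simp [reweight, hw.2.2 i hi]⟩
  · by_cases hi : i ∈ t
    · exact div_nonneg (div_nonneg (hw.1 i) (hρ i hi).le) hS.le
    · exact (h0 i hi).ge
  · rw [← Finset.sum_subset (Finset.subset_univ t) fun i _ hi => h0 i hi]
    simp only [reweight]
    rw [← Finset.sum_div, div_self hS.ne']

theorem puncturedSimplex_nonempty {t : Finset V} (ht : t ∈ T.faces) :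
    ∃ x, x ∈ puncturedSimplex t := by
  obtain ⟨i, j, k, hij, hik, hjk, rfl⟩ := Finset.card_eq_three.1 (T.card_of_mem_faces t ht)
  have hi : i ∈ ({i, j, k} : Finset V) := by simp
  have hj : j ∈ ({i, j, k} : Finset V) := by simp
  refine ⟨(1 / 2 : ℝ) • vertexPt i + (1 / 2 : ℝ) • vertexPt j, convex_simplexSet _
    (vertexPt_mem_simplexSet hi) (vertexPt_mem_simplexSet hj) (by norm_num) (by norm_num)
    (by norm_num), ?_⟩
  rintro ⟨a, ha⟩
  have h1 := congrFun ha i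
  have h2 := congrFun ha j
  by_cases hai : a = i
  · subst hai
    simp [vertexPt, hij] at h1
  · simp [vertexPt, Ne.symm hai, hij] at h1

end IdealRealization

open IdealRealization

/-- Two maps of a triangle, the first of which is injective onto a flat triangle: the second one is
the projective map that is determined by the scale factors at the vertices. -/
theorem SameMetric.eq_sum_reweight {n m : ℕ} {t : Finset V}
    {F : (V → ℝ) → EuclideanSpace ℝ (Fin n)} {G : (V → ℝ) → EuclideanSpace ℝ (Fin m)}
    (h : SameMetric t F G) (hF : IsIdealMap t F) (hG : IsIdealMap t G)
    (hinj : Set.InjOn G (simplexSet t)) {ρ : V → ℝ}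
    (hρ : ∀ i ∈ t, ∀ x ∈ puncturedSimplex t, scaleAt F G i x = ρ i) {x w : V → ℝ}
    (hρ0 : ∀ i ∈ t, 0 < ρ i)
    (hx : x ∈ simplexSet t) (hw : w ∈ simplexSet t)
    (hGx : G x = ∑ a ∈ t, w a • G (vertexPt a)) :
    F x = ∑ a ∈ t, reweight t ρ w a • F (vertexPt a) := by
  by_cases hw' : ∃ i, vertexPt i = w
  · obtain ⟨i, rfl⟩ := hw'
    have hi : i ∈ t := by
      by_contra h
      have := hw.2.2 i h
      simp [vertexPt] at this
    rw [sum_vertexPt_smul hi] at hGx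
    have hxi := hinj hx (vertexPt_mem_simplexSet hi) hGx
    have hr : reweight t ρ (vertexPt i) = vertexPt i := by
      refine eq_vertexPt_of_apply_eq_one (reweight_mem subset_rfl hρ0 hw) ?_
      unfold reweight
      rw [Finset.sum_eq_single_of_mem i hi]
      · have := (hρ0 i hi).ne'
        simp [vertexPt, this]
      · intro b _ hb
        simp [vertexPt, hb]
    rw [hr, sum_vertexPt_smul hi, hxi]
  · have hw2 : w ∈ puncturedSimplex t := ⟨hw, fun ⟨i, hi⟩ => hw' ⟨i, hi⟩⟩
    have hx2 : x ∈ puncturedSimplex t := by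
      refine ⟨hx, ?_⟩
      rintro ⟨i, rfl⟩
      have hi : i ∈ t := by
        by_contra h
        have := hx.2.2 i h
        simp [vertexPt] at this
      obtain ⟨a, ha, b, hb, hab, hwa, hwb⟩ := exists_two_pos hw2
      have := sum_mem_hypSpace t w (fun a => G (vertexPt a)) (sum_simplexSet hw)
        (fun i _ => hw.1 i) hG.norm_vertex ha hb (fun h => hab (hG.inj_vertex a ha b hb h)) hwa hwb
      rw [← hGx, mem_hypSpace, hG.norm_vertex i hi] at this
      exact lt_irrefl _ this
    rw [h.eq_sum hF hG hx2 hw2 hGx]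
    refine Finset.sum_congr rfl fun a ha => ?_
    unfold reweight
    rw [hρ a ha x hx2, Finset.sum_congr rfl fun b hb => by rw [hρ b hb x hx2]]

namespace IdealRealization

variable (R R' : IdealRealization T M)

theorem exists_scale_chart {t : Finset V} (ht : t ∈ T.faces) : ∃ ρ : V → ℝ, (∀ i ∈ t, 0 < ρ i) ∧
    ∀ x ∈ simplexSet t, ∀ w ∈ simplexSet t,
      M.chart t x = ∑ a ∈ t, w a • M.chart t (vertexPt a) →
      R.toFun x = ∑ a ∈ t, reweight t ρ w a • R.idealPt a := by
  obtain ⟨x₀, hx₀⟩ := puncturedSimplex_nonempty ht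
  have hF := R.isIdealMap ht
  have hG := M.isIdealMap ht
  refine ⟨fun i => scaleAt R.toFun (M.chart t) i x₀, fun i hi => scaleAt_pos hF hG hi hx₀,
    fun x hx w hw hxw => ?_⟩
  exact (R.sameMetric_chart ht).eq_sum_reweight hF hG (M.bijOn_chart t ht t subset_rfl).injOn
    (fun i hi x hx => (R.sameMetric_chart ht).scaleAt_eq hF hG hi hx hx₀)
    (fun i hi => scaleAt_pos hF hG hi hx₀) hx hw hxw

theorem sum_eq_of_subset {E : Type*} [AddCommGroup E] [Module ℝ E] {s t : Finset V} (hst : s ⊆ t)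
    {w : V → ℝ} (hw : w ∈ simplexSet s) (η : V → E) :
    ∑ a ∈ s, w a • η a = ∑ a ∈ t, w a • η a :=
  Finset.sum_subset hst fun a _ ha => by simp [hw.2.2 a ha]

/-- The image of a simplex is the ideal simplex spanned by the images of its vertices. -/
theorem image_simplexSet {t : Finset V} (ht : t ∈ T.faces) {s : Finset V} (hst : s ⊆ t) :
    R.toFun '' simplexSet s = convexHull ℝ (R.idealPt '' (s : Set V)) := by
  obtain ⟨ρ, hρ, h⟩ := R.exists_scale_chart ht
  have hb := M.bijOn_chart t ht s hst
  ext y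
  rw [mem_convexHull_image_iff]
  constructor
  · rintro ⟨x, hx, rfl⟩
    obtain ⟨w, hw, hxw⟩ := (mem_convexHull_image_iff _ _ _).1 (hb.mapsTo hx)
    rw [sum_eq_of_subset hst hw] at hxw
    refine ⟨reweight t ρ w, reweight_mem hst hρ hw, ?_⟩
    rw [h x (simplexSet_mono hst hx) w (simplexSet_mono hst hw) hxw,
      sum_eq_of_subset hst (reweight_mem hst hρ hw)]
  · rintro ⟨c, hc, rfl⟩
    -- Dividing the weights by `ρ⁻¹` undoes division by `ρ` up to normalization; this provides the
    -- preimage of a given convex combination.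
    have hρ' : ∀ a ∈ t, 0 < (ρ a)⁻¹ := fun a ha => inv_pos.2 (hρ a ha)
    have hw := reweight_mem hst hρ' hc
    obtain ⟨x, hx, hxw⟩ := hb.surjOn ((mem_convexHull_image_iff _ _ _).2 ⟨_, hw, rfl⟩)
    rw [sum_eq_of_subset hst hw] at hxw
    refine ⟨x, hx, ?_⟩
    rw [h x (simplexSet_mono hst hx) _ (simplexSet_mono hst hw) hxw, sum_eq_of_subset hst hc]
    refine Finset.sum_congr rfl fun a ha => ?_
    congr 1
    have hS : ∑ b ∈ t, c b * ρ b ≠ 0 := by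
      intro h0
      have := hw.2.1
      simp only [reweight, div_inv_eq_mul, h0, div_zero, Finset.sum_const_zero] at this
      exact zero_ne_one this
    have h1 : ∀ b ∈ t, reweight t (fun a => (ρ a)⁻¹) c b / ρ b = c b / ∑ b ∈ t, c b * ρ b := by
      intro b hb
      have := (hρ b hb).ne'
      simp only [reweight, div_inv_eq_mul]
      field_simp
    change reweight t (fun a => (ρ a)⁻¹) c a / ρ a / _ = _
    rw [Finset.sum_congr rfl h1, h1 a ha, ← Finset.sum_div,
      sum_simplexSet (simplexSet_mono hst hc)]
    field_simp

end IdealRealization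

/-- Three distinct ideal points are affinely independent. -/
theorem eq_zero_of_sum_unit {n : ℕ} {a b c : EuclideanSpace ℝ (Fin n)} (ha : ‖a‖ = 1)
    (hb : ‖b‖ = 1) (hc : ‖c‖ = 1) (hab : a ≠ b) (hac : a ≠ c) (hbc : b ≠ c) {x y z : ℝ}
    (h0 : x + y + z = 0) (h : x • a + y • b + z • c = 0) : x = 0 ∧ y = 0 ∧ z = 0 := by
  have hab' := inner_lt_one_of_ne ha hb hab
  have hac' := inner_lt_one_of_ne ha hc hac
  have hbc' := inner_lt_one_of_ne hb hc hbc
  have e1 := congrArg (fun v => inner ℝ a v) h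
  have e2 := congrArg (fun v => inner ℝ b v) h
  have e3 := congrArg (fun v => inner ℝ c v) h
  simp only [inner_add_right, inner_smul_right, inner_zero_right, real_inner_self_eq_norm_sq,
    ha, hb, hc, real_inner_comm a b, real_inner_comm a c, real_inner_comm b c] at e1 e2 e3
  set p := inner ℝ a b
  set q := inner ℝ a c
  set r := inner ℝ b c
  -- Pairing the relation with each of the three unit vectors gives a symmetric system with zero
  -- diagonal and off-diagonal entries `1 - p`, `1 - q`, `1 - r`. Its determinant is twice the
  -- product of these positive numbers.
  have f1 : y * (1 - p) + z * (1 - q) = 0 := by linear_combination h0 - e1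
  have f2 : x * (1 - p) + z * (1 - r) = 0 := by linear_combination h0 - e2
  have f3 : x * (1 - q) + y * (1 - r) = 0 := by linear_combination h0 - e3
  have hz : z * ((1 - q) * (1 - r)) = 0 := by
    linear_combination (1 / 2) * (1 - r) * f1 + (1 / 2) * (1 - q) * f2 - (1 / 2) * (1 - p) * f3
  have hz0 : z = 0 := by
    rcases mul_eq_zero.1 hz with h | h
    · exact h
    · exact absurd h (mul_pos (by linarith) (by linarith)).ne'
  subst hz0
  have hy0 : y = 0 := by
    rcases mul_eq_zero.1 (show y * (1 - p) = 0 by linarith) with h | h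
    · exact h
    · linarith
  exact ⟨by linarith, hy0, rfl⟩

namespace IdealRealization

variable (R R' : IdealRealization T M)

theorem weights_unique {t : Finset V} (ht : t.card = 3) {c d : V → ℝ} (hc : c ∈ simplexSet t)
    (hd : d ∈ simplexSet t)
    (h : ∑ a ∈ t, c a • R.idealPt a = ∑ a ∈ t, d a • R.idealPt a) : c = d := by
  obtain ⟨i, j, k, hij, hik, hjk, rfl⟩ := Finset.card_eq_three.1 ht
  have h1 := sum_simplexSet hc
  have h2 := sum_simplexSet hd
  have e : ∀ {E : Type} [AddCommGroup E] (f : V → E), ∑ a ∈ ({i, j, k} : Finset V), f a =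
      f i + f j + f k := by
    intro E _ f
    rw [Finset.sum_insert (by simp [hij, hik]), Finset.sum_insert (by simp [hjk]),
      Finset.sum_singleton, add_assoc]
  rw [e] at h1 h2
  rw [e, e] at h
  obtain ⟨hx, hy, hz⟩ := eq_zero_of_sum_unit (R.norm_idealPt i) (R.norm_idealPt j)
    (R.norm_idealPt k) (fun h => hij (R.idealPt_injective h)) (fun h => hik (R.idealPt_injective h))
    (fun h => hjk (R.idealPt_injective h)) (x := c i - d i) (y := c j - d j) (z := c k - d k)
    (by linarith) (by
      rw [← sub_eq_zero] at h
      rw [← h]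
      module)
  ext a
  by_cases ha : a ∈ ({i, j, k} : Finset V)
  · simp only [Finset.mem_insert, Finset.mem_singleton] at ha
    rcases ha with rfl | rfl | rfl <;> linarith
  · rw [hc.2.2 a ha, hd.2.2 a ha]

/-- A triangle that contains a relatively interior point of a simplex contains the simplex. -/
theorem subset_of_mem_convexHull {t t' s : Finset V} (ht : t ∈ T.faces) (ht' : t' ∈ T.faces)
    (hst : s ⊆ t) {c : V → ℝ} (hc : c ∈ simplexSet s) (hpos : ∀ a ∈ s, 0 < c a) {s' : Finset V}
    (hs' : s' ⊆ t')
    (h : ∑ a ∈ s, c a • R.idealPt a ∈ convexHull ℝ (R.idealPt '' (s' : Set V))) : s ⊆ s' := by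
  have h1 : ∑ a ∈ s, c a • R.idealPt a ∈ convexHull ℝ (R.idealPt '' (s : Set V)) :=
    (mem_convexHull_image_iff _ _ _).2 ⟨c, hc, rfl⟩
  rw [← R.image_simplexSet ht hst] at h1
  rw [← R.image_simplexSet ht' hs'] at h
  obtain ⟨x, hx, hxp⟩ := h1
  obtain ⟨x', hx', hxp'⟩ := h
  have hxx : x = x' := R.injOn_toFun (T.simplexSet_subset ht (simplexSet_mono hst hx))
    (T.simplexSet_subset ht' (simplexSet_mono hs' hx')) (hxp.trans hxp'.symm)
  subst hxx
  -- The unique preimage lies in both simplices. Affine independence of the ideal vertices then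
  -- makes the given weights vanish outside of `s ∩ s'`, whereas they are positive on `s`.
  have hx2 : x ∈ simplexSet (s ∩ s') := by
    rw [← simplexSet_inter]
    exact ⟨hx, hx'⟩
  have hsub : s ∩ s' ⊆ t := Finset.inter_subset_left.trans hst
  have h2 : R.toFun x ∈ R.toFun '' simplexSet (s ∩ s') := ⟨x, hx2, rfl⟩
  rw [R.image_simplexSet ht hsub, hxp, mem_convexHull_image_iff] at h2
  obtain ⟨d, hd, hcd⟩ := h2
  rw [sum_eq_of_subset hst hc, sum_eq_of_subset hsub hd] at hcd
  have := R.weights_unique (T.card_of_mem_faces t ht) (simplexSet_mono hst hc)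
    (simplexSet_mono hsub hd) hcd
  subst this
  intro a ha
  by_contra h
  have h3 := hd.2.2 a (fun h' => h (Finset.mem_inter.1 h').2)
  exact (hpos a ha).ne' h3

/-- A common point would have a preimage in the simplex on the empty set, where weights cannot add
up to one. This is the form in which embeddedness excludes crossing edges. -/
theorem convexHull_inter_eq_empty {t t' s s' : Finset V} (ht : t ∈ T.faces) (ht' : t' ∈ T.faces)
    (hst : s ⊆ t) (hs' : s' ⊆ t') (hd : Disjoint s s') {p : EuclideanSpace ℝ (Fin 3)}
    (h : p ∈ convexHull ℝ (R.idealPt '' (s : Set V)))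
    (h' : p ∈ convexHull ℝ (R.idealPt '' (s' : Set V))) : False := by
  rw [← R.image_simplexSet ht hst] at h
  rw [← R.image_simplexSet ht' hs'] at h'
  obtain ⟨x, hx, hxp⟩ := h
  obtain ⟨x', hx', hxp'⟩ := h'
  have hxx : x = x' := R.injOn_toFun (T.simplexSet_subset ht (simplexSet_mono hst hx))
    (T.simplexSet_subset ht' (simplexSet_mono hs' hx')) (hxp.trans hxp'.symm)
  subst hxx
  have hx2 : x ∈ simplexSet (s ∩ s') := by
    rw [← simplexSet_inter]
    exact ⟨hx, hx'⟩
  rw [Finset.disjoint_iff_inter_eq_empty.1 hd] at hx2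
  have := sum_simplexSet hx2
  simp at this

theorem frontier_eq : frontier R.body = ⋃ t ∈ T.faces, convexHull ℝ (R.idealPt '' (t : Set V)) := by
  rw [R.frontier_body, SphereTriangulation.carrier, Set.image_iUnion₂]
  exact Set.iUnion₂_congr fun t ht => R.image_simplexSet ht subset_rfl

end IdealRealization

end Realization

end

noncomputable section

open Filter Topology

/-! ### The cross product -/

/-- The cross product in Euclidean 3-space. -/
def cross3 (u v : EuclideanSpace ℝ (Fin 3)) : EuclideanSpace ℝ (Fin 3) :=
  !₂[u 1 * v 2 - u 2 * v 1, u 2 * v 0 - u 0 * v 2, u 0 * v 1 - u 1 * v 0]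

theorem inner3 (u v : EuclideanSpace ℝ (Fin 3)) :
    inner ℝ u v = u 0 * v 0 + u 1 * v 1 + u 2 * v 2 := by
  simp [PiLp.inner_apply, Fin.sum_univ_three, mul_comm]

theorem ext3 {u v : EuclideanSpace ℝ (Fin 3)} (h0 : u 0 = v 0) (h1 : u 1 = v 1) (h2 : u 2 = v 2) :
    u = v := by
  ext i
  fin_cases i
  · exact h0
  · exact h1
  · exact h2

@[simp] theorem cross3_zero (u v : EuclideanSpace ℝ (Fin 3)) :
    cross3 u v 0 = u 1 * v 2 - u 2 * v 1 := rfl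

@[simp] theorem cross3_one (u v : EuclideanSpace ℝ (Fin 3)) :
    cross3 u v 1 = u 2 * v 0 - u 0 * v 2 := rfl

@[simp] theorem cross3_two (u v : EuclideanSpace ℝ (Fin 3)) :
    cross3 u v 2 = u 0 * v 1 - u 1 * v 0 := rfl

theorem eq_smul_of_cross3_eq_zero {u v : EuclideanSpace ℝ (Fin 3)} (hu : u ≠ 0)
    (h : cross3 u v = 0) : v = (inner ℝ u v / inner ℝ u u) • u := by
  have h0 : cross3 u v 0 = 0 := by rw [h]; rfl
  have h1 : cross3 u v 1 = 0 := by rw [h]; rfl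
  have h2 : cross3 u v 2 = 0 := by rw [h]; rfl
  simp only [cross3_zero, cross3_one, cross3_two] at h0 h1 h2
  have hpos : inner ℝ u u ≠ 0 := inner_self_ne_zero.2 hu
  rw [inner3] at hpos
  refine ext3 ?_ ?_ ?_ <;>
    simp only [PiLp.smul_apply, smul_eq_mul, inner3] <;> rw [div_mul_eq_mul_div, eq_div_iff hpos]
  · linear_combination (u 2) * h1 - (u 1) * h2
  · linear_combination (-u 2) * h0 + (u 0) * h2
  · linear_combination (u 1) * h0 - (u 0) * h1

/-- The affine function that vanishes on the plane spanned by `a`, `b`, `c`. -/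
def planeFun (a b c q : EuclideanSpace ℝ (Fin 3)) : ℝ :=
  inner ℝ (cross3 (b - a) (c - a)) q - inner ℝ (cross3 (b - a) (c - a)) a

theorem planeFun_eq (a b c q : EuclideanSpace ℝ (Fin 3)) :
    planeFun a b c q = inner ℝ (cross3 (b - a) (c - a)) (q - a) := by
  rw [planeFun, inner_sub_right]

theorem cross3_ne_zero {a b c : EuclideanSpace ℝ (Fin 3)} (ha : ‖a‖ = 1) (hb : ‖b‖ = 1)
    (hc : ‖c‖ = 1) (hab : a ≠ b) (hac : a ≠ c) (hbc : b ≠ c) : cross3 (b - a) (c - a) ≠ 0 := by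
  intro h
  have h1 := eq_smul_of_cross3_eq_zero (sub_ne_zero.2 hab.symm) h
  set x := inner ℝ (b - a) (c - a) / inner ℝ (b - a) (b - a)
  have h2 := eq_zero_of_sum_unit ha hb hc hab hac hbc (x := x - 1) (y := -x) (z := 1) (by ring)
    (by rw [sub_eq_iff_eq_add] at h1; rw [h1]; module)
  exact one_ne_zero h2.2.2

theorem planeFun_swap (a b c q : EuclideanSpace ℝ (Fin 3)) :
    planeFun a c b q = -planeFun a b c q := by
  simp only [planeFun_eq, inner3, cross3_zero, cross3_one, cross3_two, PiLp.sub_apply]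
  ring

theorem planeFun_rotate (a b c q : EuclideanSpace ℝ (Fin 3)) :
    planeFun b c a q = planeFun a b c q := by
  simp only [planeFun_eq, inner3, cross3_zero, cross3_one, cross3_two, PiLp.sub_apply]
  ring

/-- Both sides are signed volumes of the tetrahedron `a b c d`. For two faces with a common edge it
relates the side of each face on which the apex of the other lies. -/
theorem planeFun_exchange (a b c d : EuclideanSpace ℝ (Fin 3)) :
    planeFun a b c d = -planeFun a b d c := by
  simp only [planeFun_eq, inner3, cross3_zero, cross3_one, cross3_two, PiLp.sub_apply]
  ring

/-! ### The side of a face on which the polyhedron lies -/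

section Convex

variable {E : Type*} [NormedAddCommGroup E] [InnerProductSpace ℝ E]

/-- `D` is a nonconstant affine function. -/
def IsAffineFun (D : E → ℝ) : Prop := ∃ n : E, ∃ d : ℝ, n ≠ 0 ∧ ∀ q, D q = inner ℝ n q - d

theorem IsAffineFun.neg {D : E → ℝ} (h : IsAffineFun D) : IsAffineFun (-D) := by
  obtain ⟨n, d, hn, h⟩ := h
  refine ⟨-n, -d, neg_ne_zero.2 hn, fun q => ?_⟩
  simp [h, inner_neg_left]
  ring

theorem IsAffineFun.continuous {D : E → ℝ} (h : IsAffineFun D) : Continuous D := by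
  obtain ⟨n, d, hn, h⟩ := h
  rw [funext h]
  fun_prop

theorem IsAffineFun.combo {D : E → ℝ} (h : IsAffineFun D) {a b : ℝ} (hab : a + b = 1) (x y : E) :
    D (a • x + b • y) = a * D x + b * D y := by
  obtain ⟨n, d, hn, h⟩ := h
  simp only [h, inner_add_right, inner_smul_right]
  linear_combination d * (hab)

theorem IsAffineFun.convex_pos {D : E → ℝ} (h : IsAffineFun D) : Convex ℝ {q | 0 < D q} := by
  intro x hx y hy a b ha hb hab
  simp only [Set.mem_ofPred_eq] at *
  rw [h.combo hab]
  rcases ha.eq_or_lt with rfl | ha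
  · simp only [zero_add] at hab
    subst hab
    simpa using hy
  · have := mul_pos ha hx
    have := mul_nonneg hb hy.le
    linarith

theorem IsAffineFun.convex_neg {D : E → ℝ} (h : IsAffineFun D) : Convex ℝ {q | D q < 0} := by
  have := h.neg.convex_pos
  simpa using this

/-- Near every zero of an affine function there are points where it is positive. -/
theorem IsAffineFun.exists_pos {D : E → ℝ} (h : IsAffineFun D) {p : E} (hp : D p = 0)
    {U : Set E} (hU : U ∈ 𝓝 p) : ∃ q ∈ U, 0 < D q := by
  obtain ⟨n, d, hn, h⟩ := h
  have hc : Tendsto (fun s : ℝ => p + s • n) (𝓝[>] 0) (𝓝 p) := by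
    have : Continuous (fun s : ℝ => p + s • n) := by fun_prop
    simpa using (this.tendsto 0).mono_left (nhdsWithin_le_nhds (s := Set.Ioi 0))
  obtain ⟨s, hs, hs0⟩ := ((hc.eventually_mem hU).and self_mem_nhdsWithin).exists
  refine ⟨p + s • n, hs, ?_⟩
  rw [h] at hp ⊢
  rw [inner_add_right, inner_smul_right, real_inner_self_eq_norm_sq]
  have : 0 < s * ‖n‖ ^ 2 := mul_pos hs0 (by positivity)
  linarith

/-- A convex set that does not meet the frontier lies in the interior or in the exterior. -/
theorem Convex.subset_interior_or_disjoint {C B : Set E} (hC : Convex ℝ C)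
    (h : ∀ q ∈ C, q ∉ frontier B) : C ⊆ interior B ∨ ∀ q ∈ C, q ∉ B := by
  by_contra! hn
  obtain ⟨h1, q, hqC, hqB⟩ := hn
  rw [Set.not_subset] at h1
  obtain ⟨x, hxC, hx⟩ := h1
  have hq : q ∈ interior B := by_contra fun h' => h q hqC ⟨subset_closure hqB, h'⟩
  have hx' : x ∈ (closure B)ᶜ := fun h' => h x hxC ⟨h', hx⟩
  obtain ⟨y, -, hy1, hy2⟩ := hC.isPreconnected (interior B) (closure B)ᶜ isOpen_interior
    isClosed_closure.isOpen_compl (fun y hy => by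
      by_cases hy' : y ∈ interior B
      · exact Or.inl hy'
      · exact Or.inr fun h' => h y hy ⟨h', hy'⟩) ⟨q, hqC, hq⟩ ⟨x, hxC, hx'⟩
  exact hy2 (subset_closure (interior_subset hy1))

/-- Near `p`, the points where `D` is positive lie inside, and those where it is negative lie
outside of `B`. -/
def InnerAt (B : Set E) (p : E) (D : E → ℝ) : Prop :=
  ∀ᶠ q in 𝓝 p, (0 < D q → q ∈ interior B) ∧ (D q < 0 → q ∉ B)

variable {B : Set E} {D D' : E → ℝ} {p p' : E}

theorem InnerAt.not_neg (h : InnerAt B p D) (hD : IsAffineFun D) (hp : D p = 0) :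
    ¬ InnerAt B p (-D) := by
  intro h'
  obtain ⟨q, hq, hq0⟩ := hD.exists_pos hp (h.and h')
  exact hq.2.2 (by simpa using hq0) (interior_subset (hq.1.1 hq0))

/-- `C` is connected and misses the frontier, so it is entirely inside or entirely outside. It
contains points just on the positive side of both faces; those near `p` are inside, hence so are
those near `p'`. -/
theorem InnerAt.transport (h : InnerAt B p D) (hp : D p = 0) (hp' : D' p' = 0)
    (hD : IsAffineFun D) (hD' : IsAffineFun D')
    (h' : InnerAt B p' D' ∨ InnerAt B p' (-D')) {C U U' : Set E} (hC : Convex ℝ C)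
    (hCB : ∀ q ∈ C, q ∉ frontier B) (hU : U ∈ 𝓝 p) (hU' : U' ∈ 𝓝 p')
    (hUC : ∀ q ∈ U, 0 < D q → q ∈ C) (hUC' : ∀ q ∈ U', 0 < D' q → q ∈ C) : InnerAt B p' D' := by
  refine h'.resolve_right fun hn => ?_
  obtain ⟨q, hq, hq0⟩ := hD.exists_pos hp (inter_mem hU h)
  obtain ⟨q', hq', hq0'⟩ := hD'.exists_pos hp' (inter_mem hU' hn)
  rcases hC.subset_interior_or_disjoint hCB with h1 | h1
  · exact hq'.2.2 (by simpa using hq0') (interior_subset (h1 (hUC' q' hq'.1 hq0')))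
  · exact h1 q (hUC q hq.1 hq0) (interior_subset (hq.2.1 hq0))

/-- Here `C` lies on the negative sides. If `p'` had the opposite inner side, transporting the
negated function back from `p'` to `p` would contradict the side known at `p`. -/
theorem InnerAt.transport_neg (h : InnerAt B p D) (hp : D p = 0) (hp' : D' p' = 0)
    (hD : IsAffineFun D) (hD' : IsAffineFun D')
    (h' : InnerAt B p' D' ∨ InnerAt B p' (-D')) {C U U' : Set E} (hC : Convex ℝ C)
    (hCB : ∀ q ∈ C, q ∉ frontier B) (hU : U ∈ 𝓝 p) (hU' : U' ∈ 𝓝 p')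
    (hUC : ∀ q ∈ U, D q < 0 → q ∈ C) (hUC' : ∀ q ∈ U', D' q < 0 → q ∈ C) : InnerAt B p' D' := by
  refine h'.resolve_right fun hn => h.not_neg hD hp ?_
  refine hn.transport (by simpa using hp') (by simpa using hp) hD'.neg hD.neg ?_ hC hCB hU' hU
    (fun q hq h0 => hUC' q hq (by simpa using h0)) (fun q hq h0 => hUC q hq (by simpa using h0))
  rw [neg_neg]
  exact Or.inr h

/-- At a point near which the frontier is flat, the body is on exactly one side. -/
theorem innerAt_or_of_flat (hB : closure (interior B) = B) (hD : IsAffineFun D)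
    (hpB : p ∈ frontier B) (hflat : ∀ᶠ q in 𝓝 p, q ∈ frontier B → D q = 0) :
    InnerAt B p D ∨ InnerAt B p (-D) := by
  obtain ⟨ε, hε, hball⟩ := Metric.eventually_nhds_iff_ball.1 hflat
  have hC1 : Convex ℝ (Metric.ball p ε ∩ {q | 0 < D q}) := (convex_ball p ε).inter hD.convex_pos
  have hC2 : Convex ℝ (Metric.ball p ε ∩ {q | D q < 0}) := (convex_ball p ε).inter hD.convex_neg
  have hb := Metric.ball_mem_nhds p hε
  have hcl : IsClosed B := hB ▸ isClosed_closure
  rcases hC1.subset_interior_or_disjoint (fun q hq hqB => hq.2.ne' (hball q hq.1 hqB)) with h1 | h1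
  <;> rcases hC2.subset_interior_or_disjoint (fun q hq hqB => hq.2.ne (hball q hq.1 hqB))
    with h2 | h2
  -- With the interior on both sides, closedness of `B` puts a whole neighborhood of `p` in `B`.
  · exfalso
    refine hpB.2 (mem_interior_iff_mem_nhds.2 ?_)
    filter_upwards [hb] with q hq
    rcases lt_trichotomy (D q) 0 with h | h | h
    · exact interior_subset (h2 ⟨hq, h⟩)
    · rw [← hcl.closure_eq]
      rw [mem_closure_iff_nhds]
      intro W hW
      obtain ⟨x, hx, hx0⟩ := hD.exists_pos h (inter_mem hW (Metric.isOpen_ball.mem_nhds hq))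
      exact ⟨x, hx.1, interior_subset (h1 ⟨hx.2, hx0⟩)⟩
    · exact interior_subset (h1 ⟨hq, h⟩)
  · left
    filter_upwards [hb] with q hq
    exact ⟨fun h => h1 ⟨hq, h⟩, fun h => h2 q ⟨hq, h⟩⟩
  · right
    filter_upwards [hb] with q hq
    exact ⟨fun h => h2 ⟨hq, by simpa using h⟩, fun h => h1 q ⟨hq, by simpa using h⟩⟩
  -- With the exterior on both sides, interior points near `p` would all lie in the plane; yet `p`
  -- is a limit of interior points.
  · exfalso
    have hpB' : p ∈ closure (interior B) := by
      rw [hB, ← hcl.closure_eq]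
      exact hpB.1
    obtain ⟨x, hx, hxB⟩ := mem_closure_iff_nhds.1 hpB' _ hb
    have hx0 : D x = 0 := by
      rcases lt_trichotomy (D x) 0 with h | h | h
      · exact absurd (interior_subset hxB) (h2 x ⟨hx, h⟩)
      · exact h
      · exact absurd (interior_subset hxB) (h1 x ⟨hx, h⟩)
    obtain ⟨y, hy, hy0⟩ := hD.exists_pos hx0
      (inter_mem (isOpen_interior.mem_nhds hxB) (Metric.isOpen_ball.mem_nhds hx))
    exact h1 y ⟨hy.2, hy0⟩ (interior_subset hy.1)

/-- In a star-shaped body, the center of the star is not on the outer side of a face. -/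
theorem InnerAt.nonneg_of_starConvex {L : E} (hs : StarConvex ℝ L B) (h : InnerAt B p D)
    (hD : IsAffineFun D) (hp : D p = 0) (hpB : p ∈ B) : 0 ≤ D L := by
  by_contra! hL
  -- Moving from `p` slightly towards `L` makes `D` negative, so leaves the body, against
  -- star-shapedness.
  have hc : Tendsto (fun s : ℝ => s • L + (1 - s) • p) (𝓝[>] 0) (𝓝 p) := by
    have : Continuous (fun s : ℝ => s • L + (1 - s) • p) := by fun_prop
    simpa using (this.tendsto 0).mono_left (nhdsWithin_le_nhds (s := Set.Ioi 0))
  obtain ⟨s, hs1, hs0⟩ := ((hc.eventually h).and (Ioo_mem_nhdsGT (zero_lt_one' ℝ))).exists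
  refine hs1.2 ?_ (hs hpB hs0.1.le (by linarith [hs0.2]) (by ring))
  rw [hD.combo (by ring), hp]
  nlinarith [hs0.1]

/-- In a star-shaped body there is no point behind a face that is visible from the center. -/
theorem InnerAt.notMem_of_starConvex {L q : E} (hs : StarConvex ℝ L B) (h : InnerAt B p D)
    (hD : IsAffineFun D) (hp : D p = 0) (hL : 0 < D L) {r : ℝ} (hr : 1 < r)
    (hq : q = L + r • (p - L)) : q ∉ B := by
  intro hqB
  -- The parameter `1 / r` corresponds to `p`. A slightly larger parameter gives a point just behind
  -- the face, on the segment from `L` to `q`.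
  have hc : Tendsto (fun s : ℝ => (1 - s) • L + s • q) (𝓝[>] (1 / r)) (𝓝 p) := by
    have : Continuous (fun s : ℝ => (1 - s) • L + s • q) := by fun_prop
    have h1 := (this.tendsto (1 / r)).mono_left (nhdsWithin_le_nhds (s := Set.Ioi (1 / r)))
    have h2 : (1 - 1 / r) • L + (1 / r) • q = p := by
      have : r ≠ 0 := by positivity
      rw [hq, smul_add, smul_smul, one_div_mul_cancel this]
      module
    rwa [h2] at h1
  have hr1 : 1 / r < 1 := by
    rw [div_lt_one (by linarith)]; exact hr
  obtain ⟨s, hs1, hs0⟩ := ((hc.eventually h).and (Ioo_mem_nhdsGT hr1)).exists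
  have hr0 : 0 < r := by linarith
  have hs00 : 0 < s := lt_trans (by positivity) hs0.1
  refine hs1.2 ?_ (hs hqB (by linarith [hs0.2]) hs00.le (by ring))
  have hDq : D q = (1 - r) * D L := by
    have : q = (1 - r) • L + r • p := by rw [hq]; module
    rw [this, hD.combo (by ring), hp]
    ring
  rw [hD.combo (by ring), hDq]
  have : 1 < s * r := by
    have := hs0.1
    rwa [div_lt_iff₀ hr0] at this
  nlinarith

end Convex

end

noncomputable section

open Filter Topology

/-! ### Orientation of the faces by the side on which the polyhedron lies -/

section Orientation

variable {V : Type*} [Fintype V] [DecidableEq V] {T : SphereTriangulation V} {M : CuspMetric T}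

theorem sum_triple {E : Type*} [AddCommMonoid E] {i j k : V} (hij : i ≠ j) (hik : i ≠ k)
    (hjk : j ≠ k) (f : V → E) : ∑ a ∈ ({i, j, k} : Finset V), f a = f i + f j + f k := by
  rw [Finset.sum_insert (by simp [hij, hik]), Finset.sum_insert (by simp [hjk]),
    Finset.sum_singleton, add_assoc]

theorem SphereTriangulation.ne_of_mem_faces {i j k : V} (h : {i, j, k} ∈ T.faces) :
    i ≠ j ∧ i ≠ k ∧ j ≠ k := by
  have h3 := T.card_of_mem_faces _ h
  refine ⟨?_, ?_, ?_⟩ <;> rintro rfl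
  · have := Finset.card_le_two (a := i) (b := k)
    simp at h3
    omega
  · have := Finset.card_le_two (a := j) (b := i)
    rw [Finset.insert_eq_of_mem (by simp)] at h3
    omega
  · have := Finset.card_le_two (a := i) (b := j)
    simp at h3
    omega

/-- The point of the affine span of three vertices with given weights. -/
def weightsOf (i j k : V) (x y z : ℝ) (a : V) : ℝ :=
  if a = i then x else if a = j then y else if a = k then z else 0

theorem weightsOf_mem {i j k : V} (hij : i ≠ j) (hik : i ≠ k) (hjk : j ≠ k) {x y z : ℝ}
    (hx : 0 ≤ x) (hy : 0 ≤ y) (hz : 0 ≤ z) (h : x + y + z = 1) :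
    weightsOf i j k x y z ∈ simplexSet {i, j, k} := by
  have h0 : ∀ a ∉ ({i, j, k} : Finset V), weightsOf i j k x y z a = 0 := fun a ha => by
    simp only [Finset.mem_insert, Finset.mem_singleton, not_or] at ha
    simp [weightsOf, ha.1, ha.2.1, ha.2.2]
  refine ⟨fun a => ?_, ?_, h0⟩
  · unfold weightsOf
    split_ifs <;> first | assumption | exact le_rfl
  · rw [← Finset.sum_subset (Finset.subset_univ {i, j, k}) fun a _ ha => h0 a ha,
      sum_triple hij hik hjk]
    simp [weightsOf, hij.symm, hik.symm, hjk.symm, h]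

theorem weightsOf_sum {i j k : V} (hij : i ≠ j) (hik : i ≠ k) (hjk : j ≠ k) {x y z : ℝ}
    {E : Type*} [AddCommGroup E] [Module ℝ E] (η : V → E) :
    ∑ a ∈ ({i, j, k} : Finset V), weightsOf i j k x y z a • η a = x • η i + y • η j + z • η k := by
  rw [sum_triple hij hik hjk]
  simp [weightsOf, hij.symm, hik.symm, hjk.symm]

namespace IdealRealization

variable (R : IdealRealization T M)

/-- The relative interior of the image of a simplex. -/
def openFace (s : Finset V) : Set (EuclideanSpace ℝ (Fin 3)) :=
  {p | ∃ c ∈ simplexSet s, (∀ a ∈ s, 0 < c a) ∧ p = ∑ a ∈ s, c a • R.idealPt a}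

theorem mem_openFace_triple {i j k : V} (h : {i, j, k} ∈ T.faces) {x y z : ℝ}
    (hx : 0 < x) (hy : 0 < y) (hz : 0 < z) (h1 : x + y + z = 1) :
    x • R.idealPt i + y • R.idealPt j + z • R.idealPt k ∈ R.openFace {i, j, k} := by
  obtain ⟨hij, hik, hjk⟩ := T.ne_of_mem_faces h
  refine ⟨weightsOf i j k x y z, weightsOf_mem hij hik hjk hx.le hy.le hz.le h1, fun a ha => ?_,
    (weightsOf_sum hij hik hjk _).symm⟩
  simp only [Finset.mem_insert, Finset.mem_singleton] at ha
  rcases ha with rfl | rfl | rfl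
  · simpa [weightsOf] using hx
  · simpa [weightsOf, hij.symm] using hy
  · simpa [weightsOf, hik.symm, hjk.symm] using hz

theorem mem_convexHull_triple {i j k : V} (h : {i, j, k} ∈ T.faces) {x y z : ℝ}
    (hx : 0 ≤ x) (hy : 0 ≤ y) (hz : 0 ≤ z) (h1 : x + y + z = 1) :
    x • R.idealPt i + y • R.idealPt j + z • R.idealPt k ∈
      convexHull ℝ (R.idealPt '' (({i, j, k} : Finset V) : Set V)) := by
  obtain ⟨hij, hik, hjk⟩ := T.ne_of_mem_faces h
  exact (mem_convexHull_image_iff _ _ _).2 ⟨weightsOf i j k x y z,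
    weightsOf_mem hij hik hjk hx hy hz h1, (weightsOf_sum hij hik hjk _).symm⟩

theorem mem_openFace_pair {i j : V} (hij : i ≠ j) {x y : ℝ} (hx : 0 < x) (hy : 0 < y)
    (h1 : x + y = 1) : x • R.idealPt i + y • R.idealPt j ∈ R.openFace {i, j} := by
  refine ⟨x • vertexPt i + y • vertexPt j, convex_simplexSet _
    (vertexPt_mem_simplexSet (by simp)) (vertexPt_mem_simplexSet (by simp)) hx.le hy.le h1,
    fun a ha => ?_, ?_⟩
  · simp only [Finset.mem_insert, Finset.mem_singleton] at ha
    rcases ha with rfl | rfl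
    · simpa [vertexPt, hij] using hx
    · simpa [vertexPt, hij.symm] using hy
  · rw [Finset.sum_pair hij]
    simp [vertexPt, hij, hij.symm]

theorem openFace_subset (s : Finset V) :
    R.openFace s ⊆ convexHull ℝ (R.idealPt '' (s : Set V)) := by
  rintro _ ⟨c, hc, -, rfl⟩
  exact (mem_convexHull_image_iff _ _ _).2 ⟨c, hc, rfl⟩

theorem subset_of_mem_openFace {s s' t t' : Finset V} (ht : t ∈ T.faces) (hs : s ⊆ t)
    (ht' : t' ∈ T.faces) (hs' : s' ⊆ t') {p : EuclideanSpace ℝ (Fin 3)} (hp : p ∈ R.openFace s)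
    (hp' : p ∈ convexHull ℝ (R.idealPt '' (s' : Set V))) : s ⊆ s' := by
  obtain ⟨c, hc, hc0, rfl⟩ := hp
  exact R.subset_of_mem_convexHull ht ht' hs hc hc0 hs' hp'

theorem eq_of_mem_openFace {t t' : Finset V} (ht : t ∈ T.faces) (ht' : t' ∈ T.faces)
    {p : EuclideanSpace ℝ (Fin 3)} (hp : p ∈ R.openFace t)
    (hp' : p ∈ convexHull ℝ (R.idealPt '' (t' : Set V))) : t = t' :=
  Finset.eq_of_subset_of_card_le (R.subset_of_mem_openFace ht subset_rfl ht' subset_rfl hp hp')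
    (by rw [T.card_of_mem_faces t ht, T.card_of_mem_faces t' ht'])

theorem convex_openFace (s : Finset V) : Convex ℝ (R.openFace s) := by
  rintro _ ⟨c, hc, hc0, rfl⟩ _ ⟨d, hd, hd0, rfl⟩ a b ha hb hab
  refine ⟨a • c + b • d, convex_simplexSet s hc hd ha hb hab, fun i hi => ?_, ?_⟩
  · simp only [Pi.add_apply, Pi.smul_apply, smul_eq_mul]
    rcases ha.eq_or_lt with rfl | ha
    · simp only [zero_add] at hab
      subst hab
      simpa using hd0 i hi
    · have := mul_pos ha (hc0 i hi)
      have := mul_nonneg hb (hd0 i hi).le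
      linarith
  · simp [add_smul, Finset.sum_add_distrib, Finset.smul_sum, smul_smul]

theorem isCompact_hull (s : Finset V) : IsCompact (convexHull ℝ (R.idealPt '' (s : Set V))) :=
  Set.Finite.isCompact_convexHull ℝ (s.finite_toSet.image _)

theorem openFace_subset_frontier {t : Finset V} (ht : t ∈ T.faces) :
    R.openFace t ⊆ frontier R.body := by
  rw [R.frontier_eq]
  exact (R.openFace_subset t).trans
    (Set.subset_biUnion_of_mem (u := fun t : Finset V => convexHull ℝ (R.idealPt '' (t : Set V)))
      (show t ∈ (T.faces : Set _) from ht))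

/-- Near a compact set, the frontier consists of those faces that meet the set. -/
theorem exists_thickening {K : Set (EuclideanSpace ℝ (Fin 3))} (hK : IsCompact K)
    (A : Finset (Finset V))
    (h : ∀ t ∈ T.faces, t ∉ A → ∀ p ∈ K, p ∉ convexHull ℝ (R.idealPt '' (t : Set V))) :
    ∃ δ > 0, ∀ q ∈ Metric.thickening δ K, q ∈ frontier R.body →
      ∃ t ∈ A, q ∈ convexHull ℝ (R.idealPt '' (t : Set V)) := by
  -- The finitely many remaining faces form a closed set disjoint from the compact set `K`, hence
  -- have disjoint thickenings.
  have hcl : IsClosed (⋃ t ∈ T.faces \ A, convexHull ℝ (R.idealPt '' ((t : Finset V) : Set V))) :=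
    (Finset.isCompact_biUnion _ fun t _ => R.isCompact_hull t).isClosed
  have hdis : Disjoint K (⋃ t ∈ T.faces \ A, convexHull ℝ (R.idealPt '' ((t : Finset V) : Set V))) := by
    rw [Set.disjoint_left]
    intro p hp hp'
    simp only [Set.mem_iUnion] at hp'
    obtain ⟨t, ht, hpt⟩ := hp'
    rw [Finset.mem_sdiff] at ht
    exact h t ht.1 ht.2 p hp hpt
  obtain ⟨δ, hδ, hd⟩ := hdis.exists_thickenings hK hcl
  refine ⟨δ, hδ, fun q hq hqf => ?_⟩
  rw [R.frontier_eq] at hqf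
  simp only [Set.mem_iUnion] at hqf
  obtain ⟨t, ht, hqt⟩ := hqf
  refine ⟨t, ?_, hqt⟩
  by_contra htA
  refine Set.disjoint_left.1 hd hq (Metric.self_subset_thickening hδ _ ?_)
  simp only [Set.mem_iUnion]
  exact ⟨t, Finset.mem_sdiff.2 ⟨ht, htA⟩, hqt⟩

variable {D : EuclideanSpace ℝ (Fin 3) → ℝ}

theorem affine_eq_zero_of_mem_convexHull {D : EuclideanSpace ℝ (Fin 3) → ℝ} (hD : IsAffineFun D)
    {s : Finset V} (h0 : ∀ a ∈ s, D (R.idealPt a) = 0) {p : EuclideanSpace ℝ (Fin 3)}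
    (hp : p ∈ convexHull ℝ (R.idealPt '' (s : Set V))) : D p = 0 := by
  have hconv : Convex ℝ {q | D q = 0} := by
    intro x hx y hy a b _ _ hab
    simp only [Set.mem_ofPred_eq] at *
    rw [hD.combo hab, hx, hy]
    ring
  refine convexHull_min ?_ hconv hp
  rintro _ ⟨a, ha, rfl⟩
  exact h0 a ha

/-- A point of an open face lies on no other face, so the frontier near it is contained in one plane
and `innerAt_or_of_flat` applies. -/
theorem innerAt_or {t : Finset V} (ht : t ∈ T.faces) (hD : IsAffineFun D)
    (h0 : ∀ a ∈ t, D (R.idealPt a) = 0) {p : EuclideanSpace ℝ (Fin 3)} (hp : p ∈ R.openFace t) :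
    InnerAt R.body p D ∨ InnerAt R.body p (-D) := by
  obtain ⟨δ, hδ, h⟩ := R.exists_thickening (isCompact_singleton (x := p)) {t}
    fun t' ht' hne q hq hqt => by
      rw [Set.mem_singleton_iff] at hq
      subst hq
      exact hne (by simp [R.eq_of_mem_openFace ht ht' hp hqt])
  refine innerAt_or_of_flat R.closure_interior_body hD (R.openFace_subset_frontier ht hp) ?_
  rw [Metric.thickening_singleton] at h
  filter_upwards [Metric.ball_mem_nhds p hδ] with q hq hqf
  obtain ⟨t', ht', hqt⟩ := h q hq hqf
  rw [Finset.mem_singleton] at ht'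
  subst ht'
  exact R.affine_eq_zero_of_mem_convexHull hD h0 hqt

/-- The polyhedron is on the same side along a whole face. -/
theorem innerAt_congr {t : Finset V} (ht : t ∈ T.faces) (hD : IsAffineFun D)
    (h0 : ∀ a ∈ t, D (R.idealPt a) = 0) {p p' : EuclideanSpace ℝ (Fin 3)} (hp : p ∈ R.openFace t)
    (hp' : p' ∈ R.openFace t) (h : InnerAt R.body p D) : InnerAt R.body p' D := by
  have hseg := (R.convex_openFace t).segment_subset hp hp'
  have hK : IsCompact (segment ℝ p p') := by
    rw [← convexHull_pair]
    exact Set.Finite.isCompact_convexHull ℝ (Set.toFinite _)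
  obtain ⟨δ, hδ, hth⟩ := R.exists_thickening hK {t}
    fun t' ht' hne q hq hqt => hne (by simp [R.eq_of_mem_openFace ht ht' (hseg hq) hqt])
  have hz : ∀ q ∈ R.openFace t, D q = 0 := fun q hq =>
    R.affine_eq_zero_of_mem_convexHull hD h0 (R.openFace_subset t hq)
  have hmem : ∀ q ∈ segment ℝ p p', Metric.thickening δ (segment ℝ p p') ∈ 𝓝 q := fun q hq =>
    Metric.isOpen_thickening.mem_nhds (Metric.self_subset_thickening hδ _ hq)
  -- The positive half of a thin neighborhood of the segment is convex. The frontier there consists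
  -- of the face itself, on which `D` vanishes.
  refine h.transport (hz p hp) (hz p' hp') hD hD (R.innerAt_or ht hD h0 hp')
    (((convex_segment p p').thickening δ).inter hD.convex_pos) ?_
    (hmem p (left_mem_segment ℝ p p')) (hmem p' (right_mem_segment ℝ p p'))
    (fun q hq hq0 => ⟨hq, hq0⟩) (fun q hq hq0 => ⟨hq, hq0⟩)
  rintro q ⟨hq, hq0⟩ hqf
  obtain ⟨t', ht', hqt⟩ := hth q hq hqf
  rw [Finset.mem_singleton] at ht'
  subst ht'
  exact hq0.ne' (R.affine_eq_zero_of_mem_convexHull hD h0 hqt)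

/-- The affine function that vanishes on the plane of the face `i j k`. -/
def faceFun (i j k : V) : EuclideanSpace ℝ (Fin 3) → ℝ :=
  planeFun (R.idealPt i) (R.idealPt j) (R.idealPt k)

theorem isAffineFun_faceFun {i j k : V} (hij : i ≠ j) (hik : i ≠ k) (hjk : j ≠ k) :
    IsAffineFun (R.faceFun i j k) :=
  ⟨_, _, cross3_ne_zero (R.norm_idealPt i) (R.norm_idealPt j) (R.norm_idealPt k)
    (fun h => hij (R.idealPt_injective h)) (fun h => hik (R.idealPt_injective h))
    (fun h => hjk (R.idealPt_injective h)), fun _ => rfl⟩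

theorem faceFun_swap (i j k : V) : R.faceFun i k j = -R.faceFun i j k :=
  funext fun _ => planeFun_swap _ _ _ _

theorem faceFun_rotate (i j k : V) : R.faceFun j k i = R.faceFun i j k :=
  funext fun _ => planeFun_rotate _ _ _ _

theorem faceFun_left (i j k : V) : R.faceFun i j k (R.idealPt i) = 0 := by
  simp [faceFun, planeFun_eq]

theorem faceFun_eq_zero {i j k : V} : ∀ a ∈ ({i, j, k} : Finset V),
    R.faceFun i j k (R.idealPt a) = 0 := by
  intro a ha
  simp only [Finset.mem_insert, Finset.mem_singleton] at ha
  rcases ha with rfl | rfl | rfl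
  · exact R.faceFun_left _ _ _
  · rw [← R.faceFun_rotate]
    exact R.faceFun_left _ _ _
  · rw [← R.faceFun_rotate, ← R.faceFun_rotate]
    exact R.faceFun_left _ _ _

theorem faceFun_openFace {i j k : V} (hij : i ≠ j) (hik : i ≠ k) (hjk : j ≠ k)
    {p : EuclideanSpace ℝ (Fin 3)} (hp : p ∈ R.openFace {i, j, k}) : R.faceFun i j k p = 0 :=
  R.affine_eq_zero_of_mem_convexHull (R.isAffineFun_faceFun hij hik hjk) R.faceFun_eq_zero
    (R.openFace_subset _ hp)

/-- `(i, j, k)` is a face, oriented so that the polyhedron lies on its positive side. -/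
def Oriented (i j k : V) : Prop :=
  {i, j, k} ∈ T.faces ∧ ∀ p ∈ R.openFace {i, j, k}, InnerAt R.body p (R.faceFun i j k)

variable {R} {i j k m l : V}

theorem triple_rotate (i j k : V) : ({j, k, i} : Finset V) = {i, j, k} := by
  ext a
  simp only [Finset.mem_insert, Finset.mem_singleton]
  tauto

theorem triple_swap (i j k : V) : ({i, k, j} : Finset V) = {i, j, k} := by
  ext a
  simp only [Finset.mem_insert, Finset.mem_singleton]
  tauto

theorem Oriented.rotate (h : R.Oriented i j k) : R.Oriented j k i := by
  unfold Oriented at *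
  rw [triple_rotate, R.faceFun_rotate]
  exact h

variable (R) in
theorem center_mem (h : {i, j, k} ∈ T.faces) :
    (1 / 3 : ℝ) • R.idealPt i + (1 / 3 : ℝ) • R.idealPt j + (1 / 3 : ℝ) • R.idealPt k ∈
      R.openFace {i, j, k} :=
  R.mem_openFace_triple h (by norm_num) (by norm_num) (by norm_num) (by norm_num)

theorem oriented_of_innerAt (h : {i, j, k} ∈ T.faces) {p : EuclideanSpace ℝ (Fin 3)}
    (hp : p ∈ R.openFace {i, j, k}) (hi : InnerAt R.body p (R.faceFun i j k)) :
    R.Oriented i j k := by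
  obtain ⟨hij, hik, hjk⟩ := T.ne_of_mem_faces h
  exact ⟨h, fun q hq => R.innerAt_congr h (R.isAffineFun_faceFun hij hik hjk) R.faceFun_eq_zero
    hp hq hi⟩

variable (R) in
theorem oriented_or (h : {i, j, k} ∈ T.faces) : R.Oriented i j k ∨ R.Oriented i k j := by
  obtain ⟨hij, hik, hjk⟩ := T.ne_of_mem_faces h
  rcases R.innerAt_or h (R.isAffineFun_faceFun hij hik hjk) R.faceFun_eq_zero (R.center_mem h)
    with h1 | h1
  · exact Or.inl (oriented_of_innerAt h (R.center_mem h) h1)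
  · right
    rw [← R.faceFun_swap] at h1
    have h2 := R.center_mem h
    rw [← triple_swap] at h h2
    exact oriented_of_innerAt h h2 h1

theorem Oriented.not_swap (h : R.Oriented i j k) : ¬ R.Oriented i k j := by
  intro h'
  obtain ⟨hij, hik, hjk⟩ := T.ne_of_mem_faces h.1
  have hp := R.center_mem h.1
  have h1 := h.2 _ hp
  have hp' := hp
  rw [← triple_swap] at hp'
  have h2 := h'.2 _ hp'
  rw [R.faceFun_swap] at h2
  exact h1.not_neg (R.isAffineFun_faceFun hij hik hjk) (R.faceFun_openFace hij hik hjk hp) h2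

end IdealRealization

end Orientation

end

noncomputable section

open Filter Topology

/-! ### Coherence of the orientations of neighboring faces -/

section Coherence

variable {V : Type*} [Fintype V] [DecidableEq V] {T : SphereTriangulation V} {M : CuspMetric T}

theorem SphereTriangulation.eq_or_eq_of_edge {i j k m : V} (hk : {i, j, k} ∈ T.faces)
    (hm : {i, j, m} ∈ T.faces) (hkm : k ≠ m) {t : Finset V} (ht : t ∈ T.faces)
    (hs : {i, j} ⊆ t) : t = {i, j, k} ∨ t = {i, j, m} := by
  obtain ⟨hij, hik, hjk⟩ := T.ne_of_mem_faces hk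
  obtain ⟨-, him, hjm⟩ := T.ne_of_mem_faces hm
  have hsub : ∀ a : V, ({i, j} : Finset V) ⊆ {i, j, a} := fun a x hx => by
    simp only [Finset.mem_insert, Finset.mem_singleton] at *
    tauto
  have hcard := T.card_faces_of_edge {i, j} (Finset.card_pair hij) ⟨t, ht, hs⟩
  have hne : ({i, j, k} : Finset V) ≠ {i, j, m} := by
    intro h
    have : k ∈ ({i, j, m} : Finset V) := by rw [← h]; simp
    simp only [Finset.mem_insert, Finset.mem_singleton] at this
    rcases this with h | h | h
    · exact hik h.symm
    · exact hjk h.symm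
    · exact hkm h
  have h2 : ({{i, j, k}, {i, j, m}} : Finset (Finset V)) = T.faces.filter (fun t => {i, j} ⊆ t) := by
    refine Finset.eq_of_subset_of_card_le ?_ (by rw [hcard, Finset.card_pair hne])
    intro x hx
    simp only [Finset.mem_insert, Finset.mem_singleton] at hx
    rcases hx with rfl | rfl
    · exact Finset.mem_filter.2 ⟨hk, hsub _⟩
    · exact Finset.mem_filter.2 ⟨hm, hsub _⟩
  have h3 : t ∈ T.faces.filter (fun t => {i, j} ⊆ t) := Finset.mem_filter.2 ⟨ht, hs⟩
  rw [← h2] at h3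
  simpa using h3

/-- When `w` lies in the plane of `u` and `v`, the right side vanishes and the normals `cross3 u v`
and `cross3 u w` are parallel. This settles the coplanar case of `Oriented.coherent`. -/
theorem cross3_cross3 (u v w : EuclideanSpace ℝ (Fin 3)) :
    cross3 (cross3 u v) (cross3 u w) = (inner ℝ (cross3 u v) w) • u := by
  refine ext3 ?_ ?_ ?_ <;>
    simp only [PiLp.smul_apply, smul_eq_mul, inner3, cross3_zero, cross3_one, cross3_two] <;> ring

theorem cross3_sub_smul (u v w : EuclideanSpace ℝ (Fin 3)) (y : ℝ) :
    cross3 u (w - y • v) = cross3 u w - y • cross3 u v := by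
  refine ext3 ?_ ?_ ?_ <;>
    simp only [PiLp.smul_apply, PiLp.sub_apply, smul_eq_mul, cross3_zero, cross3_one,
      cross3_two] <;> ring

namespace IdealRealization

variable {R : IdealRealization T M} {i j k m : V}

/-- Neighboring faces are oriented coherently. -/
theorem Oriented.coherent (h : R.Oriented i j k) (hm : {i, j, m} ∈ T.faces) (hkm : k ≠ m) :
    R.Oriented i m j := by
  have hk := h.1
  obtain ⟨hij, hik, hjk⟩ := T.ne_of_mem_faces hk
  obtain ⟨-, him, hjm⟩ := T.ne_of_mem_faces hm
  have hmt : m ∉ ({i, j, k} : Finset V) := by simp [him.symm, hjm.symm, hkm.symm]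
  set e₀ := (1 / 2 : ℝ) • R.idealPt i + (1 / 2 : ℝ) • R.idealPt j with he₀
  have he₀E : e₀ ∈ R.openFace {i, j} :=
    R.mem_openFace_pair hij (by norm_num) (by norm_num) (by norm_num)
  have hsub : ({i, j} : Finset V) ⊆ {i, j, k} := fun x hx => by
    simp only [Finset.mem_insert, Finset.mem_singleton] at *
    tauto
  obtain ⟨δ, hδ, hth⟩ := R.exists_thickening (isCompact_singleton (x := e₀))
    {{i, j, k}, {i, j, m}} fun t ht hne p hp hpt => by
      rw [Set.mem_singleton_iff] at hp
      subst hp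
      refine hne ?_
      have := T.eq_or_eq_of_edge hk hm hkm ht
        (R.subset_of_mem_openFace hk hsub ht subset_rfl he₀E hpt)
      simpa using this
  rw [Metric.thickening_singleton] at hth
  -- points of the two faces near the edge
  set P : V → ℝ → EuclideanSpace ℝ (Fin 3) := fun a r =>
    ((1 - r) / 2) • R.idealPt i + ((1 - r) / 2) • R.idealPt j + r • R.idealPt a with hP
  have hPc : ∀ a, Tendsto (P a) (𝓝[>] 0) (𝓝 e₀) := fun a => by
    have hc : Continuous (P a) := by simp only [hP]; fun_prop
    have := (hc.tendsto 0).mono_left (nhdsWithin_le_nhds (s := Set.Ioi 0))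
    simpa [hP, he₀] using this
  have hPball : ∀ a, ∀ᶠ r in 𝓝[>] (0 : ℝ), P a r ∈ Metric.ball e₀ δ := fun a =>
    (hPc a).eventually_mem (Metric.ball_mem_nhds e₀ hδ)
  have hr01 : ∀ᶠ r in 𝓝[>] (0 : ℝ), r ∈ Set.Ioo (0 : ℝ) 1 := Ioo_mem_nhdsGT (zero_lt_one' ℝ)
  have hPface : ∀ a, {i, j, a} ∈ T.faces → ∀ r ∈ Set.Ioo (0 : ℝ) 1, P a r ∈ R.openFace {i, j, a} :=
    fun a ha r hr => R.mem_openFace_triple ha (by linarith [hr.2]) (by linarith [hr.2]) hr.1 (by ring)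
  have hDt := R.isAffineFun_faceFun hij hik hjk
  have hDs := R.isAffineFun_faceFun hij him hjm
  have hz0 : ∀ {a}, ∀ b ∈ ({i, j, a} : Finset V), R.faceFun i j a (R.idealPt b) = 0 :=
    fun b hb => R.faceFun_eq_zero b hb
  have hDP : ∀ a b, IsAffineFun (R.faceFun i j a) → ∀ r,
      R.faceFun i j a (P b r) = r * R.faceFun i j a (R.idealPt b) := by
    intro a b hDa r
    have h1 : P b r = (1 - r) • ((1 / 2 : ℝ) • R.idealPt i + (1 / 2 : ℝ) • R.idealPt j) +
        r • R.idealPt b := by simp only [hP]; module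
    rw [h1, hDa.combo (by ring), hDa.combo (by norm_num), hz0 i (by simp), hz0 j (by simp)]
    ring
  have hexch : R.faceFun i j m (R.idealPt k) = -R.faceFun i j k (R.idealPt m) :=
    planeFun_exchange _ _ _ _
  have hfr : ∀ q ∈ Metric.ball e₀ δ, R.faceFun i j k q ≠ 0 → R.faceFun i j m q ≠ 0 →
      q ∉ frontier R.body := by
    intro q hq h1 h2 hqf
    obtain ⟨t, ht, hqt⟩ := hth q hq hqf
    simp only [Finset.mem_insert, Finset.mem_singleton] at ht
    rcases ht with rfl | rfl
    · exact h1 (R.affine_eq_zero_of_mem_convexHull hDt R.faceFun_eq_zero hqt)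
    · exact h2 (R.affine_eq_zero_of_mem_convexHull hDs R.faceFun_eq_zero hqt)
  -- it suffices to find the side near one point
  have suff : ∀ p ∈ R.openFace {i, j, m}, InnerAt R.body p (-R.faceFun i j m) →
      R.Oriented i m j := by
    intro p hp hip
    rw [← R.faceFun_swap] at hip
    rw [← triple_swap] at hp
    exact oriented_of_innerAt (by rw [triple_swap]; exact hm) hp hip
  have hor : ∀ p ∈ R.openFace {i, j, m}, InnerAt R.body p (-R.faceFun i j m) ∨
      InnerAt R.body p (- -R.faceFun i j m) := fun p hp => by
    rw [neg_neg, or_comm]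
    exact R.innerAt_or hm hDs R.faceFun_eq_zero hp
  have hballnhds : ∀ q ∈ Metric.ball e₀ δ, Metric.ball e₀ δ ∈ 𝓝 q := fun q hq =>
    Metric.isOpen_ball.mem_nhds hq
  have hDtc := hDt.continuous
  have hDsc := hDs.continuous
  -- The sign tells whether the edge is reflex, flat or convex. In the convex case the wedge between
  -- the faces is inside; in the reflex case the wedge is outside; in the flat case a half-ball
  -- replaces the wedge. Each is convex and carries the known side of one face to the other.
  rcases lt_trichotomy (R.faceFun i j k (R.idealPt m)) 0 with hlt | heq | hgt
  · obtain ⟨r, ⟨hr1, hr2⟩, hr⟩ := (((hPball k).and (hPball m)).and hr01).exists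
    have hp := hPface k hk r hr
    have hq := hPface m hm r hr
    refine suff _ hq ((h.2 _ hp).transport_neg (R.faceFun_openFace hij hik hjk hp)
      (by simpa using R.faceFun_openFace hij him hjm hq) hDt hDs.neg (hor _ hq)
      (C := Metric.ball e₀ δ ∩ ({q | R.faceFun i j k q < 0} ∩ {q | 0 < R.faceFun i j m q}))
      (U := Metric.ball e₀ δ ∩ {q | 0 < R.faceFun i j m q})
      (U' := Metric.ball e₀ δ ∩ {q | R.faceFun i j k q < 0})
      ((convex_ball _ _).inter (hDt.convex_neg.inter hDs.convex_pos))
      (fun q hq => hfr q hq.1 hq.2.1.ne hq.2.2.ne')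
      (inter_mem (hballnhds _ hr1) ((isOpen_lt continuous_const hDsc).mem_nhds ?_))
      (inter_mem (hballnhds _ hr2) ((isOpen_lt hDtc continuous_const).mem_nhds ?_))
      (fun q hq h0 => ⟨hq.1, h0, hq.2⟩) (fun q hq h0 => ⟨hq.1, hq.2, by simpa using h0⟩))
    · change 0 < R.faceFun i j m (P k r)
      rw [hDP _ _ hDs, hexch]
      exact mul_pos hr.1 (by linarith)
    · change R.faceFun i j k (P m r) < 0
      rw [hDP _ _ hDt]
      exact mul_neg_of_pos_of_neg hr.1 hlt
  · set u := R.idealPt j - R.idealPt i with hu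
    set v := R.idealPt k - R.idealPt i with hv
    set w := R.idealPt m - R.idealPt i with hw
    have hu0 : u ≠ 0 := sub_ne_zero.2 fun h => hij (R.idealPt_injective h).symm
    have hn0 : cross3 u v ≠ 0 := cross3_ne_zero (R.norm_idealPt i) (R.norm_idealPt j)
      (R.norm_idealPt k) (fun h => hij (R.idealPt_injective h))
      (fun h => hik (R.idealPt_injective h)) (fun h => hjk (R.idealPt_injective h))
    have h1 : inner ℝ (cross3 u v) w = 0 := by
      rw [← heq, faceFun, planeFun_eq]
    have h2 := eq_smul_of_cross3_eq_zero hn0 (by rw [cross3_cross3, h1, zero_smul] :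
      cross3 (cross3 u v) (cross3 u w) = 0)
    set y := inner ℝ (cross3 u v) (cross3 u w) / inner ℝ (cross3 u v) (cross3 u v)
    have h3 := eq_smul_of_cross3_eq_zero hu0
      (by rw [cross3_sub_smul, h2, sub_self] : cross3 u (w - y • v) = 0)
    set x := inner ℝ u (w - y • v) / inner ℝ u u
    have hDsy : ∀ q, R.faceFun i j m q = y * R.faceFun i j k q := fun q => by
      rw [faceFun, faceFun, planeFun_eq, planeFun_eq]
      change inner ℝ (cross3 u w) _ = y * inner ℝ (cross3 u v) _
      rw [h2, inner_smul_left]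
      rfl
    have hm' : R.idealPt m = (1 - x - y) • R.idealPt i + x • R.idealPt j + y • R.idealPt k := by
      have : R.idealPt m = w + R.idealPt i := by rw [hw]; module
      rw [this, sub_eq_iff_eq_add.1 h3, hu, hv]
      module
    -- The coplanar faces lie on opposite sides of the edge. Otherwise points of the second face
    -- near the midpoint of the edge would belong to the first one.
    have hy : y < 0 := by
      by_contra! hy
      have hev : ∀ b : ℝ, ∀ᶠ r in 𝓝[>] (0 : ℝ), 0 < (1 - r) / 2 + r * b := fun b => by
        have hc : Continuous (fun r : ℝ => (1 - r) / 2 + r * b) := by fun_prop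
        exact ((hc.tendsto 0).mono_left (nhdsWithin_le_nhds (s := Set.Ioi 0))).eventually_const_lt
          (by norm_num)
      obtain ⟨r, ⟨hr1, hr2⟩, hr⟩ := (((hev (1 - x - y)).and (hev x)).and hr01).exists
      have hq := hPface m hm r hr
      have hq' : P m r ∈ convexHull ℝ (R.idealPt '' (({i, j, k} : Finset V) : Set V)) := by
        have : P m r = ((1 - r) / 2 + r * (1 - x - y)) • R.idealPt i +
            ((1 - r) / 2 + r * x) • R.idealPt j + (r * y) • R.idealPt k := by
          simp only [hP]
          rw [hm']
          module
        rw [this]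
        exact R.mem_convexHull_triple hk hr1.le hr2.le (mul_nonneg hr.1.le hy) (by ring)
      have := R.eq_of_mem_openFace hm hk hq hq'
      rw [← this] at hmt
      simp at hmt
    obtain ⟨r, ⟨hr1, hr2⟩, hr⟩ := (((hPball k).and (hPball m)).and hr01).exists
    have hp := hPface k hk r hr
    have hq := hPface m hm r hr
    refine suff _ hq ((h.2 _ hp).transport (R.faceFun_openFace hij hik hjk hp)
      (by simpa using R.faceFun_openFace hij him hjm hq) hDt hDs.neg (hor _ hq)
      (C := Metric.ball e₀ δ ∩ {q | 0 < R.faceFun i j k q})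
      ((convex_ball _ _).inter hDt.convex_pos)
      (fun q hq => hfr q hq.1 hq.2.ne' ?_)
      (hballnhds _ hr1) (hballnhds _ hr2)
      (fun q hq h0 => ⟨hq, h0⟩) (fun q hq h0 => ⟨hq, ?_⟩))
    · rw [hDsy]
      exact (mul_neg_of_neg_of_pos hy hq.2).ne
    · simp only [Pi.neg_apply, hDsy] at h0
      change 0 < R.faceFun i j k q
      nlinarith
  · obtain ⟨r, ⟨hr1, hr2⟩, hr⟩ := (((hPball k).and (hPball m)).and hr01).exists
    have hp := hPface k hk r hr
    have hq := hPface m hm r hr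
    refine suff _ hq ((h.2 _ hp).transport (R.faceFun_openFace hij hik hjk hp)
      (by simpa using R.faceFun_openFace hij him hjm hq) hDt hDs.neg (hor _ hq)
      (C := Metric.ball e₀ δ ∩ ({q | 0 < R.faceFun i j k q} ∩ {q | R.faceFun i j m q < 0}))
      (U := Metric.ball e₀ δ ∩ {q | R.faceFun i j m q < 0})
      (U' := Metric.ball e₀ δ ∩ {q | 0 < R.faceFun i j k q})
      ((convex_ball _ _).inter (hDt.convex_pos.inter hDs.convex_neg))
      (fun q hq => hfr q hq.1 hq.2.1.ne' hq.2.2.ne)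
      (inter_mem (hballnhds _ hr1) ((isOpen_lt hDsc continuous_const).mem_nhds ?_))
      (inter_mem (hballnhds _ hr2) ((isOpen_lt continuous_const hDtc).mem_nhds ?_))
      (fun q hq h0 => ⟨hq.1, h0, hq.2⟩) (fun q hq h0 => ⟨hq.1, hq.2, by simpa using h0⟩))
    · change R.faceFun i j m (P k r) < 0
      rw [hDP _ _ hDs, hexch]
      exact mul_neg_of_pos_of_neg hr.1 (by linarith)
    · change 0 < R.faceFun i j k (P m r)
      rw [hDP _ _ hDt]
      exact mul_pos hr.1 hgt

end IdealRealization

end Coherence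

end

noncomputable section

/-! ### Oriented triangulations -/

section Combinatorics

variable {V : Type*} [Fintype V] [DecidableEq V] {T : SphereTriangulation V}

/-- A coherent choice of a cyclic order of the vertices of every triangle. -/
structure IsOrientation (T : SphereTriangulation V) (O : V → V → V → Prop) : Prop where
  mem : ∀ {i j k}, O i j k → {i, j, k} ∈ T.faces
  rotate : ∀ {i j k}, O i j k → O j k i
  or_swap : ∀ {i j k}, {i, j, k} ∈ T.faces → O i j k ∨ O i k j
  not_swap : ∀ {i j k}, O i j k → ¬ O i k j
  coherent : ∀ {i j k m}, O i j k → {i, j, m} ∈ T.faces → k ≠ m → O i m j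

theorem IdealRealization.isOrientation {M : CuspMetric T} (R : IdealRealization T M) :
    IsOrientation T R.Oriented where
  mem h := h.1
  rotate h := h.rotate
  or_swap h := R.oriented_or h
  not_swap h := h.not_swap
  coherent h := h.coherent

theorem SphereTriangulation.exists_third {t : Finset V} (ht : t ∈ T.faces) {i j : V} (hi : i ∈ t)
    (hj : j ∈ t) (hij : i ≠ j) : ∃ k, {i, j, k} = t := by
  have h1 : ({i, j} : Finset V) ⊆ t := by
    intro x hx
    simp only [Finset.mem_insert, Finset.mem_singleton] at hx
    rcases hx with rfl | rfl <;> assumption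
  have h2 : (t \ {i, j}).card = 1 := by
    rw [Finset.card_sdiff_of_subset h1, T.card_of_mem_faces t ht, Finset.card_pair hij]
  obtain ⟨k, hk⟩ := Finset.card_eq_one.1 h2
  refine ⟨k, ?_⟩
  rw [← Finset.sdiff_union_of_subset h1, hk]
  ext a
  simp only [Finset.mem_insert, Finset.mem_singleton, Finset.mem_union]
  tauto

/-- The neighbor relation of the triangulation. -/
def SphereTriangulation.Edge (T : SphereTriangulation V) (i j : V) : Prop :=
  ∃ k, {i, j, k} ∈ T.faces

theorem SphereTriangulation.Edge.ne {i j : V} (h : T.Edge i j) : i ≠ j := by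
  obtain ⟨k, hk⟩ := h
  exact (T.ne_of_mem_faces hk).1

theorem SphereTriangulation.Edge.symm {i j : V} (h : T.Edge i j) : T.Edge j i := by
  obtain ⟨k, hk⟩ := h
  exact ⟨k, by rwa [Finset.insert_comm]⟩

theorem SphereTriangulation.exists_other {i j k : V} (h : {i, j, k} ∈ T.faces) :
    ∃ m, m ≠ k ∧ {i, j, m} ∈ T.faces := by
  obtain ⟨hij, hik, hjk⟩ := T.ne_of_mem_faces h
  have hsub : ({i, j} : Finset V) ⊆ {i, j, k} := fun x hx => by
    simp only [Finset.mem_insert, Finset.mem_singleton] at *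
    tauto
  have hcard := T.card_faces_of_edge {i, j} (Finset.card_pair hij) ⟨_, h, hsub⟩
  obtain ⟨t, ht, hne⟩ := Finset.exists_mem_ne (by rw [hcard]; norm_num) ({i, j, k} : Finset V)
  rw [Finset.mem_filter] at ht
  obtain ⟨m, hm⟩ := T.exists_third ht.1 (ht.2 (by simp)) (ht.2 (by simp)) hij
  refine ⟨m, ?_, by rw [hm]; exact ht.1⟩
  rintro rfl
  exact hne hm.symm

/-- A function on the faces that agrees for neighboring faces is constant. -/
theorem SphereTriangulation.face_induction {p : Finset V → Prop}
    (hp : ∀ i j k m, {i, j, k} ∈ T.faces → {i, j, m} ∈ T.faces → p {i, j, k} → p {i, j, m})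
    {s t : Finset V} (hs : s ∈ T.faces) (ht : t ∈ T.faces) (h : p s) : p t := by
  have hpair : ∀ s ∈ T.faces, ∀ t ∈ T.faces, ∀ i ∈ s, i ∈ t → ∀ j ∈ s, j ∈ t → i ≠ j → p s → p t := by
    intro s hs t ht i his hit j hjs hjt hij h
    obtain ⟨k, rfl⟩ := T.exists_third hs his hjs hij
    obtain ⟨m, rfl⟩ := T.exists_third ht hit hjt hij
    exact hp i j k m hs ht h
  -- The property first spreads around a vertex along its link, where consecutive triangles share an
  -- edge, and afterwards from vertex to vertex by connectedness.
  have hvertex : ∀ i, ∀ s ∈ T.faces, i ∈ s → p s → ∀ t ∈ T.faces, i ∈ t → p t := by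
    intro i s hs his h t ht hit
    have hex : ∀ t ∈ T.faces, i ∈ t → ∃ j ∈ t, j ≠ i := fun t ht _ =>
      Finset.exists_mem_ne (by rw [T.card_of_mem_faces t ht]; norm_num) i
    obtain ⟨j, hjs, hji⟩ := hex s hs his
    obtain ⟨k, hkt, hki⟩ := hex t ht hit
    have hpath := T.link_connected i j k ⟨s, hs, his, hjs⟩ ⟨t, ht, hit, hkt⟩ hji hki
    have hall : ∀ k, Relation.ReflTransGen (fun a b => ({i, a, b} : Finset V) ∈ T.faces) j k →
        k ≠ i ∧ ∀ t ∈ T.faces, i ∈ t → k ∈ t → p t := by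
      intro k hk
      induction hk with
      | refl => exact ⟨hji, fun t ht hit hjt => hpair s hs t ht i his hit j hjs hjt hji.symm h⟩
      | @tail a b _ hab ih =>
        have hbi := (T.ne_of_mem_faces hab).2.1.symm
        refine ⟨hbi, fun t ht hit hbt => ?_⟩
        exact hpair _ hab t ht i (by simp) hit b (by simp) hbt hbi.symm
          (ih.2 _ hab (by simp) (by simp))
    exact (hall k hpath).2 t ht hit hkt
  obtain ⟨i, hi⟩ : s.Nonempty := Finset.card_pos.1 (by rw [T.card_of_mem_faces s hs]; norm_num)
  obtain ⟨j, hj⟩ : t.Nonempty := Finset.card_pos.1 (by rw [T.card_of_mem_faces t ht]; norm_num)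
  have hall : ∀ j, Relation.ReflTransGen (fun a b => ∃ t ∈ T.faces, a ∈ t ∧ b ∈ t) i j →
      ∀ t ∈ T.faces, j ∈ t → p t := by
    intro j hj
    induction hj with
    | refl => exact fun t ht hit => hvertex i s hs hi h t ht hit
    | @tail a b _ hab ih =>
      obtain ⟨t', ht', ha, hb⟩ := hab
      exact fun t ht hbt => hvertex b t' ht' hb (ih t' ht' ha) t ht hbt
  exact hall j (T.connected i j) t ht hj

/-- A function on the vertices that agrees for neighbors different from `l` is constant on the
complement of `l`. -/
theorem SphereTriangulation.eq_of_edge {X : Type*} {l : V} {e : V → X}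
    (he : ∀ i j, T.Edge i j → i ≠ l → j ≠ l → e i = e j) {i j : V} (hi : i ≠ l) (hj : j ≠ l) :
    e i = e j := by
  -- A path through `l` is replaced by a detour along the link of `l`, whose edges avoid `l`.
  have hlink : ∀ a b, T.Edge l a → T.Edge l b → e a = e b := by
    rintro a b ⟨a', ha⟩ ⟨b', hb⟩
    have hpath := T.link_connected l a b ⟨_, ha, by simp, by simp⟩ ⟨_, hb, by simp, by simp⟩
      (T.ne_of_mem_faces ha).1.symm (T.ne_of_mem_faces hb).1.symm
    clear ha hb
    induction hpath with
    | refl => rfl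
    | @tail c d _ hcd ih =>
      obtain ⟨h1, h2, h3⟩ := T.ne_of_mem_faces hcd
      rw [ih]
      refine he c d ⟨l, ?_⟩ h1.symm h2.symm
      rwa [IdealRealization.triple_rotate]
  have hall : ∀ j, Relation.ReflTransGen (fun a b => ∃ t ∈ T.faces, a ∈ t ∧ b ∈ t) i j →
      (j ≠ l → e i = e j) ∧ (j = l → ∀ a, T.Edge l a → e i = e a) := by
    intro j hj
    induction hj with
    | refl => exact ⟨fun _ => rfl, fun h => absurd h hi⟩
    | @tail a b _ hab ih =>
      obtain ⟨t, ht, ha, hb⟩ := hab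
      by_cases hab : a = b
      · subst hab; exact ih
      obtain ⟨c, hc⟩ := T.exists_third ht ha hb hab
      have hE : T.Edge a b := ⟨c, by rw [hc]; exact ht⟩
      constructor
      · intro hbl
        by_cases hal : a = l
        · subst hal
          exact ih.2 rfl b hE
        · rw [ih.1 hal]
          exact he a b hE hal hbl
      · rintro rfl x hx
        rw [ih.1 hab]
        exact hlink a x hE.symm hx
  exact (hall j (T.connected i j)).1 hj

theorem SphereTriangulation.exists_edge (i : V) : ∃ j, T.Edge i j := by
  obtain ⟨t, ht, hi⟩ := T.exists_face i
  obtain ⟨j, hj, hji⟩ := Finset.exists_mem_ne (by rw [T.card_of_mem_faces t ht]; norm_num) i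
  obtain ⟨k, rfl⟩ := T.exists_third ht hi hj hji.symm
  exact ⟨j, k, ht⟩

theorem SphereTriangulation.exists_edge_ne (i l : V) : ∃ j, T.Edge i j ∧ j ≠ l := by
  obtain ⟨j, k, h⟩ := T.exists_edge i
  by_cases hj : j = l
  · refine ⟨k, ⟨j, by rwa [IdealRealization.triple_swap]⟩, ?_⟩
    rintro rfl
    exact (T.ne_of_mem_faces h).2.2 hj
  · exact ⟨j, ⟨k, h⟩, hj⟩

namespace IsOrientation

variable {O O' : V → V → V → Prop}

theorem edge {i j k : V} (hO : IsOrientation T O) (h : O i j k) : T.Edge i j := ⟨k, hO.mem h⟩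

/-- If the given face passes through the edge in the wrong direction, the other face at this edge
passes through it in the right one, by coherence. -/
theorem exists_next (hO : IsOrientation T O) {i j : V} (h : T.Edge i j) : ∃ k, O i j k := by
  obtain ⟨k, hk⟩ := h
  rcases hO.or_swap hk with h1 | h1
  · exact ⟨k, h1⟩
  · obtain ⟨m, hmk, hm⟩ := T.exists_other hk
    have h2 := hO.rotate (hO.rotate h1)
    refine ⟨m, hO.rotate (hO.rotate (hO.coherent h2 ?_ hmk.symm))⟩
    rwa [Finset.insert_comm]

theorem exists_prev (hO : IsOrientation T O) {i j : V} (h : T.Edge i j) : ∃ k, O i k j := by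
  obtain ⟨k, hk⟩ := hO.exists_next h.symm
  exact ⟨k, hO.rotate hk⟩

theorem next_unique (hO : IsOrientation T O) {i j k m : V} (h : O i j k) (h' : O i j m) :
    k = m := by
  by_contra hkm
  exact hO.not_swap h' (hO.coherent h (hO.mem h') hkm)

theorem prev_unique (hO : IsOrientation T O) {i j k m : V} (h : O i k j) (h' : O i m j) :
    k = m :=
  hO.next_unique (hO.rotate (hO.rotate h)) (hO.rotate (hO.rotate h'))

theorem edge_right (hO : IsOrientation T O) {i j k : V} (h : O i j k) : T.Edge i k :=
  (hO.edge (hO.rotate (hO.rotate h))).symm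

/-- Two orientations agree or are opposite. -/
theorem agree_or_opposite (hO : IsOrientation T O) (hO' : IsOrientation T O') :
    (∀ i j k, O i j k ↔ O' i j k) ∨ (∀ i j k, O i j k ↔ O' i k j) := by
  have key : ∀ {O O' : V → V → V → Prop}, IsOrientation T O → IsOrientation T O' →
      ∀ {a b c}, O a b c → O' a b c → ∀ i j k, O i j k → O' i j k := by
    intro O O' hO hO' a b c h h' i j k hijk
    have := T.face_induction (p := fun t => ∀ i j k, {i, j, k} = t → O i j k → O' i j k)
      ?_ (hO.mem h) (hO.mem hijk) ?_
    · exact this i j k rfl hijk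
    · intro i j k m hk hm hp x y z hxyz hOx
      have hm' : ∀ i j k m, {i, j, k} ∈ T.faces → {i, j, m} ∈ T.faces → (O i j k → O' i j k) →
          (O i k j → O' i k j) → O i j m → O' i j m := by
        intro i j k m hk hm h1 h2 h3
        by_cases hkm : k = m
        · subst hkm; exact h1 h3
        · have h4 := h2 (hO.coherent h3 hk (Ne.symm hkm))
          have h5 := hO'.rotate (hO'.rotate h4)
          exact hO'.rotate (hO'.rotate (hO'.coherent h5 (by rwa [Finset.insert_comm]) hkm))
      have hp1 : ∀ i' j', ({i', j', k} : Finset V) = {i, j, k} → O i' j' m → O' i' j' m := by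
        intro i' j' h1 h2
        refine hm' i' j' k m (by rw [h1]; exact hk) (hO.mem h2) (hp i' j' k h1)
          (hp i' k j' (by rw [← h1, IdealRealization.triple_swap])) h2
      obtain ⟨hxy, hxz, hyz⟩ := T.ne_of_mem_faces (hO.mem hOx)
      have hx : x ∈ ({i, j, m} : Finset V) := by rw [← hxyz]; simp
      have hy : y ∈ ({i, j, m} : Finset V) := by rw [← hxyz]; simp
      have hz : z ∈ ({i, j, m} : Finset V) := by rw [← hxyz]; simp
      have hji : ({j, i, k} : Finset V) = {i, j, k} := Finset.insert_comm _ _ _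
      simp only [Finset.mem_insert, Finset.mem_singleton] at hx hy hz
      rcases hx with rfl | rfl | rfl <;> rcases hy with rfl | rfl | rfl <;>
        rcases hz with rfl | rfl | rfl <;> first
        | exact absurd rfl hxy
        | exact absurd rfl hxz
        | exact absurd rfl hyz
        | exact hp1 _ _ rfl hOx
        | exact hp1 _ _ hji hOx
        | exact hO'.rotate (hp1 _ _ rfl (hO.rotate (hO.rotate hOx)))
        | exact hO'.rotate (hp1 _ _ hji (hO.rotate (hO.rotate hOx)))
        | exact hO'.rotate (hO'.rotate (hp1 _ _ rfl (hO.rotate hOx)))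
        | exact hO'.rotate (hO'.rotate (hp1 _ _ hji (hO.rotate hOx)))
    · intro x y z hxyz hOx
      have hx : x ∈ ({a, b, c} : Finset V) := by rw [← hxyz]; simp
      have hy : y ∈ ({a, b, c} : Finset V) := by rw [← hxyz]; simp
      have hz : z ∈ ({a, b, c} : Finset V) := by rw [← hxyz]; simp
      obtain ⟨hxy, hxz, hyz⟩ := T.ne_of_mem_faces (hO.mem hOx)
      simp only [Finset.mem_insert, Finset.mem_singleton] at hx hy hz
      rcases hx with rfl | rfl | rfl <;> rcases hy with rfl | rfl | rfl <;>
        rcases hz with rfl | rfl | rfl <;> first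
        | exact absurd rfl hxy
        | exact absurd rfl hxz
        | exact absurd rfl hyz
        | exact h'
        | exact hO'.rotate h'
        | exact hO'.rotate (hO'.rotate h')
        | exact absurd hOx (hO.not_swap h)
        | exact absurd (hO.rotate hOx) (hO.not_swap h)
        | exact absurd (hO.rotate (hO.rotate hOx)) (hO.not_swap h)
  -- Reversal is again an orientation, so `key` also treats the case of disagreement on one face.
  have hrev : IsOrientation T (fun i j k => O' i k j) :=
    { mem := fun h => by
        have := hO'.mem h
        rwa [IdealRealization.triple_swap] at this
      rotate := fun h => hO'.rotate (hO'.rotate h)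
      or_swap := fun h => (hO'.or_swap h).symm
      not_swap := fun h h' => hO'.not_swap h h'
      coherent := fun {i j k m} h h1 h2 => by
        have h3 := hO'.rotate (hO'.rotate h)
        refine hO'.rotate (hO'.rotate ?_)
        have h4 : O' j i k := hO'.rotate (hO'.rotate h)
        exact hO'.rotate (hO'.rotate (hO'.rotate
          (hO'.coherent h4 (by rwa [Finset.insert_comm]) h2))) }
  by_cases hne : ∃ a b c, O a b c
  · obtain ⟨a, b, c, h⟩ := hne
    rcases hO'.or_swap (hO.mem h) with h' | h'
    · exact Or.inl fun i j k => ⟨key hO hO' h h' i j k, key hO' hO h' h i j k⟩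
    · exact Or.inr fun i j k => ⟨key hO hrev h h' i j k, key hrev hO h' h i j k⟩
  · push Not at hne
    left
    intro i j k
    refine ⟨fun h => absurd h (hne i j k), fun h => ?_⟩
    rcases hO.or_swap (hO'.mem h) with h1 | h1
    · exact h1
    · exact absurd h1 (hne _ _ _)

open Classical in
/-- The next vertex in the link of `i`. -/
def next (O : V → V → V → Prop) (i j : V) : V := if h : ∃ k, O i j k then h.choose else j

theorem next_spec {i j : V} (hO : IsOrientation T O) (h : T.Edge i j) : O i j (next O i j) := by
  have h' := hO.exists_next h
  rw [next, dif_pos h']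
  exact h'.choose_spec

theorem next_eq (hO : IsOrientation T O) {i j k : V} (h : O i j k) : next O i j = k :=
  hO.next_unique (hO.next_spec (hO.edge h)) h

theorem next_of_not_edge (hO : IsOrientation T O) {i j : V} (h : ¬ T.Edge i j) : next O i j = j := by
  rw [next, dif_neg]
  rintro ⟨k, hk⟩
  exact h (hO.edge hk)

/-- The default value `j` of `next` off the link makes it a permutation of all of `V`. Sums around
the link can then be reindexed over `V`. -/
theorem next_injective (hO : IsOrientation T O) (i : V) : Function.Injective (next O i) := by
  intro j k h
  by_cases hj : T.Edge i j <;> by_cases hk : T.Edge i k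
  · have h1 := hO.next_spec hj
    rw [h] at h1
    exact hO.prev_unique h1 (hO.next_spec hk)
  · have h1 := hO.edge_right (hO.next_spec hj)
    rw [h, hO.next_of_not_edge hk] at h1
    exact absurd h1 hk
  · have h1 := hO.edge_right (hO.next_spec hk)
    rw [← h, hO.next_of_not_edge hj] at h1
    exact absurd h1 hj
  · rwa [hO.next_of_not_edge hj, hO.next_of_not_edge hk] at h

/-- The rotation of the link of a vertex. -/
def nextPerm (hO : IsOrientation T O) (i : V) : Equiv.Perm V :=
  Equiv.ofBijective (next O i) (Finite.injective_iff_bijective.1 (hO.next_injective i))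

-- Each neighbor has exactly one successor in the link, so the sum over the triangles at `i` is a
-- sum over the neighbors of `i`.
open Classical in
theorem sum_link (hO : IsOrientation T O) (i : V) (A : V → V → ℝ) :
    ∑ j, ∑ k, (if O i j k then A j k else 0) =
      ∑ j, if T.Edge i j then A j (next O i j) else 0 := by
  refine Finset.sum_congr rfl fun j _ => ?_
  split_ifs with h
  · rw [Finset.sum_eq_single_of_mem (next O i j) (Finset.mem_univ _), if_pos (hO.next_spec h)]
    intro b _ hb
    rw [if_neg]
    intro h'
    exact hb (hO.next_eq h').symm
  · exact Finset.sum_eq_zero fun k _ => if_neg fun h' => h (hO.edge h')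

open Classical in
/-- A sum of differences around a vertex telescopes. -/
theorem sum_link_sub (hO : IsOrientation T O) (i : V) (A : V → ℝ) :
    ∑ j, ∑ k, (if O i j k then A k - A j else 0) = 0 := by
  rw [hO.sum_link i fun j k => A k - A j]
  have h1 : ∀ j, (if T.Edge i j then A (next O i j) - A j else 0) = A (hO.nextPerm i j) - A j := by
    intro j
    split_ifs with h
    · rfl
    · change 0 = A (next O i j) - A j
      rw [hO.next_of_not_edge h, sub_self]
  rw [Finset.sum_congr rfl fun j _ => h1 j, Finset.sum_sub_distrib, Equiv.sum_comp, sub_self]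

/-- A function on the link of `i` that does not change within the triangles that do not contain
`l` is constant on the complement of `l`. -/
theorem eq_of_link (hO : IsOrientation T O) {X : Type*} {i l : V} {d : V → X}
    (hd : ∀ j k, O i j k → j ≠ l → k ≠ l → d j = d k) {j k : V} (hj : T.Edge i j) (hk : T.Edge i k)
    (hjl : j ≠ l) (hkl : k ≠ l) : d j = d k := by
  set σ := hO.nextPerm i
  have hσ : ∀ a, a ≠ l → σ a ≠ l → d a = d (σ a) := by
    intro a ha hσa
    by_cases h : T.Edge i a
    · exact hd a _ (hO.next_spec h) ha hσa
    · change d a = d (next O i a)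
      rw [hO.next_of_not_edge h]
  have hsame : σ.SameCycle j k := by
    obtain ⟨j', hj'⟩ := hj
    obtain ⟨k', hk'⟩ := hk
    have hpath := T.link_connected i j k ⟨_, hj', by simp, by simp⟩ ⟨_, hk', by simp, by simp⟩
      (T.ne_of_mem_faces hj').1.symm (T.ne_of_mem_faces hk').1.symm
    clear hk' hkl
    induction hpath with
    | refl => exact Equiv.Perm.SameCycle.refl _ _
    | @tail a b _ hab ih =>
      refine ih.trans ?_
      rcases hO.or_swap hab with h | h
      · have : σ a = b := hO.next_eq h
        rw [← this]
        exact (Equiv.Perm.sameCycle_apply_right.2 (Equiv.Perm.SameCycle.refl _ _))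
      · have : σ b = a := hO.next_eq h
        rw [← this]
        exact (Equiv.Perm.sameCycle_apply_left.2 (Equiv.Perm.SameCycle.refl _ _))
  -- If `l` belongs to the link, deleting it leaves an arc that starts at `σ l`, and `d` is compared
  -- with its value there. Otherwise the orbit of `j` never meets `l`.
  by_cases hl : σ.SameCycle l j
  · have hall : ∀ k, k ≠ l → σ.SameCycle l k → d (σ l) = d k := by
      intro k hkl hk
      obtain ⟨n, hn⟩ := hk.exists_nat_pow_eq
      classical
      have hex : ∃ n : ℕ, (σ ^ n) l = k := ⟨n, hn⟩
      have hmin := Nat.find_spec hex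
      have hlt : ∀ m < Nat.find hex, (σ ^ m) l ≠ k := fun m hm => Nat.find_min hex hm
      set N := Nat.find hex
      -- Minimality of `N`: a return to `l` after `m` steps would give a shorter way to `k`.
      have hne : ∀ m, 1 ≤ m → m ≤ N → (σ ^ m) l ≠ l := by
        intro m hm hmN h
        refine hlt (N - m) (by omega) ?_
        have : (σ ^ (N - m)) ((σ ^ m) l) = k := by
          rw [← Equiv.Perm.mul_apply, ← pow_add, Nat.sub_add_cancel hmN, hmin]
        rwa [h] at this
      have hind : ∀ m, m + 1 ≤ N → d (σ l) = d ((σ ^ (m + 1)) l) := by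
        intro m
        induction m with
        | zero => intro _; simp
        | succ m ih =>
          intro hm
          rw [ih (by omega), pow_succ' σ (m + 1), Equiv.Perm.mul_apply]
          refine hσ _ (hne _ (by omega) (by omega)) ?_
          have := hne (m + 1 + 1) (by omega) hm
          rwa [pow_succ' σ (m + 1), Equiv.Perm.mul_apply] at this
      have hN : N ≠ 0 := by
        intro h
        rw [h] at hmin
        exact hkl (by simpa using hmin.symm)
      obtain ⟨m, hm⟩ := Nat.exists_eq_succ_of_ne_zero hN
      rw [hind m (by omega), ← hmin, hm]
    rw [← hall j hjl hl, ← hall k hkl (hl.trans hsame)]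
  · obtain ⟨n, hn⟩ := hsame.exists_nat_pow_eq
    have hne : ∀ m : ℕ, (σ ^ m) j ≠ l := by
      intro m h
      exact hl (Equiv.Perm.SameCycle.symm ⟨m, by simpa using h⟩)
    have hind : ∀ m : ℕ, d j = d ((σ ^ m) j) := by
      intro m
      induction m with
      | zero => simp
      | succ m ih =>
        rw [ih, pow_succ', Equiv.Perm.mul_apply]
        refine hσ _ (hne m) ?_
        have := hne (m + 1)
        rwa [pow_succ', Equiv.Perm.mul_apply] at this
    rw [← hn]
    exact hind n

/-- A function on the edges that is constant on every triangle that does not contain `l` is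
constant on the edges that do not contain `l`. -/
theorem eq_of_triangle (hO : IsOrientation T O) {X : Type*} {l : V} {c : V → V → X}
    (hsymm : ∀ i j, c i j = c j i)
    (hc : ∀ i j k, O i j k → i ≠ l → j ≠ l → k ≠ l → c i j = c i k) {i j i' j' : V}
    (h : T.Edge i j) (h' : T.Edge i' j') (hi : i ≠ l) (hj : j ≠ l) (hi' : i' ≠ l) (hj' : j' ≠ l) :
    c i j = c i' j' := by
  choose f hf hfl using fun i => T.exists_edge_ne i l
  have h1 : ∀ i j, T.Edge i j → i ≠ l → j ≠ l → c i j = c i (f i) := fun i j hE hi hj =>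
    hO.eq_of_link (fun j k h hj hk => hc i j k h hi hj hk) hE (hf i) hj (hfl i)
  -- Around each vertex `c` has one value, so it reduces to a function of the vertex. Symmetry of
  -- `c` equates the values at the two ends of an edge.
  have h2 : c i (f i) = c i' (f i') := T.eq_of_edge (e := fun i => c i (f i))
    (fun i j hE hi hj => by
      rw [← h1 i j hE hi hj, ← h1 j i hE.symm hj hi, hsymm]) hi hi'
  rw [h1 i j h hi hj, h1 i' j' h' hi' hj', h2]

end IsOrientation

end Combinatorics

end

noncomputable section

/-! ### Monotonicity of the angles of a triangle -/

section Triangle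

open Real

/-- This form is the derivative of the pairing in `log_sin_mono` along a segment of angles. With
cotangents `p, q, r`, the identity `pq + pr + qr = 1` completes the square: `p + r` times the form
is `((p + r) a + r b)² + b²`, and `p + r` is positive. -/
theorem cot_form_pos {x y z : ℝ} (hx : 0 < x) (hy : 0 < y) (hz : 0 < z) (h : x + y + z = π)
    {a b c : ℝ} (habc : a + b + c = 0) (hne : ¬ (a = 0 ∧ b = 0 ∧ c = 0)) :
    0 < a * (a * (cos x / sin x)) + b * (b * (cos y / sin y)) + c * (c * (cos z / sin z)) := by
  have sx : 0 < sin x := sin_pos_of_pos_of_lt_pi hx (by linarith)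
  have sy : 0 < sin y := sin_pos_of_pos_of_lt_pi hy (by linarith)
  have sz : 0 < sin z := sin_pos_of_pos_of_lt_pi hz (by linarith)
  have hsy : sin y = sin x * cos z + cos x * sin z := by
    rw [← sin_add, ← sin_pi_sub]; congr 1; linarith
  have hcy : cos y = sin x * sin z - cos x * cos z := by
    have : cos y = -cos (x + z) := by rw [← cos_pi_sub]; congr 1; linarith
    rw [this, cos_add]; ring
  set p := cos x / sin x with hp
  set q := cos y / sin y with hq
  set r := cos z / sin z with hr
  have h1 : p * sin x = cos x := div_mul_cancel₀ _ sx.ne'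
  have h2 : q * sin y = cos y := div_mul_cancel₀ _ sy.ne'
  have h3 : r * sin z = cos z := div_mul_cancel₀ _ sz.ne'
  have h13 : 0 < p + r := by
    have : p + r = sin y / (sin x * sin z) := by
      rw [hsy, hp, hr]; field_simp; ring
    rw [this]
    positivity
  have hsum : p * q + p * r + q * r = 1 := by
    have e : sin y * (p * q + p * r + q * r - 1) = 0 := by
      have e1 : q * sin y * (p + r) + sin y * (p * r - 1) = 0 := by
        rw [h2, hcy, hsy, ← h1, ← h3]; ring
      linear_combination e1
    rcases mul_eq_zero.1 e with h | h
    · exact absurd h sy.ne'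
    · linarith
  have hc : c = -(a + b) := by linarith
  subst hc
  have key : (p + r) * (a * (a * p) + b * (b * q) + -(a + b) * (-(a + b) * r)) =
      ((p + r) * a + r * b) ^ 2 + b ^ 2 := by linear_combination b ^ 2 * hsum
  by_contra! hn
  have h4 : ((p + r) * a + r * b) ^ 2 + b ^ 2 ≤ 0 := by
    rw [← key]
    exact mul_nonpos_of_nonneg_of_nonpos h13.le hn
  have hb : b = 0 := by
    have : b ^ 2 ≤ 0 := by nlinarith [sq_nonneg ((p + r) * a + r * b)]
    exact pow_eq_zero_iff two_ne_zero |>.1 (le_antisymm this (sq_nonneg b))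
  subst hb
  have ha : a = 0 := by
    have : ((p + r) * a) ^ 2 ≤ 0 := by simpa using h4
    have := pow_eq_zero_iff two_ne_zero |>.1 (le_antisymm this (sq_nonneg _))
    exact (mul_eq_zero.1 this).resolve_left h13.ne'
  subst ha
  exact hne ⟨rfl, rfl, by simp⟩

/-- The logarithms of the sines of the angles of a triangle are a monotone function of the angles. -/
theorem log_sin_mono {x y z x' y' z' : ℝ} (hx : 0 < x) (hy : 0 < y) (hz : 0 < z)
    (h : x + y + z = π) (hx' : 0 < x') (hy' : 0 < y') (hz' : 0 < z') (h' : x' + y' + z' = π)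
    (hne : ¬ (x' = x ∧ y' = y ∧ z' = z)) :
    0 < (x' - x) * (log (sin x') - log (sin x)) + (y' - y) * (log (sin y') - log (sin y)) +
      (z' - z) * (log (sin z') - log (sin z)) := by
  -- Along the segment joining the angle triples, the derivative of `g` is the cotangent form
  -- evaluated at the angle change. Comparing `g 1` with `g 0` gives the claim.
  set g : ℝ → ℝ := fun t => (x' - x) * log (sin (x + t * (x' - x))) +
    (y' - y) * log (sin (y + t * (y' - y))) + (z' - z) * log (sin (z + t * (z' - z))) with hg
  have hpos : ∀ {u u' : ℝ}, 0 < u → 0 < u' → ∀ t ∈ Set.Icc (0 : ℝ) 1, 0 < u + t * (u' - u) := by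
    intro u u' hu hu' t ht
    rcases ht.1.eq_or_lt with h0 | h0
    · rw [← h0]; simpa using hu
    · nlinarith [ht.2, mul_pos h0 hu', mul_nonneg (sub_nonneg.2 ht.2) hu.le]
  have hderiv : ∀ t ∈ Set.Icc (0 : ℝ) 1, HasDerivAt g
      ((x' - x) * ((x' - x) * (cos (x + t * (x' - x)) / sin (x + t * (x' - x)))) +
       (y' - y) * ((y' - y) * (cos (y + t * (y' - y)) / sin (y + t * (y' - y)))) +
       (z' - z) * ((z' - z) * (cos (z + t * (z' - z)) / sin (z + t * (z' - z))))) t := by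
    intro t ht
    have hterm : ∀ {u u' : ℝ}, 0 < u + t * (u' - u) → u + t * (u' - u) < π →
        HasDerivAt (fun t => (u' - u) * log (sin (u + t * (u' - u))))
          ((u' - u) * ((u' - u) * (cos (u + t * (u' - u)) / sin (u + t * (u' - u))))) t := by
      intro u u' h0 h1
      have e1 : HasDerivAt (fun t => u + t * (u' - u)) (u' - u) t := by
        simpa using ((hasDerivAt_id t).mul_const (u' - u)).const_add u
      have e2 := (e1.sin.log (sin_pos_of_pos_of_lt_pi h0 h1).ne').const_mul (u' - u)
      exact e2.congr_deriv (by ring)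
    have px := hpos hx hx' t ht
    have py := hpos hy hy' t ht
    have pz := hpos hz hz' t ht
    have hs : (x + t * (x' - x)) + (y + t * (y' - y)) + (z + t * (z' - z)) = π := by
      linear_combination (1 - t) * h + t * h'
    exact ((hterm px (by linarith)).add (hterm py (by linarith))).add (hterm pz (by linarith))
  have hmono : StrictMonoOn g (Set.Icc 0 1) := by
    refine strictMonoOn_of_deriv_pos (convex_Icc 0 1)
      (fun t ht => (hderiv t ht).continuousAt.continuousWithinAt) fun t ht => ?_
    have ht' := interior_subset ht
    rw [(hderiv t ht').deriv]
    refine cot_form_pos (hpos hx hx' t ht') (hpos hy hy' t ht') (hpos hz hz' t ht')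
      (by linear_combination (1 - t) * h + t * h') (by linarith) ?_
    rintro ⟨h1, h2, h3⟩
    exact hne ⟨by linarith, by linarith, by linarith⟩
  have := hmono (Set.left_mem_Icc.2 zero_le_one) (Set.right_mem_Icc.2 zero_le_one) zero_lt_one
  simp only [hg, zero_mul, add_zero, one_mul, add_sub_cancel] at this
  linarith

/-- The comparison of a proper triangle with a degenerate one. -/
theorem degenerate_mono {A B C a b c : ℝ} (hA : 0 < A) (hB : 0 < B) (hC : 0 < C)
    (h : A + B + C = π) (habc : exp a = exp b + exp c) :
    0 < (A - π) * (log (sin A) - a) + B * (log (sin B) - b) + C * (log (sin C) - c) := by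
  set S := B + C with hS
  have hS0 : 0 < S := by positivity
  have hSpi : S < π := by linarith
  have hsA : sin A = sin S := by rw [← sin_pi_sub]; congr 1; linarith
  have sS : 0 < sin S := sin_pos_of_pos_of_lt_pi hS0 hSpi
  -- Strict concavity of the sine on `[0, S]`, where the sine vanishes at `0`.
  have hsin : ∀ {u v : ℝ}, 0 < u → 0 < v → u + v = S → u / S * sin S < sin u := by
    intro u v hu hv huv
    have h1 := strictConcaveOn_sin_Icc.2 (show S ∈ Set.Icc 0 π from ⟨hS0.le, hSpi.le⟩)
      (show (0 : ℝ) ∈ Set.Icc 0 π from ⟨le_rfl, pi_pos.le⟩) hS0.ne'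
      (show 0 < u / S by positivity) (show 0 < v / S by positivity)
      (by rw [← add_div, huv, div_self hS0.ne'])
    simp only [smul_eq_mul, sin_zero, mul_zero, add_zero, div_mul_cancel₀ _ hS0.ne'] at h1
    exact h1
  have hlog : ∀ {u v : ℝ}, 0 < u → 0 < v → u + v = S →
      log (u / S) + log (sin S) < log (sin u) := by
    intro u v hu hv huv
    rw [← log_mul (by positivity) sS.ne']
    exact log_lt_log (by positivity) (hsin hu hv huv)
  have l1 := hlog hB hC rfl
  have l2 := hlog hC hB (by rw [hS]; ring)
  -- The rest is Gibbs' inequality: `(B / S, C / S)` and `(exp (b - a), exp (c - a))` are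
  -- probability vectors, the second one by the degeneracy `habc`, and relative entropy is
  -- nonnegative.
  have hgibbs : ∀ {u w : ℝ}, 0 < u → w - a - log (u / S) ≤ exp (w - a) / (u / S) - 1 := by
    intro u w hu
    have h1 := log_le_sub_one_of_pos (x := exp (w - a) / (u / S)) (by positivity)
    rwa [log_div (exp_pos _).ne' (by positivity), log_exp] at h1
  have g1 := mul_le_mul_of_nonneg_left (hgibbs (w := b) hB) hB.le
  have g2 := mul_le_mul_of_nonneg_left (hgibbs (w := c) hC) hC.le
  have hsum : exp (b - a) + exp (c - a) = 1 := by
    rw [exp_sub, exp_sub, ← add_div, ← habc, div_self (exp_pos a).ne']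
  have e1 : B * (exp (b - a) / (B / S) - 1) + C * (exp (c - a) / (C / S) - 1) = 0 := by
    have : B * (exp (b - a) / (B / S) - 1) + C * (exp (c - a) / (C / S) - 1) =
        S * (exp (b - a) + exp (c - a)) - (B + C) := by field_simp; ring
    rw [this, hsum, hS]
    ring
  rw [hsA]
  have m1 := mul_lt_mul_of_pos_left l1 hB
  have m2 := mul_lt_mul_of_pos_left l2 hC
  have hAS : A - π = -S := by linarith
  rw [hAS, hS]
  nlinarith

/-- `x, y, z` are the logarithms of the side lengths of a proper triangle with opposite angles
`α, β, γ`. -/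
def IsProper (x y z α β γ : ℝ) : Prop :=
  0 < α ∧ 0 < β ∧ 0 < γ ∧ α + β + γ = π ∧
    ∃ c, x = log (sin α) + c ∧ y = log (sin β) + c ∧ z = log (sin γ) + c

/-- The same for a degenerate triangle whose longest side is the first one. -/
def IsFlat (x y z α β γ : ℝ) : Prop :=
  α = π ∧ β = 0 ∧ γ = 0 ∧ exp x = exp y + exp z

/-- The same for a possibly degenerate triangle. -/
def IsTriangle (x y z α β γ : ℝ) : Prop :=
  IsProper x y z α β γ ∨ IsFlat x y z α β γ ∨ IsFlat y z x β γ α ∨ IsFlat z x y γ α β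

theorem IsProper.rotate {x y z α β γ : ℝ} (h : IsProper x y z α β γ) : IsProper y z x β γ α := by
  obtain ⟨h1, h2, h3, h4, c, h5, h6, h7⟩ := h
  exact ⟨h2, h3, h1, by linarith, c, h6, h7, h5⟩

theorem IsFlat.lt {x y z α β γ : ℝ} (h : IsFlat x y z α β γ) : y < x ∧ z < x := by
  have := h.2.2.2
  constructor <;> rw [← exp_lt_exp] <;> linarith [exp_pos y, exp_pos z]

/-- The additive constant of the proper triangle drops out because both angle triples have sum `π`;
what remains is `degenerate_mono`. -/
theorem IsFlat.proper_mono {x y z α β γ x' y' z' α' β' γ' : ℝ} (h : IsFlat x y z α β γ)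
    (h' : IsProper x' y' z' α' β' γ') :
    0 < (α' - α) * (x' - x) + (β' - β) * (y' - y) + (γ' - γ) * (z' - z) := by
  obtain ⟨rfl, rfl, rfl, h1⟩ := h
  obtain ⟨hA, hB, hC, hs, c, rfl, rfl, rfl⟩ := h'
  have := degenerate_mono hA hB hC hs h1
  have e : (α' - π) * c + β' * c + γ' * c = 0 := by linear_combination c * hs
  nlinarith

/-- Only two angles change, one by `-π` and one by `π`. In each triangle the side opposite to the
angle `π` is strictly the longest. -/
theorem IsFlat.flat_mono {x y z α β γ x' y' z' α' β' γ' : ℝ} (h : IsFlat x y z α β γ)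
    (h' : IsFlat y' z' x' β' γ' α') :
    0 < (α' - α) * (x' - x) + (β' - β) * (y' - y) + (γ' - γ) * (z' - z) := by
  have h1 := h.lt
  have h2 := h'.lt
  obtain ⟨rfl, rfl, rfl, -⟩ := h
  obtain ⟨rfl, rfl, rfl, -⟩ := h'
  nlinarith [pi_pos]

/-- The angles of a triangle are a monotone function of the logarithms of the side lengths. -/
theorem IsTriangle.mono {x y z α β γ x' y' z' α' β' γ' : ℝ} (h : IsTriangle x y z α β γ)
    (h' : IsTriangle x' y' z' α' β' γ') :
    0 < (α' - α) * (x' - x) + (β' - β) * (y' - y) + (γ' - γ) * (z' - z) ∨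
    ((α' - α) * (x' - x) + (β' - β) * (y' - y) + (γ' - γ) * (z' - z) = 0 ∧
      ((x' - x = y' - y ∧ y' - y = z' - z) ∨
      (IsFlat x y z α β γ ∧ IsFlat x' y' z' α' β' γ') ∨
      (IsFlat y z x β γ α ∧ IsFlat y' z' x' β' γ' α') ∨
      (IsFlat z x y γ α β ∧ IsFlat z' x' y' γ' α' β'))) := by
  -- The pairing vanishes only for proper triangles with equal angles, which are similar, and for
  -- flat triangles with the same longest side.
  rcases h with h | h | h | h <;> rcases h' with h' | h' | h' | h'
  · obtain ⟨hA, hB, hC, hs, c, rfl, rfl, rfl⟩ := h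
    obtain ⟨hA', hB', hC', hs', c', rfl, rfl, rfl⟩ := h'
    by_cases hne : α' = α ∧ β' = β ∧ γ' = γ
    · obtain ⟨rfl, rfl, rfl⟩ := hne
      right
      exact ⟨by ring, Or.inl ⟨by ring, by ring⟩⟩
    · left
      have := log_sin_mono hA hB hC hs hA' hB' hC' hs' hne
      have e : (α' - α) * (c' - c) + (β' - β) * (c' - c) + (γ' - γ) * (c' - c) = 0 := by
        linear_combination (c' - c) * (hs' - hs)
      nlinarith
  · left; have := h'.proper_mono h; linarith
  · left; have := h'.proper_mono h.rotate; linarith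
  · left; have := h'.proper_mono h.rotate.rotate; linarith
  · left; exact h.proper_mono h'
  · right
    have h1 := h; have h1' := h'
    obtain ⟨rfl, rfl, rfl, -⟩ := h
    obtain ⟨rfl, rfl, rfl, -⟩ := h'
    exact ⟨by ring, Or.inr (Or.inl ⟨h1, h1'⟩)⟩
  · left; exact h.flat_mono h'
  · left; have := h'.flat_mono h; linarith
  · left; have := h.proper_mono h'.rotate; linarith
  · left; have := h'.flat_mono h; linarith
  · right
    have h1 := h; have h1' := h'
    obtain ⟨rfl, rfl, rfl, -⟩ := h
    obtain ⟨rfl, rfl, rfl, -⟩ := h'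
    exact ⟨by ring, Or.inr (Or.inr (Or.inl ⟨h1, h1'⟩))⟩
  · left; have := h.flat_mono h'; linarith
  · left; have := h.proper_mono h'.rotate.rotate; linarith
  · left; have := h.flat_mono h'; linarith
  · left; have := h'.flat_mono h; linarith
  · right
    have h1 := h; have h1' := h'
    obtain ⟨rfl, rfl, rfl, -⟩ := h
    obtain ⟨rfl, rfl, rfl, -⟩ := h'
    exact ⟨by ring, Or.inr (Or.inr (Or.inr ⟨h1, h1'⟩))⟩

open EuclideanGeometry

theorem isFlat_of_sbtw {a b c : ℂ} (h : Sbtw ℝ b a c) :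
    IsFlat (log (dist b c)) (log (dist c a)) (log (dist a b)) (∠ b a c) (∠ c b a) (∠ a c b) := by
  refine ⟨h.angle₁₂₃_eq_pi, h.angle₃₁₂_eq_zero, h.angle₂₃₁_eq_zero, ?_⟩
  rw [exp_log (dist_pos.2 h.left_ne_right), exp_log (dist_pos.2 h.ne_right.symm),
    exp_log (dist_pos.2 h.ne_left), dist_comm c a, dist_comm a b, ← h.wbtw.dist_add_dist]
  ring

theorem isTriangle_of_ne {a b c : ℂ} (hab : a ≠ b) (hac : a ≠ c) (hbc : b ≠ c) :
    IsTriangle (log (dist b c)) (log (dist c a)) (log (dist a b))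
      (∠ b a c) (∠ c b a) (∠ a c b) := by
  by_cases hcol : Collinear ℝ {a, b, c}
  · right
    rcases hcol.wbtw_or_wbtw_or_wbtw with h | h | h
    · exact Or.inr (Or.inl (isFlat_of_sbtw (Sbtw.symm ⟨h, hab.symm, hbc⟩)))
    · exact Or.inr (Or.inr (isFlat_of_sbtw (Sbtw.symm ⟨h, hbc.symm, hac.symm⟩)))
    · exact Or.inl (isFlat_of_sbtw (Sbtw.symm ⟨h, hac, hab⟩))
  · left
    have h1 : ¬ Collinear ℝ {b, a, c} := by rwa [Set.insert_comm]
    have h2 : ¬ Collinear ℝ {c, b, a} := by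
      convert hcol using 2
      ext; simp only [Set.mem_insert_iff, Set.mem_singleton_iff]; tauto
    have h3 : ¬ Collinear ℝ {a, c, b} := by
      convert hcol using 2
      ext; simp only [Set.mem_insert_iff, Set.mem_singleton_iff]; tauto
    have p1 := angle_pos_of_not_collinear h1
    have p2 := angle_pos_of_not_collinear h2
    have p3 := angle_pos_of_not_collinear h3
    have hs : ∠ b a c + ∠ c b a + ∠ a c b = π := by
      have := angle_add_angle_add_angle_eq_pi c hab.symm
      rw [angle_comm a c b, angle_comm b a c, angle_comm c b a]
      rw [angle_comm] at this
      linarith [angle_comm b c a, angle_comm a b c]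
    -- By the law of sines, the common constant is the logarithm of the diameter of the
    -- circumcircle.
    refine ⟨p1, p2, p3, hs, log (dist b c / sin (∠ b a c)), ?_, ?_, ?_⟩
    all_goals
      have s1 := sin_pos_of_pos_of_lt_pi p1 (by linarith)
      have s2 := sin_pos_of_pos_of_lt_pi p2 (by linarith)
      have s3 := sin_pos_of_pos_of_lt_pi p3 (by linarith)
      have d1 := dist_pos.2 hbc
      rw [← log_mul (by positivity) (by positivity)]
      congr 1
      rw [mul_div_assoc', eq_div_iff (by positivity)]
    · ring
    · have := law_sin b a c
      rw [dist_comm c a, mul_comm, this, dist_comm c b]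
    · have := law_sin c a b
      rw [mul_comm, angle_comm b a c, this, angle_comm, mul_comm]

end Triangle

end

noncomputable section

/-! ### The angle sum at an interior vertex -/

open Real

/-- Arguments add modulo `2π`. Since the sum lies in `(-π, 2π]`, the only possible correction is one
subtraction of `2π`. -/
theorem arg_mul_of_nonneg {u v : ℂ} (hu : u ≠ 0) (hv : v ≠ 0) (h0 : 0 ≤ v.arg) :
    (u * v).arg = u.arg + v.arg - if π < u.arg + v.arg then 2 * π else 0 := by
  have h1 := Complex.arg_mul_coe_angle hu hv
  rw [← Angle.coe_add, Angle.angle_eq_iff_two_pi_dvd_sub] at h1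
  obtain ⟨n, hn⟩ := h1
  have a1 := Complex.neg_pi_lt_arg u
  have a2 := Complex.arg_le_pi u
  have b2 := Complex.arg_le_pi v
  have c1 := Complex.neg_pi_lt_arg (u * v)
  have c2 := Complex.arg_le_pi (u * v)
  have hpi := pi_pos
  split_ifs with h
  · have hn1 : n = -1 := by
      have h2 : (n : ℝ) < 0 := by nlinarith
      have h3 : (-2 : ℝ) < n := by nlinarith
      have h2' : n < 0 := by exact_mod_cast h2
      have h3' : -2 < n := by exact_mod_cast h3
      omega
    subst hn1
    push_cast at hn
    linarith
  · have hn1 : n = 0 := by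
      have h2 : (n : ℝ) < 1 := by nlinarith
      have h3 : (-1 : ℝ) < n := by nlinarith
      have h2' : n < 1 := by exact_mod_cast h2
      have h3' : -1 < n := by exact_mod_cast h3
      omega
    subst hn1
    simp only [Int.cast_zero, mul_zero] at hn
    linarith

/-- The positive real axis is crossed when turning from `p` counterclockwise to `p * v` by less than
`π`. The coefficients come from Cramer's rule. -/
theorem exists_pos_combination {p v : ℂ} (hp : p.im < 0) (hpv : 0 < (p * v).im) (hv : 0 < v.im) :
    ∃ a b : ℝ, 0 < a ∧ 0 < b ∧ (1 : ℂ) = a * p + b * (p * v) := by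
  have hΔ : p.re * (p * v).im - (p * v).re * p.im = Complex.normSq p * v.im := by
    simp only [Complex.mul_im, Complex.mul_re, Complex.normSq_apply]; ring
  have hpos : 0 < Complex.normSq p * v.im := by
    refine mul_pos (Complex.normSq_pos.2 ?_) hv
    rintro rfl
    simp at hp
  refine ⟨(p * v).im / (Complex.normSq p * v.im), -p.im / (Complex.normSq p * v.im),
    div_pos hpv hpos, div_pos (by linarith) hpos, ?_⟩
  apply Complex.ext
  · simp only [Complex.add_re, Complex.re_ofReal_mul, Complex.one_re]
    rw [div_mul_eq_mul_div, div_mul_eq_mul_div, ← add_div, eq_div_iff hpos.ne', ← hΔ]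
    ring
  · simp only [Complex.add_im, Complex.im_ofReal_mul, Complex.one_im]
    rw [div_mul_eq_mul_div, div_mul_eq_mul_div, ← add_div, eq_div_iff hpos.ne']
    ring

section Planar

variable {V : Type*} [Fintype V] [DecidableEq V] {T : SphereTriangulation V}

/-- A planar drawing of the triangles that do not contain `l`, without overlaps, but possibly with
degenerate triangles. -/
structure IsDrawing (O : V → V → V → Prop) (l : V) (z : V → ℂ) : Prop where
  inj : ∀ {i j}, i ≠ l → j ≠ l → z i = z j → i = j
  im_nonneg : ∀ {i j k}, O i j k → i ≠ l → j ≠ l → k ≠ l → 0 ≤ ((z k - z i) / (z j - z i)).im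
  disjoint : ∀ {i j k j' k'}, O i j k → O i j' k' → i ≠ l → j ≠ l → k ≠ l → j' ≠ l → k' ≠ l →
    0 < ((z k - z i) / (z j - z i)).im → 0 < ((z k' - z i) / (z j' - z i)).im →
    ∀ a b a' b' : ℝ, 0 < a → 0 < b → 0 < a' → 0 < b' →
      a * (z j - z i) + b * (z k - z i) = a' * (z j' - z i) + b' * (z k' - z i) → j = j'
  pi_unique : ∀ {i j k j' k'}, O i j k → O i j' k' → i ≠ l → j ≠ l → k ≠ l → j' ≠ l → k' ≠ l →
    ((z k - z i) / (z j - z i)).arg = π → ((z k' - z i) / (z j' - z i)).arg = π → j = j'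
  no_crossing : ∀ {i j k m}, O i j k → O i m j → i ≠ l → j ≠ l → k ≠ l → m ≠ l → ∀ r s : ℝ,
    0 < r → r < 1 → 0 < s → s < 1 → z k - z i = r * (z j - z i) → z m - z i ≠ s * (z j - z i)

variable {O : V → V → V → Prop} {l : V} {z : V → ℂ}

theorem IsDrawing.sub_ne_zero (hz : IsDrawing O l z) {i j : V} (hi : i ≠ l) (hj : j ≠ l)
    (h : i ≠ j) : z j - z i ≠ 0 :=
  _root_.sub_ne_zero.2 fun h' => h (hz.inj hj hi h').symm

theorem IsOrientation.ne (hO : IsOrientation T O) {i j k : V} (h : O i j k) :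
    i ≠ j ∧ i ≠ k ∧ j ≠ k := T.ne_of_mem_faces (hO.mem h)

/-- A direction that avoids finitely many given directions. -/
theorem exists_generic (w : V → ℂ) (j₀ : V) (h0 : w j₀ ≠ 0) : ∃ x : ℂ, x ≠ 0 ∧
    (-w j₀ / x).arg < 0 ∧ ∀ j, w j ≠ 0 → (-w j / x).arg ≠ π := by
  -- The direction is `-w j₀` rotated by `φ`. Avoiding finitely many `φ` keeps it off every ray
  -- through a `w j`, and `φ > 0` makes the argument at `j₀` equal to `-φ`.
  obtain ⟨φ, hφ, hφ'⟩ : ∃ φ ∈ Set.Ioo (0 : ℝ) π, φ ∉ Set.range fun j => (-w j / w j₀).arg :=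
    ((Set.Ioo_infinite pi_pos).sdiff (Set.finite_range _)).nonempty
  have hx : -w j₀ * Complex.exp (φ * Complex.I) ≠ 0 :=
    mul_ne_zero (neg_ne_zero.2 h0) (Complex.exp_ne_zero _)
  refine ⟨-w j₀ * Complex.exp (φ * Complex.I), hx, ?_, fun j hj h => hφ' ⟨j, ?_⟩⟩
  · rw [← div_div, div_self (neg_ne_zero.2 h0), one_div, ← Complex.exp_neg, ← neg_mul,
      ← Complex.ofReal_neg, Complex.arg_exp_mul_I]
    rw [(toIocMod_eq_self _).2 ⟨by linarith [hφ.2], by linarith [hφ.1, pi_pos]⟩]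
    linarith [hφ.1]
  · rw [Complex.arg_eq_pi_iff] at h
    set y := -w j / (-w j₀ * Complex.exp (φ * Complex.I)) with hy
    have h1 : -w j / w j₀ = ((-y.re : ℝ) : ℂ) * Complex.exp (φ * Complex.I) := by
      have h2 : ((-y.re : ℝ) : ℂ) = -y := by
        apply Complex.ext <;> simp [h.2]
      rw [h2, hy]
      have := Complex.exp_ne_zero (φ * Complex.I)
      field_simp
    change (-w j / w j₀).arg = φ
    rw [h1, Complex.arg_real_mul _ (by linarith [h.1]), Complex.arg_exp_mul_I,
      (toIocMod_eq_self _).2 ⟨by linarith [hφ.1, pi_pos], by linarith [hφ.2]⟩]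

-- Relative to a direction `x`, the arguments of the neighbors telescope around the link, so the
-- angle sum is `2π` times the number of triangles swept across `x`. Disjointness allows at most one
-- for a generic `x`. There is at least one, because the angles are nonnegative and not all zero.
open Classical in
theorem IsDrawing.angle_sum (hO : IsOrientation T O) (hz : IsDrawing O l z) {i : V} (hi : i ≠ l)
    (hil : ¬ T.Edge i l) :
    ∑ j, ∑ k, (if O i j k then ((z k - z i) / (z j - z i)).arg else 0) = 2 * π := by
  set w : V → ℂ := fun j => z j - z i with hw
  have hl : ∀ {j}, T.Edge i j → j ≠ l := by rintro j h rfl; exact hil h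
  have hw0 : ∀ {j}, T.Edge i j → w j ≠ 0 := fun h => hz.sub_ne_zero hi (hl h) h.ne
  have hE : ∀ {j k}, O i j k → T.Edge i j ∧ T.Edge i k := fun h => ⟨hO.edge h, hO.edge_right h⟩
  have him : ∀ {j k}, O i j k → 0 ≤ (w k / w j).im := fun h =>
    hz.im_nonneg h hi (hl (hE h).1) (hl (hE h).2)
  have harg : ∀ {j k}, O i j k → 0 ≤ (w k / w j).arg := fun h => Complex.arg_nonneg_iff.2 (him h)
  -- the angle sum counts the triangles that contain a given direction
  have hcount : ∀ x : ℂ, x ≠ 0 →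
      ∑ j, ∑ k, (if O i j k then (w k / w j).arg else 0) =
      ∑ j, if T.Edge i j then (if π < (-w j / x).arg + (w (IsOrientation.next O i j) / w j).arg then 2 * π else 0)
        else 0 := by
    intro x hx
    have h1 := hO.sum_link_sub i fun j => (-w j / x).arg
    rw [← hO.sum_link i fun j k => if π < (-w j / x).arg + (w k / w j).arg then 2 * π else 0]
    refine sub_eq_zero.1 (Eq.trans ?_ h1)
    rw [← Finset.sum_sub_distrib]
    refine Finset.sum_congr rfl fun j _ => ?_
    rw [← Finset.sum_sub_distrib]
    refine Finset.sum_congr rfl fun k _ => ?_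
    by_cases h : O i j k
    · rw [if_pos h, if_pos h, if_pos h]
      have h2 := arg_mul_of_nonneg (u := -w j / x) (v := w k / w j)
        (div_ne_zero (neg_ne_zero.2 (hw0 (hE h).1)) hx)
        (div_ne_zero (hw0 (hE h).2) (hw0 (hE h).1)) (harg h)
      have h3 : -w j / x * (w k / w j) = -w k / x := by
        have := hw0 (hE h).1
        field_simp
      rw [h3] at h2
      linarith
    · simp [h]
  -- not all angles vanish
  have hpos : ∃ j k, O i j k ∧ (w k / w j).arg ≠ 0 := by
    by_contra! hall
    obtain ⟨j₁, hj₁⟩ := T.exists_edge i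
    -- If all angles were zero, every link neighbor of the farthest vertex `j` would lie strictly
    -- between `i` and `j`. `no_crossing` forbids this for its successor and predecessor together.
    obtain ⟨j, hj, hmax⟩ := Finset.exists_max_image (Finset.univ.filter fun j => T.Edge i j)
      (fun j => ‖w j‖) ⟨j₁, by simpa using hj₁⟩
    simp only [Finset.mem_filter, Finset.mem_univ, true_and] at hj hmax
    have hreal : ∀ {a b}, O i a b → ∃ r : ℝ, 0 < r ∧ w b = r * w a := by
      intro a b h
      have h1 := Complex.arg_eq_zero_iff.1 (hall a b h)
      have h2 : w b / w a = ((w b / w a).re : ℝ) := by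
        apply Complex.ext <;> simp [h1.2]
      have h3 : w b / w a ≠ 0 := div_ne_zero (hw0 (hE h).2) (hw0 (hE h).1)
      refine ⟨(w b / w a).re, lt_of_le_of_ne h1.1 fun h4 => h3 ?_, ?_⟩
      · rw [h2, ← h4]; rfl
      · rw [← h2, div_mul_cancel₀ _ (hw0 (hE h).1)]
    have hlt : ∀ b, T.Edge i b → b ≠ j → ∀ r : ℝ, 0 < r → w b = r * w j → r < 1 := by
      intro b hb hbj r hr h
      refine lt_of_le_of_ne ?_ ?_
      · have h1 := hmax b hb
        rw [h, norm_mul, Complex.norm_of_nonneg hr.le] at h1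
        have h2 : 0 < ‖w j‖ := norm_pos_iff.2 (hw0 hj)
        nlinarith
      · rintro rfl
        simp only [Complex.ofReal_one, one_mul, hw, sub_left_inj] at h
        exact hbj (hz.inj (hl hb) (hl hj) h)
    obtain ⟨k, hk⟩ := hO.exists_next hj
    obtain ⟨m, hm⟩ := hO.exists_prev hj
    obtain ⟨r, hr, hkr⟩ := hreal hk
    obtain ⟨s, hs, hms⟩ := hreal hm
    have hms' : w m = (s⁻¹ : ℝ) * w j := by
      rw [hms, ← mul_assoc, ← Complex.ofReal_mul, inv_mul_cancel₀ hs.ne', Complex.ofReal_one,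
        one_mul]
    exact hz.no_crossing hk hm hi (hl hj) (hl (hE hk).2) (hl (hE hm).1) r s⁻¹ hr
      (hlt k (hE hk).2 (hO.ne hk).2.2.symm r hr hkr) (inv_pos.2 hs)
      (hlt m (hE hm).1 (hO.ne hm).2.2 _ (inv_pos.2 hs) hms') hkr hms'
  -- a direction outside of the half-plane that belongs to a vertical triangle
  obtain ⟨j₀, hj₀, hj₀π⟩ : ∃ j₀, T.Edge i j₀ ∧ ∀ j k, O i j k → (w k / w j).arg = π → j = j₀ := by
    by_cases h : ∃ j k, O i j k ∧ (w k / w j).arg = π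
    · obtain ⟨j₀, k₀, h1, h2⟩ := h
      exact ⟨j₀, (hE h1).1, fun j k h3 h4 => hz.pi_unique h3 h1 hi (hl (hE h3).1) (hl (hE h3).2)
        (hl (hE h1).1) (hl (hE h1).2) h4 h2⟩
    · push Not at h
      obtain ⟨j₀, h0⟩ := T.exists_edge i
      exact ⟨j₀, h0, fun j k h1 h2 => absurd h2 (h j k h1)⟩
  obtain ⟨x, hx, hx0, hxπ⟩ := exists_generic w j₀ (hw0 hj₀)
  have hcross : ∀ j k, O i j k → π < (-w j / x).arg + (w k / w j).arg →
      0 < (w k / w j).im ∧ ∃ a b : ℝ, 0 < a ∧ 0 < b ∧ x = a * w j + b * w k := by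
    intro j k h hc
    have hwj := hw0 (hE h).1
    have hwk := hw0 (hE h).2
    -- Only a triangle starting at `j₀` can have the angle `π`, and the argument there is negative,
    -- so it is not swept across `x`. All counted triangles are thus nondegenerate and `disjoint`
    -- applies to them.
    have hαπ : (w k / w j).arg ≠ π := by
      intro hπ
      rw [hj₀π j k h hπ] at hc hπ
      linarith
    have hα1 := lt_of_le_of_ne (Complex.arg_le_pi (w k / w j)) hαπ
    have hθ1 := lt_of_le_of_ne (Complex.arg_le_pi (-w j / x)) (hxπ j hwj)
    have hα0 : 0 < (w k / w j).arg := by linarith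
    have hθ0 : 0 < (-w j / x).arg := by linarith
    have hsign : ∀ {y : ℂ}, 0 < y.arg → y.arg < π → 0 < y.im := by
      intro y h0 h1
      refine lt_of_le_of_ne (Complex.arg_nonneg_iff.1 h0.le) fun h2 => ?_
      rcases le_or_gt 0 y.re with h3 | h3
      · exact h0.ne' (Complex.arg_eq_zero_iff.2 ⟨h3, h2.symm⟩)
      · exact h1.ne (Complex.arg_eq_pi_iff.2 ⟨h3, h2.symm⟩)
    have hv := hsign hα0 hα1
    have hu := hsign hθ0 hθ1
    refine ⟨hv, ?_⟩
    have h2 := arg_mul_of_nonneg (u := -w j / x) (v := w k / w j)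
      (div_ne_zero (neg_ne_zero.2 hwj) hx) (div_ne_zero hwk hwj) (harg h)
    rw [if_pos hc] at h2
    have h3 : (-w j / x * (w k / w j)).im < 0 := Complex.arg_neg_iff.1 (by linarith)
    obtain ⟨a, b, ha, hb, hab⟩ := exists_pos_combination (p := w j / x) (v := w k / w j)
      (by rw [neg_div, Complex.neg_im] at hu; linarith)
      (by rw [neg_div, neg_mul, Complex.neg_im] at h3; linarith) hv
    refine ⟨a, b, ha, hb, ?_⟩
    field_simp at hab
    exact hab
  have hN := hcount x hx
  have hunique : ∀ j j', T.Edge i j → T.Edge i j' →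
      π < (-w j / x).arg + (w (IsOrientation.next O i j) / w j).arg →
      π < (-w j' / x).arg + (w (IsOrientation.next O i j') / w j').arg → j = j' := by
    intro j j' hj hj' h h'
    have ho := hO.next_spec hj
    have ho' := hO.next_spec hj'
    obtain ⟨h1, a, b, ha, hb, hab⟩ := hcross _ _ ho h
    obtain ⟨h1', a', b', ha', hb', hab'⟩ := hcross _ _ ho' h'
    exact hz.disjoint ho ho' hi (hl hj) (hl (hE ho).2) (hl hj') (hl (hE ho').2) h1 h1' a b a' b'
      ha hb ha' hb' (hab.symm.trans hab')
  have hex : ∃ j, T.Edge i j ∧ π < (-w j / x).arg + (w (IsOrientation.next O i j) / w j).arg := by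
    by_contra! hnone
    have h0 : ∑ j, ∑ k, (if O i j k then (w k / w j).arg else 0) = 0 := by
      rw [hN]
      refine Finset.sum_eq_zero fun j _ => ?_
      split_ifs with h1 h2
      · exact absurd h2 (not_lt.2 (hnone j h1))
      · rfl
      · rfl
    obtain ⟨j, k, hjk, hne⟩ := hpos
    have hterm : ∀ j k, 0 ≤ (if O i j k then (w k / w j).arg else 0) := by
      intro j k
      split_ifs with h
      · exact harg h
      · exact le_rfl
    have h1 := (Finset.sum_eq_zero_iff_of_nonneg
      fun j _ => Finset.sum_nonneg fun k _ => hterm j k).1 h0 j (Finset.mem_univ _)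
    have h2 := (Finset.sum_eq_zero_iff_of_nonneg fun k _ => hterm j k).1 h1 k (Finset.mem_univ _)
    rw [if_pos hjk] at h2
    exact hne h2
  obtain ⟨j, hj, hjc⟩ := hex
  change ∑ j, ∑ k, (if O i j k then (w k / w j).arg else 0) = 2 * π
  rw [hN, Finset.sum_eq_single_of_mem j (Finset.mem_univ _), if_pos hj, if_pos hjc]
  intro b _ hb
  split_ifs with h1 h2
  · exact absurd (hunique b j h1 hj h2 hjc) hb
  · rfl
  · rfl

end Planar

end

noncomputable section

/-! ### Rigidity of planar drawings -/

open Real EuclideanGeometry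

section Rigidity

variable {V : Type*} [Fintype V] [DecidableEq V] {T : SphereTriangulation V}

/-- The angle at `z i` from `z j` to `z k`. -/
def argAt (z : V → ℂ) (i j k : V) : ℝ := ((z k - z i) / (z j - z i)).arg

theorem IsTriangle.sum_eq_pi {x y z α β γ : ℝ} (h : IsTriangle x y z α β γ) :
    α + β + γ = π := by
  rcases h with h | h | h | h
  · exact h.2.2.2.1
  · rw [h.1, h.2.1, h.2.2.1]; ring
  · rw [h.1, h.2.1, h.2.2.1]; ring
  · rw [h.1, h.2.1, h.2.2.1]; ring

variable {O : V → V → V → Prop} {l : V} {z z' : V → ℂ}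

theorem IsDrawing.argAt_nonneg (hz : IsDrawing O l z) {i j k : V} (h : O i j k) (hi : i ≠ l)
    (hj : j ≠ l) (hk : k ≠ l) : 0 ≤ argAt z i j k :=
  Complex.arg_nonneg_iff.2 (hz.im_nonneg h hi hj hk)

theorem IsDrawing.angle_eq (hO : IsOrientation T O) (hz : IsDrawing O l z) {i j k : V}
    (h : O i j k) (hi : i ≠ l) (hj : j ≠ l) (hk : k ≠ l) : ∠ (z j) (z i) (z k) = argAt z i j k := by
  obtain ⟨hij, hik, -⟩ := hO.ne h
  rw [angle_comm, EuclideanGeometry.angle, vsub_eq_sub, vsub_eq_sub,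
    Complex.angle_eq_abs_arg (hz.sub_ne_zero hi hk hik) (hz.sub_ne_zero hi hj hij)]
  exact abs_of_nonneg (hz.argAt_nonneg h hi hj hk)

theorem IsDrawing.isTriangle (hO : IsOrientation T O) (hz : IsDrawing O l z) {i j k : V}
    (h : O i j k) (hi : i ≠ l) (hj : j ≠ l) (hk : k ≠ l) :
    IsTriangle (log (dist (z j) (z k))) (log (dist (z k) (z i))) (log (dist (z i) (z j)))
      (argAt z i j k) (argAt z j k i) (argAt z k i j) := by
  obtain ⟨hij, hik, hjk⟩ := hO.ne h
  rw [← hz.angle_eq hO h hi hj hk, ← hz.angle_eq hO (hO.rotate h) hj hk hi,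
    ← hz.angle_eq hO (hO.rotate (hO.rotate h)) hk hi hj]
  exact isTriangle_of_ne (fun h => hij (hz.inj hi hj h)) (fun h => hik (hz.inj hi hk h))
    (fun h => hjk (hz.inj hj hk h))

open Classical in
/-- A maximum principle for functions that are linear on degenerate triangles and constant on the
other ones. -/
theorem IsDrawing.exists_ge_of_edge (hO : IsOrientation T O) (hz : IsDrawing O l z) (y : V → ℝ)
    (hy : ∀ i j k, O i j k → i ≠ l → j ≠ l → k ≠ l → (y i = y j ∧ y i = y k) ∨
      (∃ s, 0 < s ∧ s < 1 ∧ y i = s * y j + (1 - s) * y k) ∨ argAt z i j k = 0)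
    {a : V} (ha : a ≠ l) : ∃ b, T.Edge b l ∧ y a ≤ y b := by
  by_contra! hno
  set S : Finset V := Finset.univ.filter fun i => i ≠ l ∧ ∀ j, j ≠ l → y j ≤ y i with hS
  have hSmem : ∀ i, i ∈ S ↔ i ≠ l ∧ ∀ j, j ≠ l → y j ≤ y i := fun i => by simp [hS]
  have hSne : S.Nonempty := by
    obtain ⟨i, hi, hmax⟩ := Finset.exists_max_image (Finset.univ.filter fun i => i ≠ l) y
      ⟨a, by simpa using ha⟩
    simp only [Finset.mem_filter, Finset.mem_univ, true_and] at hi hmax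
    exact ⟨i, (hSmem i).2 ⟨hi, hmax⟩⟩
  -- Among the vertices where `y` is maximal, an extreme one for the lexicographic order of the
  -- plane is taken: all its neighbors in `S` lie in a half-plane.
  obtain ⟨i, hiS, hmax⟩ := Finset.exists_max_image S (fun i => toLex ((z i).re, (z i).im)) hSne
  have hi := (hSmem i).1 hiS
  have hil : ¬ T.Edge i l := fun h => by
    have h1 := hno i h
    have h2 := hi.2 a ha
    linarith
  have hl : ∀ {j}, T.Edge i j → j ≠ l := by rintro j h rfl; exact hil h
  have hargS : ∀ j, T.Edge i j → j ∈ S → -(π / 2) < (-(z j - z i)).arg ∧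
      (-(z j - z i)).arg ≤ π / 2 := by
    intro j hE hj
    have h1 := hmax j hj
    rw [Prod.Lex.toLex_le_toLex] at h1
    have hw := hz.sub_ne_zero hi.1 (hl hE) hE.ne
    have hre : 0 ≤ (-(z j - z i)).re := by
      simp only [Complex.neg_re, Complex.sub_re]
      rcases h1 with h1 | h1
      · linarith [h1]
      · linarith [h1.1]
    have h2 := abs_le.1 (Complex.abs_arg_le_pi_div_two_iff.2 hre)
    refine ⟨lt_of_le_of_ne h2.1 fun h3 => ?_, h2.2⟩
    have h4 := Complex.arg_eq_neg_pi_div_two_iff.1 h3.symm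
    simp only [Complex.neg_re, Complex.sub_re, Complex.neg_im, Complex.sub_im] at h4
    rcases h1 with h1 | h1
    · simp only at h1
      linarith [h4.1]
    · simp only at h1
      linarith [h4.2, h1.2]
  -- A triangle with nonzero angle at `i` has all its vertices in `S`, because a maximum at the
  -- middle of a convex combination spreads to both ends. So no argument jumps, the angles telescope
  -- to zero, and the sum cannot be `2π`.
  have hterm : ∀ j k, O i j k → argAt z i j k = (-(z k - z i)).arg - (-(z j - z i)).arg := by
    intro j k h
    have hj := hl (hO.edge h)
    have hk := hl (hO.edge_right h)
    have hwj := hz.sub_ne_zero hi.1 hj (hO.ne h).1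
    have hwk := hz.sub_ne_zero hi.1 hk (hO.ne h).2.1
    have h1 := arg_mul_of_nonneg (u := -(z j - z i)) (v := (z k - z i) / (z j - z i))
      (neg_ne_zero.2 hwj) (div_ne_zero hwk hwj) (hz.argAt_nonneg h hi.1 hj hk)
    have h2 : -(z j - z i) * ((z k - z i) / (z j - z i)) = -(z k - z i) := by
      field_simp
    rw [h2] at h1
    have hS2 : j ∈ S ∧ k ∈ S ∨ argAt z i j k = 0 := by
      have hj' := hi.2 j hj
      have hk' := hi.2 k hk
      have hall : ∀ m, m ≠ l → y m = y i → m ∈ S := fun m hm hym =>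
        (hSmem m).2 ⟨hm, by rw [hym]; exact hi.2⟩
      rcases hy i j k h hi.1 hj hk with h3 | h3 | h3
      · exact Or.inl ⟨hall j hj h3.1.symm, hall k hk h3.2.symm⟩
      · left
        obtain ⟨s, hs0, hs1, hs⟩ := h3
        have e1 : y j = y i := by
          by_contra hne
          have := lt_of_le_of_ne hj' hne
          nlinarith [mul_pos hs0 (sub_pos.2 this), mul_nonneg (sub_pos.2 hs1).le (sub_nonneg.2 hk')]
        have e2 : y k = y i := by
          rw [e1] at hs
          have : (1 - s) * (y k - y i) = 0 := by linarith
          rcases mul_eq_zero.1 this with h | h <;> linarith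
        exact ⟨hall j hj e1, hall k hk e2⟩
      · exact Or.inr h3
    rw [if_neg] at h1
    · rw [argAt]; linarith
    · intro hc
      rw [if_pos hc] at h1
      rcases hS2 with ⟨hjS, hkS⟩ | h0
      · have b1 := hargS j (hO.edge h) hjS
        have b2 := hargS k (hO.edge_right h) hkS
        have b3 := Complex.arg_le_pi ((z k - z i) / (z j - z i))
        linarith [b1.2, b2.1]
      · have b3 := Complex.arg_le_pi (-(z j - z i))
        rw [argAt] at h0
        linarith
  have hsum := hz.angle_sum hO hi.1 hil
  have hsum' := hO.sum_link_sub i fun j => (-(z j - z i)).arg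
  have : ∑ j, ∑ k, (if O i j k then ((z k - z i) / (z j - z i)).arg else 0) =
      ∑ j, ∑ k, (if O i j k then (-(z k - z i)).arg - (-(z j - z i)).arg else 0) :=
    Finset.sum_congr rfl fun j _ => Finset.sum_congr rfl fun k _ => by
      by_cases h : O i j k
      · rw [if_pos h, if_pos h]; exact hterm j k h
      · rw [if_neg h, if_neg h]
  rw [hsum, hsum'] at this
  linarith [pi_pos]

/-- The change of the angles of a triangle under a conformal change of the side lengths. -/
theorem IsDrawing.triangle_mono (hO : IsOrientation T O) (hz : IsDrawing O l z)
    (hz' : IsDrawing O l z') {δ : V → ℝ}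
    (hlen : ∀ i j, T.Edge i j → i ≠ l → j ≠ l →
      dist (z' i) (z' j) = dist (z i) (z j) * exp ((δ i + δ j) / 2))
    {i j k : V} (h : O i j k) (hi : i ≠ l) (hj : j ≠ l) (hk : k ≠ l) :
    (argAt z' i j k - argAt z i j k) * δ i + (argAt z' j k i - argAt z j k i) * δ j +
      (argAt z' k i j - argAt z k i j) * δ k < 0 ∨
    ((argAt z' i j k - argAt z i j k) * δ i + (argAt z' j k i - argAt z j k i) * δ j +
      (argAt z' k i j - argAt z k i j) * δ k = 0 ∧
      ((exp (-δ i / 2) = exp (-δ j / 2) ∧ exp (-δ i / 2) = exp (-δ k / 2)) ∨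
      (∃ s, 0 < s ∧ s < 1 ∧ exp (-δ i / 2) = s * exp (-δ j / 2) + (1 - s) * exp (-δ k / 2)) ∨
      argAt z i j k = 0)) := by
  have h1 := hz.isTriangle hO h hi hj hk
  have h2 := hz'.isTriangle hO h hi hj hk
  have s1 := h1.sum_eq_pi
  have s2 := h2.sum_eq_pi
  obtain ⟨hij, hik, hjk⟩ := hO.ne h
  have hd : ∀ {a b}, T.Edge a b → a ≠ l → b ≠ l →
      log (dist (z' a) (z' b)) = log (dist (z a) (z b)) + (δ a + δ b) / 2 := by
    intro a b hE ha hb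
    rw [hlen a b hE ha hb, log_mul (dist_pos.2 fun h => hE.ne (hz.inj ha hb h)).ne'
      (exp_pos _).ne', log_exp]
  have e1 := hd (hO.edge (hO.rotate h)) hj hk
  have e2 := hd (hO.edge (hO.rotate (hO.rotate h))) hk hi
  have e3 := hd (hO.edge h) hi hj
  -- Because angle changes have sum zero, pairing them with the half-sums of `δ` on the opposite
  -- sides is `-1/2` times pairing them with `δ` at the vertices.
  have key : ∀ A B C : ℝ, A + B + C = 0 → A * ((δ j + δ k) / 2) + B * ((δ k + δ i) / 2) +
      C * ((δ i + δ j) / 2) = -(A * δ i + B * δ j + C * δ k) / 2 := by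
    intro A B C hABC
    linear_combination (δ i + δ j + δ k) / 2 * hABC
  have key' := key (argAt z' i j k - argAt z i j k) (argAt z' j k i - argAt z j k i)
    (argAt z' k i j - argAt z k i j) (by linarith)
  have hm := h1.mono h2
  rw [e1, e2, e3] at hm
  simp only [add_sub_cancel_left] at hm
  rw [key'] at hm
  rcases hm with hm | ⟨hm, hc⟩
  · left; linarith
  · right
    refine ⟨by linarith, ?_⟩
    rcases hc with hc | hc | hc | hc
    · left
      have : δ i = δ j := by linarith [hc.1]
      have : δ j = δ k := by linarith [hc.2]
      constructor <;> congr 2 <;> linarith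
    · right; left
      have f1 := hc.1.2.2.2
      have f2 := hc.2.2.2.2
      have pjk := dist_pos.2 fun h => hjk (hz.inj hj hk h)
      have pki := dist_pos.2 fun h => hik (hz.inj hk hi h).symm
      have pij := dist_pos.2 fun h => hij (hz.inj hi hj h)
      rw [exp_add, exp_add, exp_add] at f2
      rw [exp_log pjk, exp_log pki, exp_log pij] at f1 f2
      -- Both triangles satisfy the same degenerate length relation. Dividing the second relation by
      -- `exp ((δ i + δ j + δ k) / 2)` shows that `exp (-δ i / 2)` is interpolated with the weights
      -- of the first.
      refine ⟨dist (z k) (z i) / dist (z j) (z k), div_pos pki pjk,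
        (div_lt_one pjk).2 (by linarith), ?_⟩
      have g : ∀ a b c : V, exp (-δ c / 2) =
          exp ((δ a + δ b) / 2) * exp (-(δ a + δ b + δ c) / 2) := fun a b c => by
        rw [← exp_add]; congr 1; ring
      rw [g j k i, g k i j, g i j k, show δ k + δ i + δ j = δ j + δ k + δ i by ring,
        show δ i + δ j + δ k = δ j + δ k + δ i by ring, one_sub_div pjk.ne', f1, add_sub_cancel_left,
        ← f1, ← mul_assoc, ← mul_assoc, ← add_mul]
      congr 1
      rw [div_mul_eq_mul_div, div_mul_eq_mul_div, ← add_div, eq_div_iff pjk.ne']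
      linarith
    · right; right; exact hc.1.2.2.1
    · right; right; exact hc.1.2.1

theorem sum_rotate {g : V → V → V → ℝ} :
    ∑ i, ∑ j, ∑ k, g j k i = ∑ i, ∑ j, ∑ k, g i j k := by
  rw [Finset.sum_comm]
  exact Finset.sum_congr rfl fun j _ => Finset.sum_comm

open Classical in
/-- A discrete conformal change of a drawing that fixes the boundary is trivial. -/
theorem IsDrawing.conformal_factor_eq_zero (hO : IsOrientation T O) (hz : IsDrawing O l z)
    (hz' : IsDrawing O l z') {δ : V → ℝ}
    (hlen : ∀ i j, T.Edge i j → i ≠ l → j ≠ l →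
      dist (z' i) (z' j) = dist (z i) (z j) * exp ((δ i + δ j) / 2))
    (hb : ∀ i, T.Edge i l → δ i = 0) {a : V} (ha : a ≠ l) : δ a = 0 := by
  set g : V → V → V → ℝ := fun i j k => if O i j k ∧ i ≠ l ∧ j ≠ l ∧ k ≠ l then
    (argAt z' i j k - argAt z i j k) * δ i else 0 with hg
  -- Boundary vertices contribute nothing since `δ` vanishes there; at the others both angle sums
  -- are `2π`.
  have hG : ∑ i, ∑ j, ∑ k, g i j k = 0 := by
    refine Finset.sum_eq_zero fun i _ => ?_
    by_cases hi : i = l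
    · exact Finset.sum_eq_zero fun j _ => Finset.sum_eq_zero fun k _ => if_neg fun h => h.2.1 hi
    by_cases hil : T.Edge i l
    · refine Finset.sum_eq_zero fun j _ => Finset.sum_eq_zero fun k _ => ?_
      simp only [hg, hb i hil, mul_zero, ite_self]
    · have h1 := hz.angle_sum hO hi hil
      have h2 := hz'.angle_sum hO hi hil
      have h3 : ∑ j, ∑ k, g i j k = δ i *
          (∑ j, ∑ k, (if O i j k then ((z' k - z' i) / (z' j - z' i)).arg else 0) -
           ∑ j, ∑ k, (if O i j k then ((z k - z i) / (z j - z i)).arg else 0)) := by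
        rw [← Finset.sum_sub_distrib, Finset.mul_sum]
        refine Finset.sum_congr rfl fun j _ => ?_
        rw [← Finset.sum_sub_distrib, Finset.mul_sum]
        refine Finset.sum_congr rfl fun k _ => ?_
        by_cases h : O i j k
        · have hj : j ≠ l := by rintro rfl; exact hil (hO.edge h)
          have hk : k ≠ l := by rintro rfl; exact hil (hO.edge_right h)
          simp only [hg, h, hi, hj, hk, ne_eq, not_false_eq_true, and_self, if_true]
          simp only [argAt]
          ring
        · simp [hg, h]
      rw [h3, h1, h2, sub_self, mul_zero]
  have hcyc : ∑ i, ∑ j, ∑ k, (g i j k + g j k i + g k i j) = 0 := by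
    simp only [Finset.sum_add_distrib]
    rw [sum_rotate (g := g), sum_rotate (g := fun i j k => g j k i), sum_rotate (g := g), hG]
    simp
  have hle : ∀ i j k, g i j k + g j k i + g k i j ≤ 0 := by
    intro i j k
    by_cases h : O i j k ∧ i ≠ l ∧ j ≠ l ∧ k ≠ l
    · obtain ⟨h, hi, hj, hk⟩ := h
      simp only [hg, h, hO.rotate h, hO.rotate (hO.rotate h), hi, hj, hk, ne_eq,
        not_false_eq_true, and_self, if_true]
      rcases hz.triangle_mono hO hz' hlen h hi hj hk with h1 | h1
      · exact h1.le
      · exact h1.1.le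
    · have h' : ¬ (O j k i ∧ j ≠ l ∧ k ≠ l ∧ i ≠ l) := fun h' =>
        h ⟨hO.rotate (hO.rotate h'.1), h'.2.2.2, h'.2.1, h'.2.2.1⟩
      have h'' : ¬ (O k i j ∧ k ≠ l ∧ i ≠ l ∧ j ≠ l) := fun h'' =>
        h ⟨hO.rotate h''.1, h''.2.2.1, h''.2.2.2, h''.2.1⟩
      simp only [hg, if_neg h, if_neg h', if_neg h'']
      simp
  have hzero : ∀ i j k, g i j k + g j k i + g k i j = 0 := by
    intro i j k
    have n1 : ∀ i j k, 0 ≤ -(g i j k + g j k i + g k i j) := fun i j k => by linarith [hle i j k]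
    have h0 : ∑ i, ∑ j, ∑ k, -(g i j k + g j k i + g k i j) = 0 := by
      simp only [Finset.sum_neg_distrib]
      rw [hcyc, neg_zero]
    have h1 := (Finset.sum_eq_zero_iff_of_nonneg fun i _ => Finset.sum_nonneg fun j _ =>
      Finset.sum_nonneg fun k _ => n1 i j k).1 h0 i (Finset.mem_univ _)
    have h2 := (Finset.sum_eq_zero_iff_of_nonneg fun j _ =>
      Finset.sum_nonneg fun k _ => n1 i j k).1 h1 j (Finset.mem_univ _)
    have h3 := (Finset.sum_eq_zero_iff_of_nonneg fun k _ => n1 i j k).1 h2 k (Finset.mem_univ _)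
    linarith
  have hcases : ∀ i j k, O i j k → i ≠ l → j ≠ l → k ≠ l →
      ((exp (-δ i / 2) = exp (-δ j / 2) ∧ exp (-δ i / 2) = exp (-δ k / 2)) ∨
      (∃ s, 0 < s ∧ s < 1 ∧ exp (-δ i / 2) = s * exp (-δ j / 2) + (1 - s) * exp (-δ k / 2)) ∨
      argAt z i j k = 0) := by
    intro i j k h hi hj hk
    have h0 := hzero i j k
    simp only [hg, h, hO.rotate h, hO.rotate (hO.rotate h), hi, hj, hk, ne_eq,
      not_false_eq_true, and_self, if_true] at h0
    rcases hz.triangle_mono hO hz' hlen h hi hj hk with h1 | h1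
    · exact absurd h0 h1.ne
    · exact h1.2
  -- The maximum principle, applied to `exp (-δ / 2)` and to its negative, bounds it on both sides
  -- by its boundary value `1`.
  obtain ⟨b, hbE, hb1⟩ := hz.exists_ge_of_edge hO (fun i => exp (-δ i / 2)) hcases ha
  obtain ⟨c, hcE, hc1⟩ := hz.exists_ge_of_edge hO (fun i => -exp (-δ i / 2)) (by
    intro i j k h hi hj hk
    rcases hcases i j k h hi hj hk with h1 | ⟨s, h1, h2, h3⟩ | h1
    · exact Or.inl ⟨by rw [h1.1], by rw [h1.2]⟩
    · exact Or.inr (Or.inl ⟨s, h1, h2, by rw [h3]; ring⟩)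
    · exact Or.inr (Or.inr h1)) ha
  rw [hb b hbE] at hb1
  rw [hb c hcE] at hc1
  have h1 : exp (-δ a / 2) = exp 0 := by
    simp only [neg_zero, zero_div, exp_zero] at *
    linarith
  have := exp_injective h1
  linarith

/-- A point of the closed upper half-plane is determined by its distances from `0` and `1`; this
also covers flat triangles. -/
theorem eq_of_norm_eq {u v : ℂ} (h1 : ‖u‖ = ‖v‖) (h2 : ‖u - 1‖ = ‖v - 1‖) (hu : 0 ≤ u.im)
    (hv : 0 ≤ v.im) : u = v := by
  have e1 : Complex.normSq u = Complex.normSq v := by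
    rw [Complex.normSq_eq_norm_sq, Complex.normSq_eq_norm_sq, h1]
  have e2 : Complex.normSq (u - 1) = Complex.normSq (v - 1) := by
    rw [Complex.normSq_eq_norm_sq, Complex.normSq_eq_norm_sq, h2]
  simp only [Complex.normSq_apply, Complex.sub_re, Complex.sub_im, Complex.one_re,
    Complex.one_im] at e1 e2
  have hre : u.re = v.re := by linarith
  refine Complex.ext hre ?_
  rw [hre] at e1
  nlinarith

/-- Two drawings that induce the same metric are congruent. -/
theorem IsDrawing.exists_isometry (hO : IsOrientation T O) (hz : IsDrawing O l z)
    (hz' : IsDrawing O l z')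
    (hlen : ∀ i j, T.Edge i j → i ≠ l → j ≠ l → dist (z' i) (z' j) = dist (z i) (z j)) :
    ∃ u b : ℂ, ‖u‖ = 1 ∧ ∀ i, i ≠ l → z' i = u * z i + b := by
  -- The quotient of corresponding edge vectors is the rotation undergone by an edge. Congruence of
  -- oriented triangles makes it constant on each triangle, hence on all edges that avoid `l`.
  set c : V → V → ℂ := fun i j => (z' j - z' i) / (z j - z i) with hc
  have hsymm : ∀ i j, c i j = c j i := fun i j => by
    simp only [hc]
    rw [← neg_sub, ← neg_sub (z i), neg_div_neg_eq]
  have hnorm : ∀ {i j}, T.Edge i j → i ≠ l → j ≠ l → ‖z' j - z' i‖ = ‖z j - z i‖ := by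
    intro i j hE hi hj
    rw [← dist_eq_norm, ← dist_eq_norm, hlen j i hE.symm hj hi]
  have htri : ∀ i j k, O i j k → i ≠ l → j ≠ l → k ≠ l → c i j = c i k := by
    intro i j k h hi hj hk
    obtain ⟨hij, hik, hjk⟩ := hO.ne h
    have wj := hz.sub_ne_zero hi hj hij
    have wk := hz.sub_ne_zero hi hk hik
    have wj' := hz'.sub_ne_zero hi hj hij
    have n1 := hnorm (hO.edge h) hi hj
    have n2 := hnorm (hO.edge_right h) hi hk
    have n3 := hnorm (hO.edge (hO.rotate h)) hj hk
    have key : (z' k - z' i) / (z' j - z' i) = (z k - z i) / (z j - z i) := by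
      refine eq_of_norm_eq ?_ ?_ (hz'.im_nonneg h hi hj hk) (hz.im_nonneg h hi hj hk)
      · rw [norm_div, norm_div, n1, n2]
      · rw [div_sub_one wj', div_sub_one wj, norm_div, norm_div, n1, sub_sub_sub_cancel_right,
          sub_sub_sub_cancel_right, n3]
    simp only [hc]
    rw [div_eq_div_iff wj' wj] at key
    rw [div_eq_div_iff wj wk]
    linear_combination -key
  obtain ⟨i₀, hi₀⟩ := T.exists_edge l
  obtain ⟨j₀, hj₀, hj₀l⟩ := T.exists_edge_ne i₀ l
  have hi₀l := hi₀.ne.symm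
  have hconst : ∀ i j, T.Edge i j → i ≠ l → j ≠ l → c i j = c i₀ j₀ := fun i j hE hi hj =>
    hO.eq_of_triangle hsymm htri hE hj₀ hi hj hi₀l hj₀l
  set u := c i₀ j₀ with hu
  have hnu : ‖u‖ = 1 := by
    rw [hu, hc]
    simp only
    rw [norm_div, hnorm hj₀ hi₀l hj₀l, div_self]
    exact norm_ne_zero_iff.2 (hz.sub_ne_zero hi₀l hj₀l hj₀.ne)
  refine ⟨u, z' i₀ - u * z i₀, hnu, fun i hi => ?_⟩
  have := T.eq_of_edge (l := l) (e := fun i => z' i - u * z i) (fun i j hE hi hj => by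
    have h1 := hconst i j hE hi hj
    simp only [hc] at h1
    rw [div_eq_iff (hz.sub_ne_zero hi hj hE.ne)] at h1
    linear_combination -h1) hi hi₀l
  linear_combination this

end Rigidity

end

noncomputable section

open Filter Topology

/-! ### Projection from an ideal point -/

/-- The ideal point from which we project. -/
def north : EuclideanSpace ℝ (Fin 3) := !₂[0, 0, 1]

/-- The distance from the tangent plane at `north`. -/
def height (p : EuclideanSpace ℝ (Fin 3)) : ℝ := 1 - p 2

/-- The projection from `north` to the plane. -/
def proj (p : EuclideanSpace ℝ (Fin 3)) : ℂ := ⟨p 0 / height p, p 1 / height p⟩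

/-- The point with given projection and height. -/
def ptOf (z : ℂ) (h : ℝ) : EuclideanSpace ℝ (Fin 3) := !₂[h * z.re, h * z.im, 1 - h]

@[simp] theorem north_zero : north 0 = 0 := rfl
@[simp] theorem north_one : north 1 = 0 := rfl
@[simp] theorem north_two : north 2 = 1 := rfl
@[simp] theorem ptOf_zero (z : ℂ) (h : ℝ) : ptOf z h 0 = h * z.re := rfl
@[simp] theorem ptOf_one (z : ℂ) (h : ℝ) : ptOf z h 1 = h * z.im := rfl
@[simp] theorem ptOf_two (z : ℂ) (h : ℝ) : ptOf z h 2 = 1 - h := rfl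
@[simp] theorem height_ptOf (z : ℂ) (h : ℝ) : height (ptOf z h) = h := by simp [height]

theorem norm_north : ‖north‖ = 1 := by
  have : ‖north‖ ^ 2 = 1 := by
    rw [← real_inner_self_eq_norm_sq, inner3]; simp
  nlinarith [norm_nonneg north]

theorem ptOf_proj {p : EuclideanSpace ℝ (Fin 3)} (h : height p ≠ 0) :
    ptOf (proj p) (height p) = p := by
  refine ext3 ?_ ?_ ?_
  · simp [proj, mul_div_cancel₀ _ h]
  · simp [proj, mul_div_cancel₀ _ h]
  · simp [height]

theorem proj_ptOf {z : ℂ} {h : ℝ} (hh : h ≠ 0) : proj (ptOf z h) = z := by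
  apply Complex.ext <;> simp [proj, hh]

theorem ptOf_smul (z : ℂ) (h r : ℝ) : ptOf z (r * h) = north + r • (ptOf z h - north) := by
  refine ext3 ?_ ?_ ?_ <;> simp <;> ring

theorem height_pos_of_norm_le {p : EuclideanSpace ℝ (Fin 3)} (hp : ‖p‖ ≤ 1) (hne : p ≠ north) :
    0 < height p := by
  have h1 : ‖p‖ ^ 2 = p 0 ^ 2 + p 1 ^ 2 + p 2 ^ 2 := by
    rw [← real_inner_self_eq_norm_sq, inner3]; ring
  have h2 : ‖p‖ ^ 2 ≤ 1 := by nlinarith [norm_nonneg p]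
  rw [h1] at h2
  unfold height
  by_contra! h
  have h3 : 1 ≤ p 2 := by linarith
  have h4 : p 2 = 1 := by nlinarith [sq_nonneg (p 0), sq_nonneg (p 1)]
  rw [h4] at h2
  have h5 : p 0 = 0 := by nlinarith [sq_nonneg (p 0), sq_nonneg (p 1)]
  have h6 : p 1 = 0 := by nlinarith [sq_nonneg (p 0), sq_nonneg (p 1)]
  exact hne (ext3 (by simp [h5]) (by simp [h6]) (by simp [h4]))

/-- The height of an ideal point in terms of its projection. -/
theorem inv_height {p : EuclideanSpace ℝ (Fin 3)} (hp : ‖p‖ = 1) (hne : p ≠ north) :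
    1 / height p = (1 + Complex.normSq (proj p)) / 2 := by
  have h0 := height_pos_of_norm_le hp.le hne
  have h1 : p 0 ^ 2 + p 1 ^ 2 + p 2 ^ 2 = 1 := by
    have : ‖p‖ ^ 2 = p 0 ^ 2 + p 1 ^ 2 + p 2 ^ 2 := by
      rw [← real_inner_self_eq_norm_sq, inner3]; ring
    rw [← this, hp]; norm_num
  have h2 : p 2 = 1 - height p := by unfold height; ring
  rw [Complex.normSq_apply]
  simp only [proj]
  rw [h2] at h1
  field_simp
  linarith

/-- The side of a face on which `north` lies is the orientation of the projected triangle, since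
heights are positive. -/
theorem planeFun_north {a b c : EuclideanSpace ℝ (Fin 3)} (ha : height a ≠ 0) (hb : height b ≠ 0)
    (hc : height c ≠ 0) : planeFun a b c north = height a * height b * height c *
      ((proj b - proj a).re * (proj c - proj a).im - (proj b - proj a).im * (proj c - proj a).re) := by
  have ha2 : a 2 = 1 - height a := by unfold height; ring
  have hb2 : b 2 = 1 - height b := by unfold height; ring
  have hc2 : c 2 = 1 - height c := by unfold height; ring
  simp only [planeFun_eq, inner3, cross3_zero, cross3_one, cross3_two, PiLp.sub_apply, north_zero,
    north_one, north_two, Complex.sub_re, Complex.sub_im, ha2, hb2, hc2]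
  simp only [proj]
  field_simp
  ring

theorem im_div_eq (u v : ℂ) : (v / u).im = (u.re * v.im - u.im * v.re) / Complex.normSq u := by
  rw [Complex.div_im]
  ring

/-- The distance of the projections of ideal points. -/
theorem dist_proj_sq {p q : EuclideanSpace ℝ (Fin 3)} (hp : ‖p‖ = 1) (hq : ‖q‖ = 1)
    (hp0 : height p ≠ 0) (hq0 : height q ≠ 0) :
    dist (proj p) (proj q) ^ 2 = 2 * (1 - inner ℝ p q) / (height p * height q) := by
  have hsq : ∀ {p : EuclideanSpace ℝ (Fin 3)}, ‖p‖ = 1 →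
      p 0 ^ 2 + p 1 ^ 2 = height p * (2 - height p) := by
    intro p hp
    have : ‖p‖ ^ 2 = p 0 ^ 2 + p 1 ^ 2 + p 2 ^ 2 := by
      rw [← real_inner_self_eq_norm_sq, inner3]; ring
    rw [hp] at this
    unfold height
    linarith
  have h1 := hsq hp
  have h2 := hsq hq
  have hp2 : p 2 = 1 - height p := by unfold height; ring
  have hq2 : q 2 = 1 - height q := by unfold height; ring
  rw [dist_eq_norm, ← Complex.normSq_eq_norm_sq, Complex.normSq_apply, inner3]
  simp only [Complex.sub_re, Complex.sub_im, proj, hp2, hq2]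
  field_simp
  linear_combination (height q) ^ 2 * h1 + (height p) ^ 2 * h2

/-- In the coordinates `(z, 1 / h)` the projection from `north` is affine, so segments remain
segments. Dividing the weights by the heights and normalizing prescribes the projected barycenter.
-/
theorem combo_ptOf {z₁ z₂ z₃ : ℂ} {h₁ h₂ h₃ a b c : ℝ} (h1 : h₁ ≠ 0) (h2 : h₂ ≠ 0) (h3 : h₃ ≠ 0)
    (habc : a + b + c = 1) (hS : a / h₁ + b / h₂ + c / h₃ ≠ 0) :
    (a / h₁ / (a / h₁ + b / h₂ + c / h₃)) • ptOf z₁ h₁ +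
      (b / h₂ / (a / h₁ + b / h₂ + c / h₃)) • ptOf z₂ h₂ +
      (c / h₃ / (a / h₁ + b / h₂ + c / h₃)) • ptOf z₃ h₃ =
      ptOf (a * z₁ + b * z₂ + c * z₃) (1 / (a / h₁ + b / h₂ + c / h₃)) := by
  set S := a / h₁ + b / h₂ + c / h₃ with hSd
  have e : ∀ {x y : ℝ}, y ≠ 0 → x / y / S * y = x / S := by
    intro x y hy; field_simp
  refine ext3 ?_ ?_ ?_
  · simp only [PiLp.add_apply, PiLp.smul_apply, smul_eq_mul, ptOf_zero, ← mul_assoc, e h1, e h2,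
      e h3, Complex.add_re, Complex.re_ofReal_mul]
    ring
  · simp only [PiLp.add_apply, PiLp.smul_apply, smul_eq_mul, ptOf_one, ← mul_assoc, e h1, e h2,
      e h3, Complex.add_im, Complex.im_ofReal_mul]
    ring
  · simp only [PiLp.add_apply, PiLp.smul_apply, smul_eq_mul, ptOf_two, mul_sub, e h1, e h2,
      e h3, mul_one]
    have : a / h₁ / S + b / h₂ / S + c / h₃ / S = 1 := by
      rw [← add_div, ← add_div, ← hSd, div_self hS]
    have h4 : a / S + b / S + c / S = 1 / S := by rw [← add_div, ← add_div, habc]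
    linarith

section Drawing

variable {V : Type*} [Fintype V] [DecidableEq V] {T : SphereTriangulation V} {M : CuspMetric T}

namespace IdealRealization

variable (R : IdealRealization T M) {l : V}

/-- The projections of the ideal vertices. -/
def drawing (i : V) : ℂ := proj (R.idealPt i)

variable {R}

theorem height_pos (hl : R.idealPt l = north) {i : V} (hi : i ≠ l) : 0 < height (R.idealPt i) :=
  height_pos_of_norm_le (R.norm_idealPt i).le fun h => hi (R.idealPt_injective (h.trans hl.symm))

theorem ptOf_drawing (hl : R.idealPt l = north) {i : V} (hi : i ≠ l) :
    ptOf (R.drawing i) (height (R.idealPt i)) = R.idealPt i :=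
  ptOf_proj (height_pos hl hi).ne'

theorem inv_height_drawing (hl : R.idealPt l = north) {i : V} (hi : i ≠ l) :
    1 / height (R.idealPt i) = (1 + Complex.normSq (R.drawing i)) / 2 :=
  inv_height (R.norm_idealPt i) fun h => hi (R.idealPt_injective (h.trans hl.symm))

theorem drawing_inj (hl : R.idealPt l = north) {i j : V} (hi : i ≠ l) (hj : j ≠ l)
    (h : R.drawing i = R.drawing j) : i = j := by
  have h1 := inv_height_drawing hl hi
  have h2 := inv_height_drawing hl hj
  rw [h, ← h2, one_div, one_div, inv_inj] at h1
  refine R.idealPt_injective ?_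
  rw [← ptOf_drawing hl hi, ← ptOf_drawing hl hj, h, h1]

theorem faceFun_north (hl : R.idealPt l = north) {i j k : V} (hi : i ≠ l) (hj : j ≠ l)
    (hk : k ≠ l) (hij : i ≠ j) : R.faceFun i j k north =
      height (R.idealPt i) * height (R.idealPt j) * height (R.idealPt k) *
      (Complex.normSq (R.drawing j - R.drawing i) *
        ((R.drawing k - R.drawing i) / (R.drawing j - R.drawing i)).im) := by
  have hne : R.drawing j - R.drawing i ≠ 0 :=
    sub_ne_zero.2 fun h => hij (drawing_inj hl hj hi h).symm
  rw [im_div_eq, mul_div_cancel₀ _ (Complex.normSq_pos.2 hne).ne']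
  exact planeFun_north (height_pos hl hi).ne' (height_pos hl hj).ne' (height_pos hl hk).ne'

theorem isClosed_body (R : IdealRealization T M) : IsClosed R.body := R.isCompact_body.isClosed

theorem openFace_subset_body {t : Finset V} (ht : t ∈ T.faces) : R.openFace t ⊆ R.body :=
  (R.openFace_subset_frontier ht).trans R.isClosed_body.frontier_subset

/-- The center `north` of the star cannot be strictly on the outer side of a face, and
`faceFun_north` reads this as the orientation of the drawing. -/
theorem Oriented.im_nonneg (hl : R.idealPt l = north) (hs : StarConvex ℝ north R.body) {i j k : V}
    (h : R.Oriented i j k) (hi : i ≠ l) (hj : j ≠ l) (hk : k ≠ l) :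
    0 ≤ ((R.drawing k - R.drawing i) / (R.drawing j - R.drawing i)).im := by
  obtain ⟨hij, hik, hjk⟩ := T.ne_of_mem_faces h.1
  have hp := R.center_mem h.1
  have h1 := (h.2 _ hp).nonneg_of_starConvex hs (R.isAffineFun_faceFun hij hik hjk)
    (R.faceFun_openFace hij hik hjk hp) (openFace_subset_body h.1 hp)
  rw [faceFun_north hl hi hj hk hij] at h1
  have hne : R.drawing j - R.drawing i ≠ 0 :=
    sub_ne_zero.2 fun h => hij (drawing_inj hl hj hi h).symm
  have h2 := Complex.normSq_pos.2 hne
  have h3 := mul_pos (mul_pos (height_pos hl hi) (height_pos hl hj)) (height_pos hl hk)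
  by_contra! h4
  have := mul_neg_of_pos_of_neg h3 (mul_neg_of_pos_of_neg h2 h4)
  linarith

/-- A point of a projected triangle is the projection of a point of the face. -/
theorem exists_mem_openFace (hl : R.idealPt l = north) {i j k : V} (h : {i, j, k} ∈ T.faces)
    (hi : i ≠ l) (hj : j ≠ l) (hk : k ≠ l) {a b c : ℝ} (ha : 0 < a) (hb : 0 < b) (hc : 0 < c)
    (habc : a + b + c = 1) : ∃ t : ℝ, 0 < t ∧
      ptOf (a * R.drawing i + b * R.drawing j + c * R.drawing k) t ∈ R.openFace {i, j, k} := by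
  have pi := height_pos hl hi
  have pj := height_pos hl hj
  have pk := height_pos hl hk
  have hS : 0 < a / height (R.idealPt i) + b / height (R.idealPt j) + c / height (R.idealPt k) := by
    positivity
  refine ⟨_, one_div_pos.2 hS, ?_⟩
  rw [← combo_ptOf pi.ne' pj.ne' pk.ne' habc hS.ne', ptOf_drawing hl hi, ptOf_drawing hl hj,
    ptOf_drawing hl hk]
  refine R.mem_openFace_triple h (by positivity) (by positivity) (by positivity) ?_
  rw [← add_div, ← add_div, div_self hS.ne']

theorem eq_of_triple_eq {O : V → V → V → Prop} (hO : IsOrientation T O) {i j k j' k' : V}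
    (h : O i j k) (h' : O i j' k') (heq : ({i, j, k} : Finset V) = {i, j', k'}) : j = j' := by
  obtain ⟨hij, hik, hjk⟩ := hO.ne h
  obtain ⟨hij', hik', hjk'⟩ := hO.ne h'
  have h1 : j' ∈ ({i, j, k} : Finset V) := by rw [heq]; simp
  have h2 : k' ∈ ({i, j, k} : Finset V) := by rw [heq]; simp
  simp only [Finset.mem_insert, Finset.mem_singleton] at h1 h2
  rcases h1 with rfl | rfl | rfl
  · exact absurd rfl hij'
  · rfl
  · rcases h2 with rfl | rfl | rfl
    · exact absurd rfl hik'
    · exact absurd h' (hO.not_swap h)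
    · exact absurd rfl hjk'

/-- Over a common point of two projected triangles lie points of both faces. If their heights
differ, the one farther from `north` is hidden behind the other and cannot belong to the star-shaped
body. So they coincide, and then so do the faces. -/
theorem disjoint_triangles (hl : R.idealPt l = north) (hs : StarConvex ℝ north R.body)
    {i j k j' k' : V} (h : R.Oriented i j k) (h' : R.Oriented i j' k') (hi : i ≠ l) (hj : j ≠ l)
    (hk : k ≠ l) (hj' : j' ≠ l) (hk' : k' ≠ l)
    (hpos : 0 < ((R.drawing k - R.drawing i) / (R.drawing j - R.drawing i)).im)
    (hpos' : 0 < ((R.drawing k' - R.drawing i) / (R.drawing j' - R.drawing i)).im)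
    {a b a' b' : ℝ} (ha : 0 < a) (hb : 0 < b) (ha' : 0 < a') (hb' : 0 < b')
    (heq : a * (R.drawing j - R.drawing i) + b * (R.drawing k - R.drawing i) =
      a' * (R.drawing j' - R.drawing i) + b' * (R.drawing k' - R.drawing i)) : j = j' := by
  -- Scaling towards `i` moves the common point of the two cones into both triangles, with a
  -- positive weight left for `i`.
  set ε := 1 / (a + b + a' + b' + 1) with hε
  have hε0 : 0 < ε := by positivity
  have hε1 : ε * (a + b + a' + b' + 1) = 1 := by
    rw [hε]; field_simp
  have m1 := mul_pos hε0 ha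
  have m2 := mul_pos hε0 hb
  have m3 := mul_pos hε0 ha'
  have m4 := mul_pos hε0 hb'
  obtain ⟨t, ht, hp⟩ := exists_mem_openFace hl h.1 hi hj hk (a := 1 - ε * a - ε * b)
    (b := ε * a) (c := ε * b) (by linarith) m1 m2 (by ring)
  obtain ⟨t', ht', hp'⟩ := exists_mem_openFace hl h'.1 hi hj' hk' (a := 1 - ε * a' - ε * b')
    (b := ε * a') (c := ε * b') (by linarith) m3 m4 (by ring)
  set w := ((1 - ε * a - ε * b : ℝ) : ℂ) * R.drawing i + (ε * a : ℝ) * R.drawing j +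
    (ε * b : ℝ) * R.drawing k with hw
  have hww : ((1 - ε * a' - ε * b' : ℝ) : ℂ) * R.drawing i + (ε * a' : ℝ) * R.drawing j' +
    (ε * b' : ℝ) * R.drawing k' = w := by
    rw [hw]
    push_cast
    linear_combination -(ε : ℂ) * heq
  rw [hww] at hp'
  have hbehind : ∀ {j k : V}, R.Oriented i j k → j ≠ l → k ≠ l →
      0 < ((R.drawing k - R.drawing i) / (R.drawing j - R.drawing i)).im →
      ∀ {s s' : ℝ}, 0 < s → s < s' → ptOf w s ∈ R.openFace {i, j, k} → ptOf w s' ∉ R.body := by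
    intro j k h hj hk hpos s s' hs0 hss hp
    obtain ⟨hij, hik, hjk⟩ := T.ne_of_mem_faces h.1
    have hne : R.drawing j - R.drawing i ≠ 0 :=
      sub_ne_zero.2 fun h => hij (drawing_inj hl hj hi h).symm
    refine (h.2 _ hp).notMem_of_starConvex hs (R.isAffineFun_faceFun hij hik hjk)
      (R.faceFun_openFace hij hik hjk hp) ?_ (r := s' / s) ((one_lt_div hs0).2 hss) ?_
    · rw [faceFun_north hl hi hj hk hij]
      exact mul_pos (mul_pos (mul_pos (height_pos hl hi) (height_pos hl hj)) (height_pos hl hk))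
        (mul_pos (Complex.normSq_pos.2 hne) hpos)
    · rw [← ptOf_smul, div_mul_cancel₀ _ hs0.ne']
  have htt : t = t' := by
    rcases lt_trichotomy t t' with h1 | h1 | h1
    · exact absurd (openFace_subset_body h'.1 hp') (hbehind h hj hk hpos ht h1 hp)
    · exact h1
    · exact absurd (openFace_subset_body h.1 hp) (hbehind h' hj' hk' hpos' ht' h1 hp')
  subst htt
  exact eq_of_triple_eq R.isOrientation h h'
    (R.eq_of_mem_openFace h.1 h'.1 hp (R.openFace_subset _ hp'))

/-- A vertical triangle contains the points above its middle vertex. -/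
theorem eventually_mem_openFace (hl : R.idealPt l = north) {i j k : V} (h : {i, j, k} ∈ T.faces)
    (hi : i ≠ l) (hj : j ≠ l) (hk : k ≠ l)
    (hπ : ((R.drawing k - R.drawing i) / (R.drawing j - R.drawing i)).arg = Real.pi) :
    ∀ᶠ s in 𝓝[>] (0 : ℝ), ptOf (R.drawing i) (height (R.idealPt i) * (1 - s)) ∈
      R.openFace {i, j, k} := by
  obtain ⟨hij, hik, hjk⟩ := T.ne_of_mem_faces h
  have pi := height_pos hl hi
  have pj := height_pos hl hj
  have pk := height_pos hl hk
  have ei := inv_height_drawing hl hi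
  have ej := inv_height_drawing hl hj
  have ek := inv_height_drawing hl hk
  have hwj : R.drawing j - R.drawing i ≠ 0 :=
    sub_ne_zero.2 fun h => hij (drawing_inj hl hj hi h).symm
  obtain ⟨r, hr, hwk⟩ : ∃ r : ℝ, 0 < r ∧
      R.drawing k - R.drawing i = -(r : ℂ) * (R.drawing j - R.drawing i) := by
    rw [Complex.arg_eq_pi_iff] at hπ
    refine ⟨-((R.drawing k - R.drawing i) / (R.drawing j - R.drawing i)).re, by linarith, ?_⟩
    rw [← div_eq_iff hwj]
    apply Complex.ext <;> simp [hπ.2]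
  -- In the coordinates `(z, 1 / h)` ideal points lie on a paraboloid, and `K` measures how far the
  -- chord from `j` to `k` passes above it over `i`. Strict convexity gives `K > 0`: the face
  -- contains points just above `i` on the side of `north`.
  set K := r / height (R.idealPt j) + 1 / height (R.idealPt k) - (1 + r) / height (R.idealPt i)
    with hK
  have hKpos : 0 < K := by
    have h1 : R.drawing k = R.drawing i - r * (R.drawing j - R.drawing i) := by
      linear_combination hwk
    have h2 : R.drawing j = R.drawing i + (R.drawing j - R.drawing i) := by ring
    set w := R.drawing j - R.drawing i
    have h3 : K = r * (1 / height (R.idealPt j)) + 1 / height (R.idealPt k) -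
        (1 + r) * (1 / height (R.idealPt i)) := by rw [hK]; ring
    rw [h3, ei, ej, ek, h1, h2]
    have h4 : 0 < Complex.normSq w := Complex.normSq_pos.2 hwj
    have h5 : r * ((1 + Complex.normSq (R.drawing i + w)) / 2) +
        (1 + Complex.normSq (R.drawing i - r * w)) / 2 -
        (1 + r) * ((1 + Complex.normSq (R.drawing i)) / 2) =
        (r + r ^ 2) / 2 * Complex.normSq w := by
      simp only [Complex.normSq_apply, Complex.add_re, Complex.add_im, Complex.sub_re,
        Complex.sub_im, Complex.re_ofReal_mul, Complex.im_ofReal_mul]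
      ring
    rw [h5]
    positivity
  have hev : ∀ᶠ s in 𝓝[>] (0 : ℝ), 0 < 1 - s - s / K * (1 + r) / height (R.idealPt i) := by
    have hc : Continuous (fun s : ℝ => 1 - s - s / K * (1 + r) / height (R.idealPt i)) := by
      fun_prop
    exact ((hc.tendsto 0).mono_left (nhdsWithin_le_nhds (s := Set.Ioi 0))).eventually_const_lt
      (by norm_num)
  filter_upwards [hev, self_mem_nhdsWithin] with s hs1 hs0
  have hs0' : 0 < s := hs0
  have hmem := R.mem_openFace_triple h hs1 (y := s / K * r / height (R.idealPt j))
    (z := s / K / height (R.idealPt k)) (by positivity) (by positivity) (by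
      have : s / K * K = s := div_mul_cancel₀ _ hKpos.ne'
      have h1 : s / K * K = s / K * r / height (R.idealPt j) + s / K / height (R.idealPt k) -
          s / K * (1 + r) / height (R.idealPt i) := by
        rw [hK]; ring
      linarith)
  have hsum : s / K * r / height (R.idealPt j) + s / K / height (R.idealPt k) =
      s + s / K * (1 + r) / height (R.idealPt i) := by
    have : s / K * K = s := div_mul_cancel₀ _ hKpos.ne'
    have h1 : s / K * K = s / K * r / height (R.idealPt j) + s / K / height (R.idealPt k) -
        s / K * (1 + r) / height (R.idealPt i) := by
      rw [hK]; ring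
    linarith
  convert hmem using 1
  have hre : (R.drawing k).re = (R.drawing i).re - r * ((R.drawing j).re - (R.drawing i).re) := by
    have := congrArg Complex.re hwk
    simp only [Complex.sub_re, ← Complex.ofReal_neg, Complex.re_ofReal_mul] at this
    linarith
  have him : (R.drawing k).im = (R.drawing i).im - r * ((R.drawing j).im - (R.drawing i).im) := by
    have := congrArg Complex.im hwk
    simp only [Complex.sub_im, ← Complex.ofReal_neg, Complex.im_ofReal_mul] at this
    linarith
  rw [← ptOf_drawing hl hi, ← ptOf_drawing hl hj, ← ptOf_drawing hl hk]
  simp only [height_ptOf]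
  have e : ∀ {x y : ℝ}, y ≠ 0 → x / y * y = x := fun hy => div_mul_cancel₀ _ hy
  refine ext3 ?_ ?_ ?_
  · simp only [PiLp.add_apply, PiLp.smul_apply, smul_eq_mul, ptOf_zero, ← mul_assoc, e pj.ne',
      e pk.ne', sub_mul, e pi.ne', hre]
    ring
  · simp only [PiLp.add_apply, PiLp.smul_apply, smul_eq_mul, ptOf_one, ← mul_assoc, e pj.ne',
      e pk.ne', sub_mul, e pi.ne', him]
    ring
  · simp only [PiLp.add_apply, PiLp.smul_apply, smul_eq_mul, ptOf_two, mul_sub, e pj.ne',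
      e pk.ne', sub_mul, e pi.ne', mul_one]
    linear_combination -hsum

/-- The edges of four ideal points in a vertical plane cross. -/
theorem chords_cross (hl : R.idealPt l = north) {i j k m : V} (hi : i ≠ l) (hj : j ≠ l)
    (hk : k ≠ l) (hm : m ≠ l) {r s : ℝ} (hr : 0 < r) (hrs : r < s) (hs : s < 1)
    (hwk : R.drawing k - R.drawing i = r * (R.drawing j - R.drawing i))
    (hwm : R.drawing m - R.drawing i = s * (R.drawing j - R.drawing i)) :
    ∃ p, p ∈ convexHull ℝ (R.idealPt '' (({i, m} : Finset V) : Set V)) ∧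
      p ∈ convexHull ℝ (R.idealPt '' (({k, j} : Finset V) : Set V)) := by
  have hpair : ∀ {a b : V}, a ≠ l → b ≠ l → ∀ {x : ℝ}, 0 ≤ x → x ≤ 1 →
      ptOf ((1 - x : ℝ) * R.drawing a + (x : ℝ) * R.drawing b)
        (1 / ((1 - x) / height (R.idealPt a) + x / height (R.idealPt b))) ∈
      convexHull ℝ (R.idealPt '' (({a, b} : Finset V) : Set V)) := by
    intro a b ha hb x hx0 hx1
    have pa := height_pos hl ha
    have pb := height_pos hl hb
    have hS : 0 < (1 - x) / height (R.idealPt a) + x / height (R.idealPt b) := by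
      rcases hx0.eq_or_lt with rfl | hx0
      · simp; positivity
      · have := sub_nonneg.2 hx1
        positivity
    have := combo_ptOf (z₁ := R.drawing a) (z₂ := R.drawing b) (z₃ := 0) pa.ne' pb.ne'
      (one_ne_zero (α := ℝ)) (a := 1 - x) (b := x) (c := 0) (by ring) (by simpa using hS.ne')
    simp only [zero_div, add_zero, zero_smul, Complex.ofReal_zero, mul_zero] at this
    rw [← this, ptOf_drawing hl ha, ptOf_drawing hl hb]
    have ha' : R.idealPt a ∈ convexHull ℝ (R.idealPt '' (({a, b} : Finset V) : Set V)) :=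
      subset_convexHull ℝ _ ⟨a, by simp, rfl⟩
    have hb' : R.idealPt b ∈ convexHull ℝ (R.idealPt '' (({a, b} : Finset V) : Set V)) :=
      subset_convexHull ℝ _ ⟨b, by simp, rfl⟩
    refine convex_convexHull ℝ _ ha' hb' ?_ (by positivity) ?_
    · have := sub_nonneg.2 hx1
      positivity
    · rw [← add_div, div_self hS.ne']
  have hd : 0 < 1 + r - s := by linarith
  -- Along the vertical plane the ideal points lie on a parabola at parameters `0 < r < s < 1`. The
  -- chords over `[0, s]` and `[r, 1]` interleave; `A` and `B` are the positions of their
  -- intersection, obtained from `y = s x` and `y = (1 + r) x - r`.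
  set A := r / (s * (1 + r - s)) with hA
  set B := r * (s - r) / ((1 + r - s) * (1 - r)) with hB
  have hs0 : 0 < s := by linarith
  have h1r : 0 < 1 - r := by linarith
  have hA0 : 0 ≤ A := by positivity
  have hA1 : A ≤ 1 := by
    rw [hA, div_le_one (by positivity)]
    nlinarith
  have hsr := sub_pos.2 hrs
  have hB0 : 0 ≤ B := by positivity
  have hB1 : B ≤ 1 := by
    rw [hB, div_le_one (by positivity)]
    nlinarith [sq_nonneg (1 - s)]
  refine ⟨_, hpair hi hm hA0 hA1, ?_⟩
  have e1 : A * s = (1 - B) * r + B := by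
    rw [hA, hB]; field_simp; ring
  have e2 : A * s ^ 2 = (1 - B) * r ^ 2 + B := by
    rw [hA, hB]; field_simp; ring
  have hk' : R.drawing k = R.drawing i + r * (R.drawing j - R.drawing i) := by
    linear_combination hwk
  have hm' : R.drawing m = R.drawing i + s * (R.drawing j - R.drawing i) := by
    linear_combination hwm
  have f1 : (1 - A : ℝ) * R.drawing i + (A : ℝ) * R.drawing m =
      (1 - B : ℝ) * R.drawing k + (B : ℝ) * R.drawing j := by
    have e1' : (A : ℂ) * s = (1 - B) * r + B := by exact_mod_cast e1
    rw [hk', hm']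
    push_cast
    linear_combination (R.drawing j - R.drawing i) * e1'
  have f2 : (1 - A) / height (R.idealPt i) + A / height (R.idealPt m) =
      (1 - B) / height (R.idealPt k) + B / height (R.idealPt j) := by
    have hj' : R.drawing j = R.drawing i + (R.drawing j - R.drawing i) := by ring
    rw [div_eq_mul_one_div (1 - A), div_eq_mul_one_div A, div_eq_mul_one_div (1 - B),
      div_eq_mul_one_div B, inv_height_drawing hl hi, inv_height_drawing hl hm,
      inv_height_drawing hl hk, inv_height_drawing hl hj, hk', hm']
    set w := R.drawing j - R.drawing i
    rw [hj']
    simp only [Complex.normSq_apply, Complex.add_re, Complex.add_im, Complex.re_ofReal_mul,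
      Complex.im_ofReal_mul]
    linear_combination ((R.drawing i).re * w.re + (R.drawing i).im * w.im) * e1 +
      (w.re ^ 2 + w.im ^ 2) / 2 * e2
  rw [f1, f2]
  exact hpair hk hj hB0 hB1

theorem isDrawing (hl : R.idealPt l = north) (hs : StarConvex ℝ north R.body) :
    IsDrawing R.Oriented l R.drawing where
  inj := drawing_inj hl
  im_nonneg h hi hj hk := h.im_nonneg hl hs hi hj hk
  disjoint h h' hi hj hk hj' hk' hpos hpos' _ _ _ _ ha hb ha' hb' heq :=
    disjoint_triangles hl hs h h' hi hj hk hj' hk' hpos hpos' ha hb ha' hb' heq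
  pi_unique {i j k j' k'} h h' hi hj hk hj' hk' hπ hπ' := by
    obtain ⟨s, hs1, hs2⟩ := ((eventually_mem_openFace hl h.1 hi hj hk hπ).and
      (eventually_mem_openFace hl h'.1 hi hj' hk' hπ')).exists
    exact eq_of_triple_eq R.isOrientation h h'
      (R.eq_of_mem_openFace h.1 h'.1 hs1 (R.openFace_subset _ hs2))
  no_crossing {i j k m} h h' hi hj hk hm r s hr0 hr1 hs0 hs1 hwk hwm := by
    obtain ⟨hij, hik, hjk⟩ := T.ne_of_mem_faces h.1
    obtain ⟨him, -, hmj⟩ := T.ne_of_mem_faces h'.1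
    have hkm : k ≠ m := by
      rintro rfl
      exact h.not_swap h'
    have hdisj : ∀ {a b c d : V}, a ≠ c → a ≠ d → b ≠ c → b ≠ d →
        Disjoint ({a, b} : Finset V) {c, d} := by
      intro a b c d h1 h2 h3 h4
      simp [Finset.disjoint_left, h1, h2, h3, h4]
    have hsub : ∀ {a b c d e : V}, (a = c ∨ a = d ∨ a = e) → (b = c ∨ b = d ∨ b = e) →
        ({a, b} : Finset V) ⊆ {c, d, e} := by
      intro a b c d e h1 h2 x hx
      simp only [Finset.mem_insert, Finset.mem_singleton] at *
      rcases hx with rfl | rfl <;> assumption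
    rcases lt_trichotomy r s with hrs | hrs | hrs
    · obtain ⟨p, hp, hp'⟩ := chords_cross hl hi hj hk hm hr0 hrs hs1 hwk hwm
      exact R.convexHull_inter_eq_empty h'.1 h.1 (hsub (by simp) (by simp))
        (hsub (by simp) (by simp)) (hdisj hik hij hkm.symm hmj) hp hp'
    · subst hrs
      refine hkm (drawing_inj hl hk hm ?_)
      rw [← hwm] at hwk
      exact sub_left_injective hwk
    · obtain ⟨p, hp, hp'⟩ := chords_cross hl hi hj hm hk hs0 hrs hr1 hwm hwk
      exact R.convexHull_inter_eq_empty h.1 h'.1 (hsub (by simp) (by simp))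
        (hsub (by simp) (by simp)) (hdisj him hij hkm hjk.symm) hp hp'

end IdealRealization

end Drawing

end

noncomputable section

/-! ### Scale factors of two realizations -/

section Scale

variable {V : Type*} [Fintype V] [DecidableEq V] {T : SphereTriangulation V} {M : CuspMetric T}

/-- The Euclidean midpoint of an edge. -/
def midPt (i j : V) : V → ℝ := (1 / 2 : ℝ) • vertexPt i + (1 / 2 : ℝ) • vertexPt j

theorem midPt_mem {t : Finset V} {i j : V} (hi : i ∈ t) (hj : j ∈ t) (hij : i ≠ j) :
    midPt i j ∈ puncturedSimplex t := by
  refine ⟨convex_simplexSet _ (vertexPt_mem_simplexSet hi) (vertexPt_mem_simplexSet hj)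
    (by norm_num) (by norm_num) (by norm_num), ?_⟩
  rintro ⟨a, ha⟩
  have h1 := congrFun ha i
  have h2 := congrFun ha j
  by_cases hai : a = i
  · subst hai
    simp [midPt, vertexPt, hij] at h1
  · simp [midPt, vertexPt, Ne.symm hai, hij] at h1

namespace IdealRealization

variable (R R' : IdealRealization T M)

/-- The factor by which the horospherical functions of the vertex `i` differ. -/
def scale (i : V) : ℝ := scaleAt R'.toFun R.toFun i (midPt i (T.exists_edge i).choose)

/-- Within one triangle the factor is constant. Consecutive triangles around `i` share an edge,
whose midpoint links their factors, and the link is connected. -/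
theorem scale_eq {t : Finset V} (ht : t ∈ T.faces) {i : V} (hi : i ∈ t) {x : V → ℝ}
    (hx : x ∈ puncturedSimplex t) : scaleAt R'.toFun R.toFun i x = R.scale R' i := by
  have key : ∀ j k, T.Edge i j → T.Edge i k →
      scaleAt R'.toFun R.toFun i (midPt i j) = scaleAt R'.toFun R.toFun i (midPt i k) := by
    rintro j k ⟨j', hj⟩ ⟨k', hk⟩
    have hpath := T.link_connected i j k ⟨_, hj, by simp, by simp⟩ ⟨_, hk, by simp, by simp⟩
      (T.ne_of_mem_faces hj).1.symm (T.ne_of_mem_faces hk).1.symm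
    clear hj hk
    induction hpath with
    | refl => rfl
    | @tail a b _ hab ih =>
      obtain ⟨h1, h2, h3⟩ := T.ne_of_mem_faces hab
      rw [ih]
      exact (R.sameMetric R' hab).scaleAt_eq (R'.isIdealMap hab) (R.isIdealMap hab) (by simp)
        (midPt_mem (by simp) (by simp) h1) (midPt_mem (by simp) (by simp) h2)
  obtain ⟨j, hj, hji⟩ := Finset.exists_mem_ne (by rw [T.card_of_mem_faces t ht]; norm_num) i
  have hE : T.Edge i j := by
    obtain ⟨k, hk⟩ := T.exists_third ht hi hj hji.symm
    exact ⟨k, hk ▸ ht⟩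
  rw [(R.sameMetric R' ht).scaleAt_eq (R'.isIdealMap ht) (R.isIdealMap ht) hi hx
    (midPt_mem hi hj hji.symm)]
  exact key j _ hE (T.exists_edge i).choose_spec

theorem scale_pos (i : V) : 0 < R.scale R' i := by
  obtain ⟨t, ht, hi⟩ := T.exists_face i
  obtain ⟨x, hx⟩ := puncturedSimplex_nonempty ht
  rw [← R.scale_eq R' ht hi hx]
  exact scaleAt_pos (R'.isIdealMap ht) (R.isIdealMap ht) hi hx

theorem one_sub_inner_eq {i j : V} (h : T.Edge i j) :
    1 - inner ℝ (R'.idealPt i) (R'.idealPt j) =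
      R.scale R' i * R.scale R' j * (1 - inner ℝ (R.idealPt i) (R.idealPt j)) := by
  obtain ⟨k, hk⟩ := h
  obtain ⟨x, hx⟩ := puncturedSimplex_nonempty hk
  rw [← R.scale_eq R' hk (i := i) (by simp) hx, ← R.scale_eq R' hk (i := j) (by simp) hx]
  exact (R.sameMetric R' hk).one_sub_inner (R'.isIdealMap hk) (R.isIdealMap hk) (by simp) (by simp)
    hx

theorem toFun_eq_sum_reweight {t : Finset V} (ht : t ∈ T.faces) {x w : V → ℝ}
    (hx : x ∈ simplexSet t) (hw : w ∈ simplexSet t)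
    (h : R.toFun x = ∑ a ∈ t, w a • R.idealPt a) :
    R'.toFun x = ∑ a ∈ t, reweight t (R.scale R') w a • R'.idealPt a :=
  (R.sameMetric R' ht).eq_sum_reweight (R'.isIdealMap ht) (R.isIdealMap ht)
    (R.injOn_toFun.mono (T.simplexSet_subset ht)) (fun _ hi _ hx => R.scale_eq R' ht hi hx)
    (fun i _ => R.scale_pos R' i) hx hw h

end IdealRealization

end Scale

end

noncomputable section

/-! ### The similarity of the drawings -/

section Similarity

variable {V : Type*} [Fintype V] [DecidableEq V] {T : SphereTriangulation V} {M : CuspMetric T}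

/-- Needed to normalize the second drawing so that the conformal factor is trivial at the neighbors
of `l`. -/
theorem IsDrawing.const_mul {O : V → V → V → Prop} {l : V} {z : V → ℂ} (hz : IsDrawing O l z)
    {c : ℂ} (hc : c ≠ 0) : IsDrawing O l (fun i => c * z i) := by
  have hr : ∀ i j k, (c * z k - c * z i) / (c * z j - c * z i) = (z k - z i) / (z j - z i) := by
    intro i j k
    rw [← mul_sub, ← mul_sub, mul_div_mul_left _ _ hc]
  refine ⟨fun hi hj h => hz.inj hi hj (mul_left_cancel₀ hc h), ?_, ?_, ?_, ?_⟩
  · intro i j k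
    rw [hr]
    exact hz.im_nonneg
  · intro i j k j' k' h h' hi hj hk hj' hk'
    rw [hr, hr]
    intro h1 h2 a b a' b' ha hb ha' hb' heq
    refine hz.disjoint h h' hi hj hk hj' hk' h1 h2 a b a' b' ha hb ha' hb'
      (mul_left_cancel₀ hc ?_)
    linear_combination heq
  · intro i j k j' k'
    rw [hr, hr]
    exact hz.pi_unique
  · intro i j k m h h' hi hj hk hm r s hr0 hr1 hs0 hs1 h1 h2
    refine hz.no_crossing h h' hi hj hk hm r s hr0 hr1 hs0 hs1 (mul_left_cancel₀ hc ?_)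
      (mul_left_cancel₀ hc ?_)
    · linear_combination h1
    · linear_combination h2

namespace IdealRealization

variable {R R' : IdealRealization T M} {l : V}

theorem height_eq_one_sub_inner (p : EuclideanSpace ℝ (Fin 3)) : height p = 1 - inner ℝ p north := by
  simp [height, inner3]

/-- Two realizations that are star-shaped with respect to the same ideal point and induce the same
orientation: their drawings are similar, and the scale factors are those of the similarity. -/
theorem exists_similarity (hl : R.idealPt l = north) (hl' : R'.idealPt l = north)
    (hs : StarConvex ℝ north R.body) (hs' : StarConvex ℝ north R'.body)
    (hO : ∀ i j k, R.Oriented i j k ↔ R'.Oriented i j k) :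
    ∃ (κ : ℝ) (u b : ℂ), 0 < κ ∧ ‖u‖ = 1 ∧ R.scale R' l * κ = 1 ∧ ∀ i, i ≠ l →
      R'.drawing i = κ * u * R.drawing i + b ∧
      R.scale R' i * height (R.idealPt i) = κ * height (R'.idealPt i) := by
  -- The law `one_sub_inner_eq` on an edge from a neighbor to `l` reads heights, since `l` is at
  -- `north`, and yields exactly this value of `τ` at the neighbor.
  set κ := (R.scale R' l)⁻¹ with hκd
  have hκ : 0 < κ := inv_pos.2 (R.scale_pos R' l)
  have hκl : R.scale R' l * κ = 1 := mul_inv_cancel₀ (R.scale_pos R' l).ne'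
  set τ : V → ℝ := fun i => R.scale R' i * height (R.idealPt i) / height (R'.idealPt i) with hτd
  have hτ : ∀ i, i ≠ l → 0 < τ i := fun i hi =>
    div_pos (mul_pos (R.scale_pos R' i) (height_pos hl hi)) (height_pos hl' hi)
  have hκc : (κ : ℂ)⁻¹ ≠ 0 := inv_ne_zero (Complex.ofReal_ne_zero.2 hκ.ne')
  have hO' : R.Oriented = R'.Oriented := by
    funext i j k
    exact propext (hO i j k)
  have hz := isDrawing hl hs
  have hz' : IsDrawing R.Oriented l (fun i => (κ : ℂ)⁻¹ * R'.drawing i) := by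
    rw [hO']
    exact (isDrawing hl' hs').const_mul hκc
  have hd : ∀ i j, dist ((κ : ℂ)⁻¹ * R'.drawing i) ((κ : ℂ)⁻¹ * R'.drawing j) =
      κ⁻¹ * dist (R'.drawing i) (R'.drawing j) := by
    intro i j
    rw [dist_eq_norm, ← mul_sub, norm_mul, norm_inv, Complex.norm_real, Real.norm_eq_abs,
      abs_of_pos hκ, dist_eq_norm]
  -- Passing from `1 - inner` to distances of projections divides by the heights, which `τ` absorbs.
  have hdist : ∀ i j, T.Edge i j → i ≠ l → j ≠ l → dist (R'.drawing i) (R'.drawing j) ^ 2 =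
      dist (R.drawing i) (R.drawing j) ^ 2 * (τ i * τ j) := by
    intro i j hE hi hj
    have h1 := (height_pos hl hi).ne'
    have h2 := (height_pos hl hj).ne'
    have h3 := (height_pos hl' hi).ne'
    have h4 := (height_pos hl' hj).ne'
    rw [drawing, drawing, drawing, drawing, dist_proj_sq (R.norm_idealPt i) (R.norm_idealPt j) h1 h2,
      dist_proj_sq (R'.norm_idealPt i) (R'.norm_idealPt j) h3 h4, R.one_sub_inner_eq R' hE, hτd]
    field_simp
  have hδ : ∀ i, i ≠ l → τ i = κ := by
    intro i hi
    have h0 : Real.log (τ i / κ) = 0 := by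
      refine hz.conformal_factor_eq_zero R.isOrientation hz' (δ := fun i => Real.log (τ i / κ))
        ?_ ?_ hi
      · intro i j hE hi hj
        rw [hd]
        refine (pow_left_inj₀ (by positivity) (by positivity) two_ne_zero).1 ?_
        rw [mul_pow, hdist i j hE hi hj, mul_pow, ← Real.exp_nat_mul]
        have : ((2 : ℕ) : ℝ) * ((Real.log (τ i / κ) + Real.log (τ j / κ)) / 2) =
            Real.log (τ i / κ) + Real.log (τ j / κ) := by push_cast; ring
        rw [this, Real.exp_add, Real.exp_log (div_pos (hτ i hi) hκ),
          Real.exp_log (div_pos (hτ j hj) hκ)]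
        field_simp
      · intro i hE
        have h1 := R.one_sub_inner_eq R' hE
        rw [hl, hl', ← height_eq_one_sub_inner, ← height_eq_one_sub_inner] at h1
        have h2 := (height_pos hl' hE.ne).ne'
        have h3 : τ i = κ := by
          rw [hτd]
          simp only
          rw [div_eq_iff h2, h1]
          linear_combination -(R.scale R' i * height (R.idealPt i)) * hκl
        change Real.log (τ i / κ) = 0
        rw [h3, div_self hκ.ne', Real.log_one]
    rcases Real.log_eq_zero.1 h0 with h | h | h
    · exact absurd h (div_pos (hτ i hi) hκ).ne'
    · rwa [div_eq_one_iff_eq hκ.ne'] at h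
    · have := div_pos (hτ i hi) hκ
      linarith
  obtain ⟨u, b, hu, hub⟩ := hz.exists_isometry R.isOrientation hz' (fun i j hE hi hj => by
    rw [hd]
    refine (pow_left_inj₀ (by positivity) (by positivity) two_ne_zero).1 ?_
    rw [mul_pow, hdist i j hE hi hj, hδ i hi, hδ j hj]
    field_simp)
  refine ⟨κ, u, κ * b, hκ, hu, hκl, fun i hi => ⟨?_, ?_⟩⟩
  · have h1 := hub i hi
    have h2 : (κ : ℂ) ≠ 0 := Complex.ofReal_ne_zero.2 hκ.ne'
    rw [inv_mul_eq_iff_eq_mul₀ h2] at h1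
    rw [h1]
    ring
  · have h1 := hδ i hi
    rw [hτd] at h1
    simp only at h1
    rwa [div_eq_iff (height_pos hl' hi).ne'] at h1

end IdealRealization

end Similarity

end

noncomputable section

/-! ### Similarities of the plane as isometries of hyperbolic space -/

/-- The square of the height coordinate in the half-space model with `north` at infinity. -/
def tau (p : EuclideanSpace ℝ (Fin 3)) : ℝ := (1 - ‖p‖ ^ 2) / height p ^ 2

/-- The point with given half-space coordinates. -/
def halfPt (z : ℂ) (τ : ℝ) : EuclideanSpace ℝ (Fin 3) := ptOf z (2 / (1 + τ + Complex.normSq z))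

/-- The extension of the similarity `z ↦ κ u z + b` to hyperbolic space. -/
def simMap (κ : ℝ) (u b : ℂ) (p : EuclideanSpace ℝ (Fin 3)) : EuclideanSpace ℝ (Fin 3) :=
  halfPt (κ * u * proj p + b) (κ ^ 2 * tau p)

theorem tau_nonneg {p : EuclideanSpace ℝ (Fin 3)} (hp : ‖p‖ ≤ 1) : 0 ≤ tau p :=
  div_nonneg (by nlinarith [norm_nonneg p]) (sq_nonneg _)

/-- The Minkowski product in half-space coordinates. It gives the formula of `hypDist_eq_half`, in
which invariance under similarities is visible. -/
theorem one_sub_inner_eq_height {p q : EuclideanSpace ℝ (Fin 3)} (hp : height p ≠ 0)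
    (hq : height q ≠ 0) : 2 * (1 - inner ℝ p q) =
      height p * height q * (tau p + tau q + Complex.normSq (proj p - proj q)) := by
  have h1 : ∀ p : EuclideanSpace ℝ (Fin 3), ‖p‖ ^ 2 = p 0 ^ 2 + p 1 ^ 2 + p 2 ^ 2 := by
    intro p
    rw [← real_inner_self_eq_norm_sq, inner3]; ring
  have hp2 : p 2 = 1 - height p := by unfold height; ring
  have hq2 : q 2 = 1 - height q := by unfold height; ring
  rw [Complex.normSq_apply, tau, tau, h1, h1, inner3]
  simp only [Complex.sub_re, Complex.sub_im, proj, hp2, hq2]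
  field_simp
  ring

theorem one_add_tau {p : EuclideanSpace ℝ (Fin 3)} (hp : height p ≠ 0) :
    height p * (1 + tau p + Complex.normSq (proj p)) = 2 := by
  have h1 : ‖p‖ ^ 2 = p 0 ^ 2 + p 1 ^ 2 + p 2 ^ 2 := by
    rw [← real_inner_self_eq_norm_sq, inner3]; ring
  have hp2 : p 2 = 1 - height p := by unfold height; ring
  rw [Complex.normSq_apply, tau, h1]
  simp only [proj, hp2]
  field_simp
  ring

theorem halfPt_eq {p : EuclideanSpace ℝ (Fin 3)} (hp : height p ≠ 0) :
    halfPt (proj p) (tau p) = p := by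
  have h := one_add_tau hp
  have h0 : 1 + tau p + Complex.normSq (proj p) ≠ 0 := by
    intro h0
    rw [h0] at h
    norm_num at h
  rw [halfPt, ← h, mul_div_cancel_right₀ _ h0, ptOf_proj hp]

theorem height_halfPt_pos {z : ℂ} {τ : ℝ} (hτ : 0 ≤ τ) : 0 < height (halfPt z τ) := by
  have := Complex.normSq_nonneg z
  rw [halfPt, height_ptOf]
  positivity

theorem proj_halfPt {z : ℂ} {τ : ℝ} (hτ : 0 ≤ τ) : proj (halfPt z τ) = z := by
  have h := height_halfPt_pos (z := z) hτ
  rw [halfPt, height_ptOf] at h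
  exact proj_ptOf h.ne'

theorem tau_halfPt {z : ℂ} {τ : ℝ} (hτ : 0 ≤ τ) : tau (halfPt z τ) = τ := by
  have h := one_add_tau (height_halfPt_pos (z := z) hτ).ne'
  have hn := Complex.normSq_nonneg z
  rw [proj_halfPt hτ, halfPt, height_ptOf, ← halfPt, div_mul_eq_mul_div,
    div_eq_iff (by positivity)] at h
  linarith

theorem height_pos_of_mem {p : EuclideanSpace ℝ (Fin 3)} (hp : p ∈ hypSpace 3) : 0 < height p := by
  rw [mem_hypSpace] at hp
  exact height_pos_of_norm_le hp.le fun h => by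
    rw [h, norm_north] at hp
    exact lt_irrefl _ hp

theorem tau_pos {p : EuclideanSpace ℝ (Fin 3)} (hp : p ∈ hypSpace 3) : 0 < tau p :=
  div_pos (by nlinarith [norm_nonneg p, mem_hypSpace.1 hp]) (pow_pos (height_pos_of_mem hp) 2)

theorem halfPt_mem {z : ℂ} {τ : ℝ} (hτ : 0 < τ) : halfPt z τ ∈ hypSpace 3 := by
  have h := tau_halfPt (z := z) hτ.le
  have h1 := height_halfPt_pos (z := z) hτ.le
  rw [tau, div_eq_iff (pow_pos h1 2).ne'] at h
  have h2 : 0 < τ * height (halfPt z τ) ^ 2 := by positivity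
  rw [mem_hypSpace]
  nlinarith [norm_nonneg (halfPt z τ)]

theorem hypDist_eq_half {p q : EuclideanSpace ℝ (Fin 3)} (hp : p ∈ hypSpace 3)
    (hq : q ∈ hypSpace 3) : hypDist p q = Real.arcosh
      ((tau p + tau q + Complex.normSq (proj p - proj q)) / (2 * (√(tau p) * √(tau q)))) := by
  have h1 := height_pos_of_mem hp
  have h2 := height_pos_of_mem hq
  have hs : ∀ {p : EuclideanSpace ℝ (Fin 3)}, 0 < height p →
      √(1 - ‖p‖ ^ 2) = height p * √(tau p) := by
    intro p hp
    have : 1 - ‖p‖ ^ 2 = height p ^ 2 * tau p := by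
      rw [tau, mul_div_cancel₀ _ (pow_pos hp 2).ne']
    rw [this, Real.sqrt_mul (sq_nonneg _), Real.sqrt_sq hp.le]
  have h3 : 1 - inner ℝ p q = height p * height q *
      (tau p + tau q + Complex.normSq (proj p - proj q)) / 2 := by
    rw [← one_sub_inner_eq_height h1.ne' h2.ne']
    ring
  have h4 := Real.sqrt_pos.2 (tau_pos hp)
  have h5 := Real.sqrt_pos.2 (tau_pos hq)
  rw [hypDist, hs h1, hs h2, h3]
  congr 1
  field_simp

section SimMap

variable {κ : ℝ} {u b : ℂ}

theorem simMap_mem (hκ : 0 < κ) {p : EuclideanSpace ℝ (Fin 3)} (hp : p ∈ hypSpace 3) :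
    simMap κ u b p ∈ hypSpace 3 :=
  halfPt_mem (mul_pos (pow_pos hκ 2) (tau_pos hp))

theorem simMap_inverse (hκ : 0 < κ) (hu : ‖u‖ = 1) {p : EuclideanSpace ℝ (Fin 3)}
    (hp : height p ≠ 0) (hp1 : ‖p‖ ≤ 1) :
    simMap κ⁻¹ u⁻¹ (-(κ * u)⁻¹ * b) (simMap κ u b p) = p := by
  have hu0 : u ≠ 0 := fun h => by simp [h] at hu
  have hκ0 : (κ : ℂ) ≠ 0 := Complex.ofReal_ne_zero.2 hκ.ne'
  have h1 : 0 ≤ κ ^ 2 * tau p := mul_nonneg (sq_nonneg _) (tau_nonneg hp1)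
  rw [simMap, simMap, proj_halfPt h1, tau_halfPt h1]
  refine Eq.trans ?_ (halfPt_eq hp)
  congr 1
  · push_cast
    field_simp
    ring
  · field_simp

theorem simMap_inverse' (hκ : 0 < κ) (hu : ‖u‖ = 1) {p : EuclideanSpace ℝ (Fin 3)}
    (hp : height p ≠ 0) (hp1 : ‖p‖ ≤ 1) :
    simMap κ u b (simMap κ⁻¹ u⁻¹ (-(κ * u)⁻¹ * b) p) = p := by
  have hu0 : u ≠ 0 := fun h => by simp [h] at hu
  have hκ0 : (κ : ℂ) ≠ 0 := Complex.ofReal_ne_zero.2 hκ.ne'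
  have h := simMap_inverse (b := -(κ * u)⁻¹ * b) (inv_pos.2 hκ) (u := u⁻¹) (by simp [hu]) hp hp1
  convert h using 1
  congr 1
  · rw [inv_inv]
  · rw [inv_inv]
  · push_cast
    field_simp

theorem isHypIsometry_simMap (hκ : 0 < κ) (hu : ‖u‖ = 1) : IsHypIsometry (simMap κ u b) := by
  constructor
  · have hinv : Set.InvOn (simMap κ⁻¹ u⁻¹ (-(κ * u)⁻¹ * b)) (simMap κ u b) (hypSpace 3)
        (hypSpace 3) :=
      ⟨fun p hp => simMap_inverse hκ hu (height_pos_of_mem hp).ne' (mem_hypSpace.1 hp).le,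
        fun p hp => simMap_inverse' hκ hu (height_pos_of_mem hp).ne' (mem_hypSpace.1 hp).le⟩
    exact hinv.bijOn (fun p hp => simMap_mem hκ hp) fun p hp => simMap_mem (inv_pos.2 hκ) hp
  · intro p hp q hq
    have h1 := (mul_pos (pow_pos hκ 2) (tau_pos hp)).le
    have h2 := (mul_pos (pow_pos hκ 2) (tau_pos hq)).le
    rw [hypDist_eq_half (simMap_mem hκ hp) (simMap_mem hκ hq), hypDist_eq_half hp hq]
    simp only [simMap]
    rw [proj_halfPt h1, proj_halfPt h2, tau_halfPt h1, tau_halfPt h2,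
      add_sub_add_right_eq_sub, ← mul_sub, map_mul, map_mul, Complex.normSq_ofReal,
      Complex.normSq_eq_norm_sq u, hu, Real.sqrt_mul (sq_nonneg _), Real.sqrt_mul (sq_nonneg _),
      Real.sqrt_sq hκ.le]
    congr 1
    have h4 := Real.sqrt_pos.2 (tau_pos hp)
    have h5 := Real.sqrt_pos.2 (tau_pos hq)
    field_simp

theorem height_sum {ι : Type*} (t : Finset ι) (w : ι → ℝ) (η : ι → EuclideanSpace ℝ (Fin 3))
    (hw : ∑ i ∈ t, w i = 1) : height (∑ i ∈ t, w i • η i) = ∑ i ∈ t, w i * height (η i) := by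
  simp only [IdealRealization.height_eq_one_sub_inner]
  exact one_sub_inner_sum' t w η north hw

/-- The horizontal part of a point, as a complex number. -/
def horizontal : EuclideanSpace ℝ (Fin 3) →ₗ[ℝ] ℂ where
  toFun p := ⟨p 0, p 1⟩
  map_add' p q := by apply Complex.ext <;> simp
  map_smul' r p := by apply Complex.ext <;> simp

theorem horizontal_eq {p : EuclideanSpace ℝ (Fin 3)} (hp : height p ≠ 0) :
    horizontal p = height p * proj p := by
  apply Complex.ext
  · simp [horizontal, proj, mul_div_cancel₀ _ hp]
  · simp [horizontal, proj, mul_div_cancel₀ _ hp]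

theorem eq_simMap {p q : EuclideanSpace ℝ (Fin 3)} (hq : height q ≠ 0)
    (hproj : proj q = κ * u * proj p + b) (htau : tau q = κ ^ 2 * tau p) : q = simMap κ u b p := by
  rw [simMap, ← hproj, ← htau, halfPt_eq hq]

end SimMap

/-! ### The surface and the body under the extended similarity -/

section Body

variable {V : Type*} [Fintype V] [DecidableEq V] {T : SphereTriangulation V} {M : CuspMetric T}

namespace IdealRealization

variable {R R' : IdealRealization T M} {l : V}

theorem norm_toFun_le {x : V → ℝ} (hx : x ∈ T.carrier) : ‖R.toFun x‖ ≤ 1 := by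
  by_cases h : x ∈ Set.range (vertexPt (V := V))
  · obtain ⟨i, rfl⟩ := h
    exact (R.norm_vertex i).le
  · exact (mem_hypSpace.1 (R.mapsTo_hypSpace ⟨hx, h⟩)).le

/-- On every triangle, the second realization is the image of the first one under the extension of
the similarity. -/
theorem toFun_eq_simMap (hl : R.idealPt l = north) (hl' : R'.idealPt l = north) {κ : ℝ} {u b : ℂ}
    (hκ : 0 < κ) (hsim : ∀ i, i ≠ l → R'.drawing i = κ * u * R.drawing i + b ∧
      R.scale R' i * height (R.idealPt i) = κ * height (R'.idealPt i))
    {x : V → ℝ} (hx : x ∈ T.carrier) (hxl : x ≠ vertexPt l) :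
    R'.toFun x = simMap κ u b (R.toFun x) := by
  obtain ⟨t, ht, hxt⟩ := Set.mem_iUnion₂.1 hx
  have hmem : R.toFun x ∈ convexHull ℝ (R.idealPt '' (t : Set V)) := by
    rw [← R.image_simplexSet ht subset_rfl]
    exact ⟨x, hxt, rfl⟩
  obtain ⟨c, hc, hcx⟩ := (mem_convexHull_image_iff _ _ _).1 hmem
  have hx' := R.toFun_eq_sum_reweight R' ht hxt hc hcx
  set σ := R.scale R' with hσ
  have hσ0 : ∀ i, 0 < σ i := R.scale_pos R'
  set c' := reweight t σ c with hc'd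
  have hc' : c' ∈ simplexSet t := reweight_mem subset_rfl (fun i _ => hσ0 i) hc
  have h1 := sum_simplexSet hc
  have h1' := sum_simplexSet hc'
  set S := ∑ b ∈ t, c b / σ b with hS
  have hca : ∀ a, c' a = c a / σ a / S := fun a => rfl
  have hS0 : S ≠ 0 := by
    intro h0
    rw [Finset.sum_congr rfl fun a _ => hca a, h0] at h1'
    simp at h1'
  have hh : ∀ a, height (R'.idealPt a) = σ a * height (R.idealPt a) / κ := by
    intro a
    by_cases ha : a = l
    · subst ha
      rw [hl, hl']
      simp [height]
    · rw [(hsim a ha).2, mul_div_cancel_left₀ _ hκ.ne']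
  -- Height and horizontal part are linear in the weights, and `1 - ‖·‖ ^ 2` is quadratic. Hence all
  -- three are compared vertex by vertex, and they determine the half-space coordinates. The vertex
  -- `l` contributes zero to the first two sums.
  have hH : height (R'.toFun x) = height (R.toFun x) / (S * κ) := by
    rw [hx', hcx, height_sum t c' _ h1', height_sum t c _ h1, Finset.sum_div]
    refine Finset.sum_congr rfl fun a _ => ?_
    have := (hσ0 a).ne'
    rw [hca, hh]
    field_simp
  have hne : R.toFun x ≠ north := fun h =>
    hxl (R.injOn_toFun hx (T.vertexPt_mem l) (h.trans hl.symm))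
  have hp := (height_pos_of_norm_le (norm_toFun_le hx) hne).ne'
  have hp' : height (R'.toFun x) ≠ 0 := by
    rw [hH]
    exact div_ne_zero hp (mul_ne_zero hS0 hκ.ne')
  have hhor : horizontal (R'.toFun x) =
      ((S * κ : ℝ) : ℂ)⁻¹ * (κ * u * horizontal (R.toFun x) + b * height (R.toFun x)) := by
    have hκc : (κ : ℂ) ≠ 0 := Complex.ofReal_ne_zero.2 hκ.ne'
    have hSc : (S : ℂ) ≠ 0 := Complex.ofReal_ne_zero.2 hS0
    rw [hx', hcx, height_sum t c _ h1, map_sum, map_sum, Complex.ofReal_sum, Finset.mul_sum,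
      Finset.mul_sum, ← Finset.sum_add_distrib, Finset.mul_sum]
    refine Finset.sum_congr rfl fun a _ => ?_
    have hσc : (σ a : ℂ) ≠ 0 := Complex.ofReal_ne_zero.2 (hσ0 a).ne'
    rw [map_smul, map_smul, Complex.real_smul, Complex.real_smul, hca]
    by_cases ha : a = l
    · subst ha
      rw [hl, hl']
      have : horizontal north = 0 := by apply Complex.ext <;> simp [horizontal]
      simp [this, height]
    · rw [horizontal_eq (height_pos hl ha).ne', horizontal_eq (height_pos hl' ha).ne', hh]
      have h2 := (hsim a ha).1
      rw [drawing, drawing] at h2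
      rw [h2]
      push_cast
      field_simp
  have hsq : 1 - ‖R'.toFun x‖ ^ 2 = (1 - ‖R.toFun x‖ ^ 2) / S ^ 2 := by
    rw [← real_inner_self_eq_norm_sq, ← real_inner_self_eq_norm_sq, hx', hcx,
      one_sub_inner_sum' t c' _ _ h1', one_sub_inner_sum' t c _ _ h1, Finset.sum_div]
    refine Finset.sum_congr rfl fun a ha => ?_
    rw [one_sub_inner_sum t c' _ _ h1', one_sub_inner_sum t c _ _ h1, Finset.mul_sum,
      Finset.mul_sum, Finset.sum_div]
    refine Finset.sum_congr rfl fun d hd => ?_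
    by_cases had : a = d
    · subst had
      rw [real_inner_self_eq_norm_sq, real_inner_self_eq_norm_sq, R.norm_idealPt, R'.norm_idealPt]
      simp
    · obtain ⟨k, hk⟩ := T.exists_third ht ha hd had
      have h2 := (hσ0 a).ne'
      have h3 := (hσ0 d).ne'
      rw [R.one_sub_inner_eq R' ⟨k, hk ▸ ht⟩, ← hσ, hca, hca]
      field_simp
  refine eq_simMap hp' ?_ ?_
  · have h2 := hhor
    rw [horizontal_eq hp', horizontal_eq hp, hH] at h2
    have hpc : (height (R.toFun x) : ℂ) ≠ 0 := Complex.ofReal_ne_zero.2 hp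
    have hκc : (κ : ℂ) ≠ 0 := Complex.ofReal_ne_zero.2 hκ.ne'
    have hSc : (S : ℂ) ≠ 0 := Complex.ofReal_ne_zero.2 hS0
    push_cast at h2
    field_simp at h2
    linear_combination h2
  · rw [tau, tau, hsq, hH]
    field_simp

/-- A point of the body lies on a segment from `north` to a point of the surface. -/
theorem exists_frontier_above (R : IdealRealization T M) {p : EuclideanSpace ℝ (Fin 3)}
    (hp : p ∈ R.body) (hne : p ≠ north) :
    ∃ x ∈ T.carrier, ∃ r : ℝ, 1 ≤ r ∧ R.toFun x = north + r • (p - north) := by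
  have hv : p - north ≠ 0 := sub_ne_zero.2 hne
  set g : ℝ → EuclideanSpace ℝ (Fin 3) := fun r => north + r • (p - north) with hg
  have hgc : Continuous g := by fun_prop
  -- The last point of the ray from `north` through `p` that belongs to the body is a frontier
  -- point.
  set A : Set ℝ := {r | 1 ≤ r ∧ g r ∈ R.body} with hA
  have hAc : IsClosed A := (isClosed_Ici (a := (1 : ℝ))).inter (R.isClosed_body.preimage hgc)
  have h1A : (1 : ℝ) ∈ A := ⟨le_rfl, by simpa [hg] using hp⟩
  obtain ⟨C, hC⟩ := R.isCompact_body.isBounded.exists_norm_le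
  have hAb : BddAbove A := by
    refine ⟨(C + ‖north‖) / ‖p - north‖, fun r hr => ?_⟩
    have h2 := hC _ hr.2
    rw [le_div_iff₀ (norm_pos_iff.2 hv)]
    have h3 : r • (p - north) = g r - north := by simp [hg]
    have h4 : ‖r • (p - north)‖ ≤ ‖g r‖ + ‖north‖ := by rw [h3]; exact norm_sub_le _ _
    rw [norm_smul, Real.norm_eq_abs, abs_of_nonneg (by linarith [hr.1])] at h4
    linarith
  have hmem : sSup A ∈ A := hAc.csSup_mem ⟨1, h1A⟩ hAb
  have hfr : g (sSup A) ∈ frontier R.body := by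
    refine ⟨subset_closure hmem.2, fun hint => ?_⟩
    have h2 : ∀ᶠ r in nhds (sSup A), g r ∈ R.body := by
      have := hgc.continuousAt.preimage_mem_nhds (isOpen_interior.mem_nhds hint)
      filter_upwards [this] with r hr using interior_subset hr
    obtain ⟨ε, hε, h3⟩ := Metric.eventually_nhds_iff.1 h2
    have h4 : sSup A + ε / 2 ∈ A := by
      refine ⟨by linarith [hmem.1], h3 ?_⟩
      rw [Real.dist_eq, add_sub_cancel_left, abs_of_pos (by linarith)]
      linarith
    linarith [le_csSup hAb h4]
  rw [R.frontier_body] at hfr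
  obtain ⟨x, hx, hxg⟩ := hfr
  exact ⟨x, hx, _, hmem.1, hxg⟩

/-- The extended similarity preserves vertical lines and the order on them. The surface point below
`p` goes to the other surface, and star-shapedness then brings in the whole segment from there to
`north`. -/
theorem simMap_mem_body (hl : R.idealPt l = north) (hs' : StarConvex ℝ north R'.body) {κ : ℝ}
    {u b : ℂ} (hκ : 0 < κ)
    (hf : ∀ x ∈ T.carrier, x ≠ vertexPt l → R'.toFun x = simMap κ u b (R.toFun x))
    {p : EuclideanSpace ℝ (Fin 3)} (hp : p ∈ R.body ∩ hypSpace 3) :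
    simMap κ u b p ∈ R'.body ∩ hypSpace 3 := by
  refine ⟨?_, simMap_mem hκ hp.2⟩
  have hpos := height_pos_of_mem hp.2
  obtain ⟨x, hx, r, hr, hxr⟩ := R.exists_frontier_above hp.1 fun h => by
    rw [h] at hpos
    simp [height] at hpos
  have hr0 : 0 < r := by linarith
  set q := R.toFun x with hq
  have hqp : q = ptOf (proj p) (r * height p) := by
    rw [ptOf_smul, ptOf_proj hpos.ne', hxr]
  have hqh : height q = r * height p := by rw [hqp, height_ptOf]
  have hqpos : 0 < height q := by rw [hqh]; positivity
  have hqproj : proj q = proj p := by rw [hqp, proj_ptOf (by positivity)]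
  have hxl : x ≠ vertexPt l := by
    rintro rfl
    rw [hq, show R.toFun (vertexPt l) = north from hl] at hqpos
    simp [height] at hqpos
  have hq' : simMap κ u b q ∈ R'.body := by
    rw [← hf x hx hxl]
    refine R'.isClosed_body.frontier_subset ?_
    rw [R'.frontier_body]
    exact ⟨x, hx, rfl⟩
  have htq := tau_nonneg (norm_toFun_le (R := R) hx)
  have htp := (tau_pos hp.2).le
  have hle : tau q ≤ tau p := by
    have h1 := one_add_tau hpos.ne'
    have h2 := one_add_tau hqpos.ne'
    rw [hqproj, hqh] at h2
    have h4 : r * (1 + tau q + Complex.normSq (proj p)) = 1 + tau p + Complex.normSq (proj p) := by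
      refine mul_left_cancel₀ hpos.ne' ?_
      rw [h1, ← h2]
      ring
    have h5 : 0 ≤ 1 + tau q + Complex.normSq (proj p) := by
      have := Complex.normSq_nonneg (proj p)
      positivity
    nlinarith [mul_nonneg (sub_nonneg.2 hr) h5]
  set z := (κ : ℂ) * u * proj p + b with hz
  have hn := Complex.normSq_nonneg z
  set α := 2 / (1 + κ ^ 2 * tau p + Complex.normSq z) with hα
  set β := 2 / (1 + κ ^ 2 * tau q + Complex.normSq z) with hβ
  have hβ0 : 0 < β := by positivity
  have hα0 : 0 < α := by positivity
  have hαβ : α ≤ β := by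
    rw [hα, hβ]
    gcongr
  have h1 : simMap κ u b p = north + (α / β) • (simMap κ u b q - north) := by
    have h2 : simMap κ u b q = ptOf z β := by
      rw [simMap, halfPt, hqproj]
    rw [h2, ← ptOf_smul, div_mul_cancel₀ _ hβ0.ne']
    rfl
  rw [h1]
  have h3 := hs' hq' (a := 1 - α / β) (b := α / β)
    (sub_nonneg.2 ((div_le_one hβ0).2 hαβ)) (by positivity) (by ring)
  convert h3 using 1
  module

theorem exists_isometry_of_normalized (hl : R.idealPt l = north) (hl' : R'.idealPt l = north)
    (hs : StarConvex ℝ north R.body) (hs' : StarConvex ℝ north R'.body)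
    (hO : ∀ i j k, R.Oriented i j k ↔ R'.Oriented i j k) :
    ∃ φ : EuclideanSpace ℝ (Fin 3) → EuclideanSpace ℝ (Fin 3), IsHypIsometry φ ∧
      (∀ x ∈ T.punctured, R'.toFun x = φ (R.toFun x)) ∧
      φ '' (R.body ∩ hypSpace 3) = R'.body ∩ hypSpace 3 := by
  obtain ⟨κ, u, b, hκ, hu, -, hsim⟩ := exists_similarity hl hl' hs hs' hO
  have hf : ∀ x ∈ T.carrier, x ≠ vertexPt l → R'.toFun x = simMap κ u b (R.toFun x) :=
    fun x hx hxl => toFun_eq_simMap hl hl' hκ hsim hx hxl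
  have hf' : ∀ x ∈ T.carrier, x ≠ vertexPt l →
      R.toFun x = simMap κ⁻¹ u⁻¹ (-(κ * u)⁻¹ * b) (R'.toFun x) := by
    intro x hx hxl
    have hne : R.toFun x ≠ north := fun h =>
      hxl (R.injOn_toFun hx (T.vertexPt_mem l) (h.trans hl.symm))
    have hle := norm_toFun_le (R := R) hx
    rw [hf x hx hxl, simMap_inverse hκ hu (height_pos_of_norm_le hle hne).ne' hle]
  refine ⟨simMap κ u b, isHypIsometry_simMap hκ hu, fun x hx => hf x hx.1 ?_, ?_⟩
  · rintro rfl
    exact hx.2 ⟨l, rfl⟩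
  · refine Set.Subset.antisymm ?_ ?_
    · rintro _ ⟨p, hp, rfl⟩
      exact simMap_mem_body hl hs' hκ hf hp
    · intro p hp
      refine ⟨_, simMap_mem_body hl' hs (inv_pos.2 hκ) hf' hp, ?_⟩
      exact simMap_inverse' hκ hu (height_pos_of_mem hp.2).ne' (mem_hypSpace.1 hp.2).le

end IdealRealization

end Body

end

noncomputable section

open Filter Topology

/-! ### Rotations of a realization -/

section Rotation

variable {V : Type*} [Fintype V] [DecidableEq V] {T : SphereTriangulation V} {M : CuspMetric T}

theorem hypDist_map {n : ℕ} (g : EuclideanSpace ℝ (Fin n) ≃ₗᵢ[ℝ] EuclideanSpace ℝ (Fin n))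
    (x y : EuclideanSpace ℝ (Fin n)) : hypDist (g x) (g y) = hypDist x y := by
  simp only [hypDist, g.inner_map_map, g.norm_map]

theorem map_mem_hypSpace {n : ℕ} (g : EuclideanSpace ℝ (Fin n) ≃ₗᵢ[ℝ] EuclideanSpace ℝ (Fin n))
    {x : EuclideanSpace ℝ (Fin n)} : g x ∈ hypSpace n ↔ x ∈ hypSpace n := by
  simp only [mem_hypSpace, g.norm_map]

theorem IsHypIsometry.of_linear {n : ℕ}
    (g : EuclideanSpace ℝ (Fin n) ≃ₗᵢ[ℝ] EuclideanSpace ℝ (Fin n)) : IsHypIsometry g :=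
  ⟨⟨fun _ hx => (map_mem_hypSpace g).2 hx, g.injective.injOn, fun y hy =>
    ⟨g.symm y, (map_mem_hypSpace g.symm).2 hy, g.apply_symm_apply y⟩⟩,
    fun x _ y _ => hypDist_map g x y⟩

theorem IsHypIsometry.comp {n : ℕ} {φ ψ : EuclideanSpace ℝ (Fin n) → EuclideanSpace ℝ (Fin n)}
    (hφ : IsHypIsometry φ) (hψ : IsHypIsometry ψ) : IsHypIsometry (φ ∘ ψ) :=
  ⟨hφ.1.comp hψ.1, fun x hx y hy =>
    (hφ.2 _ (hψ.1.mapsTo hx) _ (hψ.1.mapsTo hy)).trans (hψ.2 x hx y hy)⟩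

namespace IdealRealization

/-- The image of a realization under a linear isometry. -/
def map (R : IdealRealization T M)
    (g : EuclideanSpace ℝ (Fin 3) ≃ₗᵢ[ℝ] EuclideanSpace ℝ (Fin 3)) : IdealRealization T M where
  toFun := g ∘ R.toFun
  continuousOn_toFun := g.continuous.comp_continuousOn R.continuousOn_toFun
  injOn_toFun := g.injective.comp_injOn R.injOn_toFun
  norm_vertex i := by rw [Function.comp_apply, g.norm_map, R.norm_vertex]
  mapsTo_hypSpace _ hx := (map_mem_hypSpace g).2 (R.mapsTo_hypSpace hx)
  isometric t ht x hx y hy := (hypDist_map g _ _).trans (R.isometric t ht x hx y hy)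
  body := g '' R.body
  isCompact_body := R.isCompact_body.image g.continuous
  closure_interior_body := by
    have h1 := g.toHomeomorph.image_interior R.body
    have h2 := g.toHomeomorph.image_closure (interior R.body)
    rw [h1, R.closure_interior_body] at h2
    exact h2.symm
  frontier_body := by
    have h := g.toHomeomorph.image_frontier R.body
    rw [R.frontier_body, ← Set.image_comp] at h
    exact h.symm

variable (R R' : IdealRealization T M)
  (g : EuclideanSpace ℝ (Fin 3) ≃ₗᵢ[ℝ] EuclideanSpace ℝ (Fin 3))

theorem idealPt_map (i : V) : (R.map g).idealPt i = g (R.idealPt i) := rfl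

theorem starConvex_map {p : EuclideanSpace ℝ (Fin 3)} (h : StarConvex ℝ p R.body) :
    StarConvex ℝ (g p) (R.map g).body := h.linear_image g.toLinearEquiv.toLinearMap

theorem body_map_inter : (R.map g).body ∩ hypSpace 3 = g '' (R.body ∩ hypSpace 3) := by
  rw [Set.image_inter g.injective, (IsHypIsometry.of_linear g).1.image_eq]
  rfl

/-- Realizations that differ by an isometry of hyperbolic space. -/
def Congruent (R R' : IdealRealization T M) : Prop :=
  ∃ φ : EuclideanSpace ℝ (Fin 3) → EuclideanSpace ℝ (Fin 3), IsHypIsometry φ ∧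
    (∀ x ∈ T.punctured, R'.toFun x = φ (R.toFun x)) ∧
    φ '' (R.body ∩ hypSpace 3) = R'.body ∩ hypSpace 3

variable {R R' g}

theorem Congruent.of_map_left (h : (R.map g).Congruent R') : R.Congruent R' := by
  obtain ⟨φ, h1, h2, h3⟩ := h
  refine ⟨φ ∘ g, h1.comp (IsHypIsometry.of_linear g), h2, ?_⟩
  rw [Set.image_comp, ← body_map_inter, h3]

theorem Congruent.of_map_right (h : R.Congruent (R'.map g)) : R.Congruent R' := by
  obtain ⟨φ, h1, h2, h3⟩ := h
  refine ⟨g.symm ∘ φ, (IsHypIsometry.of_linear g.symm).comp h1, fun x hx => ?_, ?_⟩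
  · rw [Function.comp_apply, ← h2 x hx]
    exact (g.symm_apply_apply _).symm
  · rw [Set.image_comp, h3, body_map_inter, ← Set.image_comp]
    simp

/-- The reflection in a plane through `north`. -/
def flip : EuclideanSpace ℝ (Fin 3) ≃ₗᵢ[ℝ] EuclideanSpace ℝ (Fin 3) :=
  LinearIsometryEquiv.piLpCongrRight 2 fun i : Fin 3 =>
    if i = 0 then LinearIsometryEquiv.neg ℝ else LinearIsometryEquiv.refl ℝ ℝ

theorem flip_zero (p : EuclideanSpace ℝ (Fin 3)) : flip p 0 = -p 0 := by simp [flip]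

theorem flip_one (p : EuclideanSpace ℝ (Fin 3)) : flip p 1 = p 1 := by simp [flip]

theorem flip_two (p : EuclideanSpace ℝ (Fin 3)) : flip p 2 = p 2 := by simp [flip]

theorem flip_north : flip north = north :=
  ext3 (by simp [flip_zero]) (by simp [flip_one]) (by simp [flip_two])

/-- A reflection changes the sign of the triple product; exchanging `j` and `k` compensates for it.
-/
theorem faceFun_flip (i j k : V) (p : EuclideanSpace ℝ (Fin 3)) :
    (R.map flip).faceFun i j k (flip p) = R.faceFun i k j p := by
  rw [R.faceFun_swap i j k]
  simp only [faceFun, idealPt_map, planeFun_eq, inner3, cross3_zero, cross3_one, cross3_two,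
    PiLp.sub_apply, flip_zero, flip_one, flip_two, Pi.neg_apply]
  ring

theorem Oriented.of_flip {i j k : V} (h : (R.map flip).Oriented i j k) : R.Oriented i k j := by
  have hf := h.1
  have hp := (R.map flip).center_mem hf
  have h1 := h.2 _ hp
  have hc := R.center_mem hf
  rw [← triple_swap] at hf hc
  refine oriented_of_innerAt hf hc ?_
  simp only [idealPt_map, ← map_smul, ← map_add] at h1
  have h2 := flip.continuous.continuousAt.eventually h1
  filter_upwards [h2] with q hq
  rw [faceFun_flip] at hq
  refine ⟨fun hq0 => ?_, fun hq0 hqB => hq.2 hq0 ⟨q, hqB, rfl⟩⟩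
  have h3 : flip q ∈ interior (flip '' R.body) := hq.1 hq0
  have h4 := flip.toHomeomorph.image_interior R.body
  have h5 : flip q ∈ flip '' interior R.body := by
    change flip q ∈ flip.toHomeomorph '' interior R.body
    rw [h4]
    exact h3
  exact (flip.injective.mem_set_image).1 h5

theorem oriented_flip_iff {i j k : V} : (R.map flip).Oriented i j k ↔ R.Oriented i k j := by
  refine ⟨Oriented.of_flip, fun h => ?_⟩
  have hf := h.1
  rw [triple_swap] at hf
  exact ((R.map flip).oriented_or hf).resolve_right fun h' => h'.of_flip.not_swap h

theorem exists_linearIsometry {v w : EuclideanSpace ℝ (Fin 3)} (h : ‖v‖ = ‖w‖) :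
    ∃ g : EuclideanSpace ℝ (Fin 3) ≃ₗᵢ[ℝ] EuclideanSpace ℝ (Fin 3), g v = w :=
  ⟨_, Submodule.reflection_sub h⟩

/-- Linear isometries normalize the position of `l`, and a reflection fixing `north` corrects
opposite orientations. These moves are composed into the final isometry. -/
theorem congruent_of_starConvex {l : V} (h : R.IsStarShapedAt l) (h' : R'.IsStarShapedAt l) :
    R.Congruent R' := by
  have hrot : ∀ R : IdealRealization T M, R.IsStarShapedAt l →
      ∃ g : EuclideanSpace ℝ (Fin 3) ≃ₗᵢ[ℝ] EuclideanSpace ℝ (Fin 3),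
        (R.map g).idealPt l = north ∧ StarConvex ℝ north (R.map g).body := by
    intro R h
    obtain ⟨g, hg⟩ := exists_linearIsometry ((R.norm_idealPt l).trans norm_north.symm)
    refine ⟨g, hg, ?_⟩
    rw [← hg]
    exact R.starConvex_map g h
  obtain ⟨g, hl, hs⟩ := hrot R h
  obtain ⟨g', hl', hs'⟩ := hrot R' h'
  refine Congruent.of_map_left (g := g) (Congruent.of_map_right (g := g') ?_)
  rcases (R.map g).isOrientation.agree_or_opposite (R'.map g').isOrientation with hO | hO
  · exact exists_isometry_of_normalized hl hl' hs hs' hO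
  · refine Congruent.of_map_right (g := flip) (exists_isometry_of_normalized hl ?_ hs ?_ ?_)
    · rw [idealPt_map, hl', flip_north]
    · have := (R'.map g').starConvex_map flip hs'
      rwa [flip_north] at this
    · intro i j k
      rw [hO, oriented_flip_iff]

end IdealRealization

end Rotation

end

theorem mainTheorem10 {V : Type*} [Fintype V] [DecidableEq V]
    (T : SphereTriangulation V) (M : CuspMetric T) (l : V)
    (R R' : IdealRealization T M) (hR : R.IsStarShapedAt l) (hR' : R'.IsStarShapedAt l) :
    ∃ φ : EuclideanSpace ℝ (Fin 3) → EuclideanSpace ℝ (Fin 3), IsHypIsometry φ ∧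
      (∀ x ∈ T.punctured, R'.toFun x = φ (R.toFun x)) ∧
      φ '' (R.body ∩ hypSpace 3) = R'.body ∩ hypSpace 3 :=
  IdealRealization.congruent_of_starConvex hR hR'
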